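/- Let $K$ be a field of characteristic $0$ which is complete with respect to a nontrivial nonarchimedean absolute value. *Manifold* means: paracompact Hausdorff finite dimensional locally $K$-analytic manifold. Let $V$ be a separated locally convex $K$-vector space, let $G$ be a locally $K$-analytic Lie group, and let $\rho\colon G\to \mathrm{Aut}(V)$ be a locally analytic representation, i.e. $G$ acts by continuous linear automorphisms and all orbit maps $g\mapsto gv$ are analytic in the following sense. A BH-space of $V$ is a $K$-Banach space $W$ with a continuous linear injection $W\hookrightarrow V$. A map $f\colon X\to V$ from a manifold is *analytic* if locally on $X$ it factors through a locally analytic map into some BH-space of $V$; it is *admissible* if both $f$ and $\hat f\colon G\times X\to V$, $(g,x)\mapsto g f(x)$, are analytic. For manifolds $X,Y$, a *$V$-valued relative $k$-form* $\omega$ on $X\times Y/X$ is a family of alternating $K$-multilinear maps $\omega_{(x,y)}\colon (T_yY)^k\to V$, $(x,y)\in X\times Y$. It is *analytic* if for every open $U\subseteq X\times Y$ and all analytic sections $\xi_1,\dots,\xi_k$ over $U$ of the vertical tangent bundle $T(X\times Y/X)$ the function $\omega(\xi_1,\dots,\xi_k)\colon U\to V$ is analytic. It is *admissible* if it is analytic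 and the relative form $\hat\omega_{(g,x,y)}=g\,\omega_{(x,y)}$ on $G\times X\times Y/G\times X$ is analytic as well. Let $\Omega^k_{ad}(X\times Y/X,V)$ be the group of admissible relative $k$-forms and $d$ the exterior derivative along $Y$; it preserves admissibility. Consider the category of manifolds and locally analytic maps as a site with the topology of open coverings. For a manifold $Y$ let $\Omega^k_{ad}(Y,V)$ be the abelian sheaf $X\mapsto\Omega^k_{ad}(X\times Y/X,V)$ on this site, so that $(\Omega^*_{ad}(Y,V),d)$ is a complex of abelian sheaves in degrees $\ge 0$, and let $C^{lc}_{ad}(Y,V)$ be the abelian sheaf which sends $X$ to the group of admissible functions $f\colon X\times Y\to V$ that are locally constant along $Y$, i.e. such that each point of $X\times Y$ has a neighbourhood $X'\times Y'$ on which $f$ factors through the projection $X'\times Y'\to X'$. Then for every manifold $Y$ the inclusion $$C^{lc}_{ad}(Y,V)\longrightarrow \Omega^*_{ad}(Y,V),$$ where the left hand side is placed in degree $0$, is a quasi-isomorphism of complexes of abelian sheaves on the site of manifolds. -/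

import Mathlib

open CategoryTheory
open scoped Manifold ContDiff Topology

universe u

set_option linter.unusedSectionVars false

noncomputable section

/-! ### Analytic functions with values in a locally convex space -/

/-- A BH-space for the topological vector space `V`: a (nonarchimedean) Banach space `W` together
with a continuous linear injection `W → V`. -/
structure BHSpace (K : Type u) [NontriviallyNormedField K] (V : Type u) [AddCommGroup V]
    [Module K V] [TopologicalSpace V] where
  carrier : Type u
  [normedAddCommGroup : NormedAddCommGroup carrier]
  [normedSpace : NormedSpace K carrier]
  [isUltrametricDist : IsUltrametricDist carrier]
  [completeSpace : CompleteSpace carrier]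
  incl : carrier →L[K] V
  injective : Function.Injective incl

attribute [instance] BHSpace.normedAddCommGroup BHSpace.normedSpace BHSpace.isUltrametricDist
  BHSpace.completeSpace

section AnalyticFunctions

variable {K : Type u} [NontriviallyNormedField K]
  {V : Type u} [AddCommGroup V] [Module K V] [TopologicalSpace V]
  {E : Type*} [NormedAddCommGroup E] [NormedSpace K E] {H : Type*} [TopologicalSpace H]
  (I : ModelWithCorners K E H) {M : Type*} [TopologicalSpace M] [ChartedSpace H M]
  {E' : Type*} [NormedAddCommGroup E'] [NormedSpace K E'] {H' : Type*} [TopologicalSpace H']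
  {I' : ModelWithCorners K E' H'} {M' : Type*} [TopologicalSpace M'] [ChartedSpace H' M']

variable (K) in
/-- `f : M → V` is analytic near `x`: on some neighbourhood of `x` it factors through an analytic
map into a BH-space for `V`. -/
def VAnalyticAt (f : M → V) (x : M) : Prop :=
  ∃ U ∈ 𝓝 x, ∃ (W : BHSpace K V) (h : M → W.carrier),
    ContMDiffOn I 𝓘(K, W.carrier) ω h U ∧ ∀ z ∈ U, f z = W.incl (h z)

variable (K) in
/-- Analytic functions from the manifold `M` to `V`. -/
def VAnalytic (f : M → V) : Prop :=
  ∀ x, VAnalyticAt K I f x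

variable {I}

theorem vAnalyticAt_iff [IsManifold I ω M] {f : M → V} {x : M} :
    VAnalyticAt K I f x ↔ ∃ (W : BHSpace K V) (h : M → W.carrier),
      ContMDiffAt I 𝓘(K, W.carrier) ω h x ∧ ∀ᶠ z in 𝓝 x, f z = W.incl (h z) := by
  constructor
  · rintro ⟨U, hU, W, h, hh, he⟩
    exact ⟨W, h, hh.contMDiffAt hU, Filter.mem_of_superset hU he⟩
  · rintro ⟨W, h, hh, he⟩
    obtain ⟨U, hU, hUh⟩ := (contMDiffAt_iff_contMDiffOn_nhds (by simp)).1 hh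
    exact ⟨U ∩ {z | f z = W.incl (h z)}, Filter.inter_mem hU he, W, h,
      hUh.mono Set.inter_subset_left, fun z hz => hz.2⟩

theorem VAnalyticAt.comp [IsManifold I ω M] [IsManifold I' ω M'] {f : M → V} {φ : M' → M} {x : M'}
    (hf : VAnalyticAt K I f (φ x)) (hφ : ContMDiffAt I' I ω φ x) :
    VAnalyticAt K I' (fun z => f (φ z)) x := by
  rw [vAnalyticAt_iff] at hf ⊢
  obtain ⟨W, h, hh, he⟩ := hf
  exact ⟨W, fun z => h (φ z), hh.comp x hφ, hφ.continuousAt.eventually he⟩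

theorem VAnalyticAt.congr [IsManifold I ω M] {f g : M → V} {x : M}
    (hf : VAnalyticAt K I f x) (h : ∀ᶠ z in 𝓝 x, g z = f z) : VAnalyticAt K I g x := by
  rw [vAnalyticAt_iff] at hf ⊢
  obtain ⟨W, k, hk, he⟩ := hf
  exact ⟨W, k, hk, by filter_upwards [h, he] with z h1 h2 using h1.trans h2⟩

theorem VAnalyticAt.const_smul [IsManifold I ω M] {f : M → V} {x : M} (c : K)
    (hf : VAnalyticAt K I f x) : VAnalyticAt K I (fun z => c • f z) x := by
  rw [vAnalyticAt_iff] at hf ⊢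
  obtain ⟨W, h, hh, he⟩ := hf
  refine ⟨W, fun z => c • h z,
    (c • ContinuousLinearMap.id K W.carrier).contMDiff.contMDiffAt.comp x hh, ?_⟩
  filter_upwards [he] with z hz
  rw [hz, map_smul]

theorem vAnalyticAt_zero {x : M} : VAnalyticAt K I (fun _ => (0 : V)) x :=
  ⟨Set.univ, Filter.univ_mem,
    { carrier := PUnit, isUltrametricDist := ⟨fun _ _ _ => by simp⟩, incl := 0, injective := Function.injective_of_subsingleton _ },
    fun _ => 0, contMDiffOn_const, fun _ _ => rfl⟩

theorem isUltrametricDist_quotient {W : Type*} [NormedAddCommGroup W] [NormedSpace K W]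
    [IsUltrametricDist W] (S : Submodule K W) [IsClosed (S : Set W)] :
    IsUltrametricDist (W ⧸ S) := by
  refine IsUltrametricDist.isUltrametricDist_of_forall_norm_add_le_max_norm fun x y => ?_
  refine le_of_forall_pos_lt_add fun ε hε => ?_
  obtain ⟨a, rfl, ha⟩ := Submodule.Quotient.norm_mk_lt x hε
  obtain ⟨b, rfl, hb⟩ := Submodule.Quotient.norm_mk_lt y hε
  rw [← Submodule.Quotient.mk_add]
  calc _ ≤ ‖a + b‖ := Submodule.Quotient.norm_mk_le S (a + b)
    _ ≤ max ‖a‖ ‖b‖ := IsUltrametricDist.norm_add_le_max a b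
    _ < _ := by
      rw [← max_add_add_right]
      exact max_lt_max ha hb

variable [IsTopologicalAddGroup V] [T2Space V]

/-- The sum, inside `V`, of finitely many BH-spaces. -/
theorem exists_bhSpace_sum {ι : Type} [Fintype ι] (W : ι → BHSpace K V) :
    ∃ (W' : BHSpace K V) (j : ∀ i, (W i).carrier →L[K] W'.carrier),
      ∀ i w, W'.incl (j i w) = (W i).incl w := by
  classical
  let T : (∀ i, (W i).carrier) →L[K] V := ∑ i, (W i).incl ∘L ContinuousLinearMap.proj i
  have : IsClosed ((LinearMap.ker T.toLinearMap : Submodule K _) : Set (∀ i, (W i).carrier)) :=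
    T.isClosed_ker
  let S : Submodule K (∀ i, (W i).carrier) := LinearMap.ker T.toLinearMap
  have hS : IsClosed (S : Set (∀ i, (W i).carrier)) := T.isClosed_ker
  have hu : IsUltrametricDist ((∀ i, (W i).carrier) ⧸ S) := isUltrametricDist_quotient S
  let T' : ((∀ i, (W i).carrier) ⧸ S) →L[K] V :=
    ⟨S.liftQ T.toLinearMap le_rfl, T.continuous.quotient_lift _⟩
  have hinj : Function.Injective T' := by
    have h : LinearMap.ker T'.toLinearMap = ⊥ := Submodule.ker_liftQ_eq_bot _ _ _ le_rfl
    exact LinearMap.ker_eq_bot.1 h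
  refine ⟨⟨(∀ i, (W i).carrier) ⧸ S, T', hinj⟩,
    fun i => S.mkQL ∘L ContinuousLinearMap.single K (fun i => (W i).carrier) i,
    fun i w => ?_⟩
  change T (Pi.single i w) = _
  simp only [T, _root_.sum_apply, ContinuousLinearMap.comp_apply,
    ContinuousLinearMap.proj_apply]
  rw [Finset.sum_eq_single i]
  · simp
  · intro k _ hk
    simp [Pi.single_eq_of_ne hk]
  · simp

theorem VAnalyticAt.common [IsManifold I ω M] {ι : Type} [Fintype ι] {f : ι → M → V} {x : M}
    (hf : ∀ i, VAnalyticAt K I (f i) x) :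
    ∃ (W : BHSpace K V) (h : ι → M → W.carrier),
      (∀ i, ContMDiffAt I 𝓘(K, W.carrier) ω (h i) x) ∧
        ∀ᶠ z in 𝓝 x, ∀ i, f i z = W.incl (h i z) := by
  simp only [vAnalyticAt_iff] at hf
  choose W h hh he using hf
  obtain ⟨W', j, hj⟩ := exists_bhSpace_sum W
  refine ⟨W', fun i z => j i (h i z), fun i => ?_, ?_⟩
  · exact (j i).contMDiff.contMDiffAt.comp x (hh i)
  · rw [Filter.eventually_all]
    intro i
    filter_upwards [he i] with z hz
    rw [hj, hz]

theorem VAnalyticAt.add [IsManifold I ω M] {f g : M → V} {x : M}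
    (hf : VAnalyticAt K I f x) (hg : VAnalyticAt K I g x) :
    VAnalyticAt K I (fun z => f z + g z) x := by
  obtain ⟨W, h, hh, he⟩ := VAnalyticAt.common (ι := Bool) (f := fun b => if b then f else g)
    (x := x) (I := I) (K := K) (by simp [hf, hg])
  rw [vAnalyticAt_iff]
  refine ⟨W, fun z => h true z + h false z, (hh true).add (hh false), ?_⟩
  filter_upwards [he] with z hz
  have h1 := hz true
  have h2 := hz false
  simp only [if_true, Bool.false_eq_true, if_false] at h1 h2
  rw [h1, h2, map_add]

end AnalyticFunctions

/-! ### Relative differential forms on `B × Y / B` -/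

section Forms

variable {K : Type u} [NontriviallyNormedField K]
  {V : Type u} [AddCommGroup V] [Module K V] [TopologicalSpace V]
  {EB : Type*} [NormedAddCommGroup EB] [NormedSpace K EB] {HB : Type*} [TopologicalSpace HB]
  (I : ModelWithCorners K EB HB) {B : Type*} [TopologicalSpace B] [ChartedSpace HB B]
  {F : Type*} [NormedAddCommGroup F] [NormedSpace K F]
  {Y : Type*} [TopologicalSpace Y] [ChartedSpace F Y] {k : ℕ}

variable (K F Y V k) in
/-- Not necessarily continuous families, indexed by the points `y` of `Y`, of alternating `k`-forms
on the tangent space of `Y` at `y` with values in `V`. -/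
abbrev VForm : Type _ :=
  ∀ y : Y, (TangentSpace 𝓘(K, F) y) [⋀^Fin k]→ₗ[K] V

/-- A relative `k`-form `η` on `B × Y / B`, i.e. a family of alternating maps `η b y` on
`T_{(b, y)}(B × Y / B) = T_y Y`, is analytic if evaluating it on local analytic sections of the
vertical tangent bundle gives analytic functions. Such a section over `U` is an analytic map
`U → T Y` lying over the projection `U → Y`. -/
def IsAnalyticForm [IsManifold 𝓘(K, F) ω Y] (η : B → VForm K V F Y k) : Prop :=
  ∀ (U : Set (B × Y)), IsOpen U →
    ∀ φ : Fin k → ∀ p : B × Y, TangentSpace 𝓘(K, F) p.2,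
      (∀ i, ContMDiffOn (I.prod 𝓘(K, F)) 𝓘(K, F).tangent ω
        (fun p => (⟨p.2, φ i p⟩ : TangentBundle 𝓘(K, F) Y)) U) →
      ∀ p ∈ U, VAnalyticAt K (I.prod 𝓘(K, F)) (fun p : B × Y => η p.1 p.2 fun i => φ i p) p

/-- The pullback of a form on `Y` along the inverse of the preferred chart at `y₀`. -/
def chartForm (η : VForm K V F Y k) (y₀ : Y) (x : F) : F [⋀^Fin k]→ₗ[K] V :=
  (η ((extChartAt 𝓘(K, F) y₀).symm x)).compLinearMap
    (mfderiv 𝓘(K, F) 𝓘(K, F) (extChartAt 𝓘(K, F) y₀).symm x).toLinearMap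

/-- `D v w` is the derivative in direction `v` at `x` of the coefficient function
`x' ↦ η x' w`, for all `w`. -/
def IsFormFDeriv (η : F → F [⋀^Fin k]→ₗ[K] V) (x : F) (D : F →ₗ[K] F [⋀^Fin k]→ₗ[K] V) : Prop :=
  ∀ w, ∃ A : F →L[K] V, HasFDerivAt (fun x' => η x' w) A x ∧ ∀ v, A v = D v w

open Classical in
/-- The derivative of a form on `F`; by convention zero where some coefficient function is not
differentiable. -/
def formFDeriv (η : F → F [⋀^Fin k]→ₗ[K] V) (x : F) : F →ₗ[K] F [⋀^Fin k]→ₗ[K] V :=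
  if h : ∃ D, IsFormFDeriv η x D then h.choose else 0

/-- The exterior derivative of a form on `F`:
`(dη)(x)(v₀, …, v_k) = ∑ i, (-1)^i (∂_{v_i} η)(x)(v₀, …, v_{i-1}, v_{i+1}, …, v_k)`. -/
def vExtDeriv (η : F → F [⋀^Fin k]→ₗ[K] V) (x : F) : F [⋀^Fin (k + 1)]→ₗ[K] V :=
  AlternatingMap.alternatizeUncurryFin (formFDeriv η x)

/-- The exterior derivative of a form on `Y`. At `y` it is computed in the preferred chart at `y`,
whose derivative at `y` is the identification of `T_y Y` with the model space `F`. -/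
def formD (η : VForm K V F Y k) : VForm K V F Y (k + 1) :=
  fun y => (vExtDeriv (chartForm η y) (extChartAt 𝓘(K, F) y y) : F [⋀^Fin (k + 1)]→ₗ[K] V)

end Forms

section FormLemmas

variable {K : Type u} [NontriviallyNormedField K]
  {V : Type u} [AddCommGroup V] [Module K V] [TopologicalSpace V]
  {F : Type*} [NormedAddCommGroup F] [NormedSpace K F] {k : ℕ}

theorem HasFDerivAt.clm_comp_tvs {W : Type*} [NormedAddCommGroup W] [NormedSpace K W]
    {h : F → W} {h' : F →L[K] W} {x : F} (hh : HasFDerivAt h h' x) (A : W →L[K] V) :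
    HasFDerivAt (fun z => A (h z)) (A ∘L h') x := by
  rw [hasFDerivAt_iff_isLittleOTVS] at hh ⊢
  have := (A.isBigOTVS_comp (f := fun x' => h x' - h x - h' (x' - x)) (l := 𝓝 x)).trans_isLittleOTVS
    hh
  simpa [Function.comp_def] using this

theorem HasFDerivAt.clm_comp_tvs' {h : F → V} {h' : F →L[K] V} {x : F} (hh : HasFDerivAt h h' x)
    (A : V →L[K] V) : HasFDerivAt (fun z => A (h z)) (A ∘L h') x := by
  rw [hasFDerivAt_iff_isLittleOTVS] at hh ⊢
  have := (A.isBigOTVS_comp (f := fun x' => h x' - h x - h' (x' - x)) (l := 𝓝 x)).trans_isLittleOTVS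
    hh
  simpa [Function.comp_def] using this

theorem IsFormFDeriv.clm_comp {η : F → F [⋀^Fin k]→ₗ[K] V} {x : F}
    {D : F →ₗ[K] F [⋀^Fin k]→ₗ[K] V} (h : IsFormFDeriv η x D) (A : V →L[K] V) :
    IsFormFDeriv (fun z => A.toLinearMap.compAlternatingMap (η z)) x
      (A.toLinearMap.compAlternatingMapₗ K ∘ₗ D) := fun w => by
  obtain ⟨B, hB, hB'⟩ := h w
  exact ⟨A ∘L B, hB.clm_comp_tvs' A, fun v => by simp [hB']⟩

variable [IsTopologicalAddGroup V] [ContinuousSMul K V]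

theorem HasFDerivAt.add_tvs {f g : F → V} {f' g' : F →L[K] V} {x : F} (hf : HasFDerivAt f f' x)
    (hg : HasFDerivAt g g' x) : HasFDerivAt (fun z => f z + g z) (f' + g') x := by
  rw [hasFDerivAt_iff_isLittleOTVS] at hf hg ⊢
  refine (hf.add hg).congr_left fun z => ?_
  simp only [Pi.add_apply, _root_.add_apply]
  abel

theorem IsFormFDeriv.add {η θ : F → F [⋀^Fin k]→ₗ[K] V} {x : F}
    {D D' : F →ₗ[K] F [⋀^Fin k]→ₗ[K] V} (h : IsFormFDeriv η x D) (h' : IsFormFDeriv θ x D') :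
    IsFormFDeriv (fun z => η z + θ z) x (D + D') := fun w => by
  obtain ⟨A, hA, hA'⟩ := h w
  obtain ⟨A₂, hA₂, hA₂'⟩ := h' w
  exact ⟨A + A₂, hA.add_tvs hA₂, fun v => by simp [hA', hA₂']⟩

variable [T2Space V]

theorem IsFormFDeriv.formFDeriv_eq {η : F → F [⋀^Fin k]→ₗ[K] V} {x : F}
    {D : F →ₗ[K] F [⋀^Fin k]→ₗ[K] V} (h : IsFormFDeriv η x D) : formFDeriv η x = D := by
  have hex : ∃ D, IsFormFDeriv η x D := ⟨D, h⟩
  rw [formFDeriv, dif_pos hex]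
  ext v w
  obtain ⟨A, hA, hA'⟩ := h w
  obtain ⟨A₂, hA₂, hA₂'⟩ := hex.choose_spec w
  rw [← hA' v, ← hA₂' v, hA.unique hA₂]

end FormLemmas

section Coefficients

variable {K : Type u} [NontriviallyNormedField K] [CompleteSpace K]
  {F : Type*} [NormedAddCommGroup F] [NormedSpace K F] [FiniteDimensional K F]
  {W : Type*} [NormedAddCommGroup W] [NormedSpace K W] {k : ℕ}

variable (K F) in
/-- The normalized alternatization of the product of the coordinate functions with indices `r`. -/
def elemForm (r : Fin k → Fin (Module.finrank K F)) : F [⋀^Fin k]→L[K] K :=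
  ((k.factorial : K)⁻¹) • ContinuousMultilinearMap.alternatization
    ((ContinuousMultilinearMap.mkPiAlgebra K (Fin k) K).compContinuousLinearMap
      fun i => LinearMap.toContinuousLinearMap ((Module.finBasis K F).coord (r i)))

variable (K F) in
def elemCLM (r : Fin k → Fin (Module.finrank K F)) : W →L[K] (F [⋀^Fin k]→L[K] W) :=
  ((ContinuousLinearMap.compContinuousAlternatingMapCLM K F K W (Fin k)).flip (elemForm K F r)) ∘L
    (ContinuousLinearMap.smulRightL K K W 1)

theorem alternating_eq_of_basis [CharZero K] {V : Type*} [AddCommGroup V] [Module K V]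
    (A : F [⋀^Fin k]→ₗ[K] V) (ι : W →ₗ[K] V) (h : (Fin k → Fin (Module.finrank K F)) → W)
    (hA : ∀ r, A (fun i => Module.finBasis K F (r i)) = ι (h r)) (w : Fin k → F) :
    A w = ι ((∑ r, elemCLM K F r (h r)) w) := by
  have key : ∀ w : Fin k → F, A w =
      ∑ r : Fin k → Fin (Module.finrank K F),
        (∏ i, (Module.finBasis K F).coord (r i) (w i)) • ι (h r) := by
    intro w
    have hw : w = fun i => ∑ j, (Module.finBasis K F).coord j (w i) • Module.finBasis K F j := by
      funext i
      exact ((Module.finBasis K F).sum_repr (w i)).symm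
    conv_lhs => rw [hw]
    have := A.toMultilinearMap.map_sum
      (fun i j => (Module.finBasis K F).coord j (w i) • Module.finBasis K F j)
    refine this.trans (Finset.sum_congr rfl fun r _ => ?_)
    rw [MultilinearMap.map_smul_univ]
    congr 1
    exact hA r
  have h1 : (k.factorial : K) • A w = ∑ σ : Equiv.Perm (Fin k), Equiv.Perm.sign σ • A (w ∘ σ) := by
    have := congrArg (fun B : F [⋀^Fin k]→ₗ[K] V => B w) (AlternatingMap.coe_alternatization A)
    simp only [MultilinearMap.alternatization_apply, Fintype.card_fin] at this
    rw [AlternatingMap.smul_apply] at this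
    rw [Nat.cast_smul_eq_nsmul, ← this]
    rfl
  have hk : (k.factorial : K) ≠ 0 := by exact_mod_cast k.factorial_ne_zero
  have h2 : A w = (k.factorial : K)⁻¹ •
      ∑ σ : Equiv.Perm (Fin k), Equiv.Perm.sign σ • A (w ∘ σ) := by
    rw [← h1, smul_smul, inv_mul_cancel₀ hk, one_smul]
  rw [h2]
  simp only [key]
  have h3 : ∀ r, (elemCLM K F r (h r)) w = (k.factorial : K)⁻¹ •
      ∑ σ : Equiv.Perm (Fin k), Equiv.Perm.sign σ •
        (∏ i, (Module.finBasis K F).coord (r i) ((w ∘ σ) i)) • h r := by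
    intro r
    simp [elemCLM, elemForm, ContinuousMultilinearMap.alternatization_apply_apply]
  simp only [ContinuousAlternatingMap.sum_apply, h3, map_sum, map_smul, Units.smul_def, map_zsmul,
    Finset.smul_sum]
  rw [Finset.sum_comm]

end Coefficients

section LocalRep

theorem ContMDiffAt.alternating_apply {K : Type u} [NontriviallyNormedField K] [CompleteSpace K]
    {F : Type*} [NormedAddCommGroup F] [NormedSpace K F] [FiniteDimensional K F]
    {W : Type*} [NormedAddCommGroup W] [NormedSpace K W] {k : ℕ}
    {E : Type*} [NormedAddCommGroup E] [NormedSpace K E] {H : Type*} [TopologicalSpace H]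
    {I : ModelWithCorners K E H} {M : Type*} [TopologicalSpace M] [ChartedSpace H M]
    {θ : M → F [⋀^Fin k]→L[K] W} {a : Fin k → M → F} {x : M}
    (hθ : ContMDiffAt I 𝓘(K, F [⋀^Fin k]→L[K] W) ω θ x)
    (ha : ∀ i, ContMDiffAt I 𝓘(K, F) ω (a i) x) :
    ContMDiffAt I 𝓘(K, W) ω (fun z => θ z fun i => a i z) x := by
  have key : (fun z => θ z fun i => a i z) = fun z =>
      ∑ r : Fin k → Fin (Module.finrank K F),
        (∏ i, LinearMap.toContinuousLinearMap ((Module.finBasis K F).coord (r i)) (a i z)) •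
          ContinuousAlternatingMap.apply K F W (fun i => Module.finBasis K F (r i)) (θ z) := by
    funext z
    have hw : (fun i => a i z) =
        fun i => ∑ j, (Module.finBasis K F).coord j (a i z) • Module.finBasis K F j := by
      funext i
      exact ((Module.finBasis K F).sum_repr (a i z)).symm
    rw [hw]
    have := (θ z).toMultilinearMap.map_sum
      (fun i j => (Module.finBasis K F).coord j (a i z) • Module.finBasis K F j)
    refine this.trans (Finset.sum_congr rfl fun r _ => ?_)
    rw [MultilinearMap.map_smul_univ]
    rfl
  rw [key]
  refine ContMDiffAt.sum fun r _ => ?_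
  have h1 : ContMDiffAt I 𝓘(K, K) ω (fun z => ∏ i,
      LinearMap.toContinuousLinearMap ((Module.finBasis K F).coord (r i)) (a i z)) x := by
    refine ContMDiffAt.prod fun i _ => ?_
    exact (ContinuousLinearMap.contMDiff _).contMDiffAt.comp x (ha i)
  refine ContMDiffAt.smul h1 ?_
  exact (ContinuousLinearMap.contMDiff _).contMDiffAt.comp x hθ

variable {K : Type u} [NontriviallyNormedField K]
  {V : Type u} [AddCommGroup V] [Module K V] [TopologicalSpace V]
  {EB : Type*} [NormedAddCommGroup EB] [NormedSpace K EB] {HB : Type*} [TopologicalSpace HB]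
  {I : ModelWithCorners K EB HB} {B : Type*} [TopologicalSpace B] [ChartedSpace HB B]
  {EB' : Type*} [NormedAddCommGroup EB'] [NormedSpace K EB'] {HB' : Type*} [TopologicalSpace HB']
  {I' : ModelWithCorners K EB' HB'} {B' : Type*} [TopologicalSpace B'] [ChartedSpace HB' B']
  {F : Type*} [NormedAddCommGroup F] [NormedSpace K F]
  {Y : Type*} [TopologicalSpace Y] [ChartedSpace F Y] {k : ℕ}

theorem chartForm_apply (η : VForm K V F Y k) (y₀ : Y) (x : F) (w : Fin k → F) :
    chartForm η y₀ x w = η ((extChartAt 𝓘(K, F) y₀).symm x)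
      (fun i => mfderiv 𝓘(K, F) 𝓘(K, F) (extChartAt 𝓘(K, F) y₀).symm x (w i)) := rfl

theorem mfderiv_extChartAt_symm_eq [IsManifold 𝓘(K, F) ω Y] {y₀ : Y} {x : F}
    (hx : x ∈ (extChartAt 𝓘(K, F) y₀).target) :
    mfderiv 𝓘(K, F) 𝓘(K, F) (extChartAt 𝓘(K, F) y₀).symm x =
      tangentCoordChange 𝓘(K, F) y₀ ((extChartAt 𝓘(K, F) y₀).symm x)
        ((extChartAt 𝓘(K, F) y₀).symm x) := by
  have h : MDifferentiableAt 𝓘(K, F) 𝓘(K, F) (extChartAt 𝓘(K, F) y₀).symm x :=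
    ((contMDiffOn_extChartAt_symm (n := ω) y₀).contMDiffAt
      ((isOpen_extChartAt_target y₀).mem_nhds hx)).mdifferentiableAt (by simp)
  have h2 : mfderiv 𝓘(K, F) 𝓘(K, F) (extChartAt 𝓘(K, F) y₀).symm x =
      (fderivWithin K (writtenInExtChartAt 𝓘(K, F) 𝓘(K, F) x (extChartAt 𝓘(K, F) y₀).symm)
        (Set.range 𝓘(K, F)) (extChartAt 𝓘(K, F) x x) : F →L[K] F) := if_pos h
  refine h2.trans ?_
  rw [tangentCoordChange_def, (extChartAt 𝓘(K, F) y₀).right_inv hx]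
  rfl

theorem mfderiv_extChartAt_symm_eq_symm [IsManifold 𝓘(K, F) ω Y] {y₀ : Y} {x : F}
    (hx : x ∈ (extChartAt 𝓘(K, F) y₀).target) (v : F) :
    mfderiv 𝓘(K, F) 𝓘(K, F) (extChartAt 𝓘(K, F) y₀).symm x v =
      (trivializationAt F (TangentSpace 𝓘(K, F)) y₀).symm ((extChartAt 𝓘(K, F) y₀).symm x) v := by
  have h := TangentBundle.symmL_trivializationAt_eq_core (I := 𝓘(K, F)) (b₀ := y₀)
    (b := (extChartAt 𝓘(K, F) y₀).symm x)
    (by simpa using (extChartAt 𝓘(K, F) y₀).map_target hx)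
  rw [mfderiv_extChartAt_symm_eq hx]
  refine (congrArg (fun A : F →L[K] F => A v) h).symm.trans ?_
  refine Bundle.Trivialization.symmL_apply _ ?_ v
  rw [TangentBundle.trivializationAt_baseSet]
  simpa using (extChartAt 𝓘(K, F) y₀).map_target hx

variable (I) in
/-- `θ` represents the relative form `η` near `(b₀, y₀)` in the preferred chart at `y₀`, through a
BH-space `W`. -/
def LocalRep (η : B → VForm K V F Y k) (b₀ : B) (y₀ : Y) (W : BHSpace K V)
    (θ : B × F → F [⋀^Fin k]→L[K] W.carrier) : Prop :=
  ContMDiffAt (I.prod 𝓘(K, F)) 𝓘(K, F [⋀^Fin k]→L[K] W.carrier) ω θ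
      (b₀, extChartAt 𝓘(K, F) y₀ y₀) ∧
    ∀ᶠ q in 𝓝 (b₀, extChartAt 𝓘(K, F) y₀ y₀),
      ∀ w, chartForm (η q.1) y₀ q.2 w = W.incl (θ q w)

theorem LocalRep.comp {η : B → VForm K V F Y k} {φ : B' → B} {b₀ : B'} {y₀ : Y} {W : BHSpace K V}
    {θ : B × F → F [⋀^Fin k]→L[K] W.carrier} (h : LocalRep I η (φ b₀) y₀ W θ)
    (hφ : ContMDiffAt I' I ω φ b₀) :
    LocalRep I' (fun b => η (φ b)) b₀ y₀ W (fun q => θ (φ q.1, q.2)) := by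
  have h2 : ContMDiffAt (I'.prod 𝓘(K, F)) (I.prod 𝓘(K, F)) ω
      (fun q : B' × F => (φ q.1, q.2)) (b₀, extChartAt 𝓘(K, F) y₀ y₀) :=
    ContMDiffAt.prodMk (hφ.comp _ contMDiffAt_fst) contMDiffAt_snd
  exact ⟨ContMDiffAt.comp _ h.1 h2, h2.continuousAt.eventually h.2⟩

theorem LocalRep.congr {η η' : B → VForm K V F Y k} {b₀ : B} {y₀ : Y} {W : BHSpace K V}
    {θ : B × F → F [⋀^Fin k]→L[K] W.carrier} (h : LocalRep I η b₀ y₀ W θ)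
    (he : ∀ᶠ b in 𝓝 b₀, η' b = η b) : LocalRep I η' b₀ y₀ W θ := by
  refine ⟨h.1, ?_⟩
  filter_upwards [h.2, he.prod_inl_nhds _] with q hq hq'
  rw [hq']
  exact hq

variable [CompleteSpace K] [FiniteDimensional K F] [IsManifold I ω B] [IsManifold 𝓘(K, F) ω Y]

theorem isAnalyticForm_of_localRep {η : B → VForm K V F Y k}
    (h : ∀ b₀ y₀, ∃ W θ, LocalRep I η b₀ y₀ W θ) : IsAnalyticForm I η := by
  rintro U hU φ hφ ⟨b₀, y₀⟩ hp
  obtain ⟨W, θ, hθ, he⟩ := h b₀ y₀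
  let e := trivializationAt F (TangentSpace 𝓘(K, F)) y₀
  have ha : ∀ i, ContMDiffAt (I.prod 𝓘(K, F)) 𝓘(K, F) ω
      (fun p : B × Y => (e (⟨p.2, φ i p⟩ : TangentBundle 𝓘(K, F) Y)).2) (b₀, y₀) := fun i =>
    (Bundle.contMDiffAt_totalSpace.1 ((hφ i).contMDiffAt (hU.mem_nhds hp))).2
  have hc : ContMDiffAt (I.prod 𝓘(K, F)) (I.prod 𝓘(K, F)) ω
      (fun p : B × Y => (p.1, extChartAt 𝓘(K, F) y₀ p.2)) (b₀, y₀) :=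
    ContMDiffAt.prodMk contMDiffAt_fst
      (ContMDiffAt.comp (b₀, y₀) (contMDiffAt_extChartAt (x := y₀)) contMDiffAt_snd)
  rw [vAnalyticAt_iff]
  refine ⟨W, _, ContMDiffAt.alternating_apply (ContMDiffAt.comp (b₀, y₀) hθ hc) ha, ?_⟩
  have hs : ∀ᶠ p : B × Y in 𝓝 (b₀, y₀), p.2 ∈ (extChartAt 𝓘(K, F) y₀).source :=
    continuousAt_snd.eventually (extChartAt_source_mem_nhds y₀)
  filter_upwards [hc.continuousAt.eventually he, hs] with p hp1 hp2
  dsimp only [Function.comp_apply]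
  rw [← hp1]
  have hx := (extChartAt 𝓘(K, F) y₀).map_source hp2
  have hl := (extChartAt 𝓘(K, F) y₀).left_inv hp2
  have hb : p.2 ∈ e.baseSet := by
    rw [TangentBundle.trivializationAt_baseSet]; simpa using hp2
  have : ∀ (y : Y) (hy : y = p.2), η p.1 p.2 (fun i => φ i p) =
      η p.1 y (fun i => e.symm y (e (⟨p.2, φ i p⟩ : TangentBundle 𝓘(K, F) Y)).2) := by
    rintro y rfl
    congr 1
    funext i
    exact (e.symm_apply_apply_mk hb (φ i p)).symm
  rw [this _ hl, chartForm_apply]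
  congr 1
  funext i
  exact (mfderiv_extChartAt_symm_eq_symm hx _).symm

variable [CharZero K] [IsTopologicalAddGroup V] [T2Space V]

theorem IsAnalyticForm.exists_localRep {η : B → VForm K V F Y k} (hη : IsAnalyticForm I η)
    (b₀ : B) (y₀ : Y) : ∃ W θ, LocalRep I η b₀ y₀ W θ := by
  let e := trivializationAt F (TangentSpace 𝓘(K, F)) y₀
  let U : Set (B × Y) := {p | p.2 ∈ e.baseSet}
  have hU : IsOpen U := e.open_baseSet.preimage continuous_snd
  have hy₀ : y₀ ∈ e.baseSet := FiberBundle.mem_baseSet_trivializationAt' y₀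
  have : IsManifold 𝓘(K, F) (ω + 1) Y := ‹IsManifold 𝓘(K, F) ω Y›
  have hsec : ∀ v : F, ContMDiffOn (I.prod 𝓘(K, F)) 𝓘(K, F).tangent ω
      (fun p : B × Y => (⟨p.2, e.symm p.2 v⟩ : TangentBundle 𝓘(K, F) Y)) U := by
    intro v
    have h1 : ContMDiffOn (I.prod 𝓘(K, F)) (𝓘(K, F).prod 𝓘(K, F)) ω
        (fun p : B × Y => (p.2, v)) U := contMDiffOn_snd.prodMk contMDiffOn_const
    refine (e.contMDiffOn_symm.comp h1 ?_).congr ?_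
    · intro p hp
      exact e.mem_target.2 hp
    · intro p hp
      exact e.mk_symm hp v
  have hr : ∀ r : Fin k → Fin (Module.finrank K F), VAnalyticAt K (I.prod 𝓘(K, F))
      (fun p : B × Y => η p.1 p.2 fun i => e.symm p.2 (Module.finBasis K F (r i))) (b₀, y₀) :=
    fun r => hη U hU (fun i p => e.symm p.2 (Module.finBasis K F (r i))) (fun i => hsec _) _ hy₀
  obtain ⟨W, h, hh, he⟩ := VAnalyticAt.common hr
  have hc : ContMDiffAt (I.prod 𝓘(K, F)) (I.prod 𝓘(K, F)) ω
      (fun q : B × F => (q.1, (extChartAt 𝓘(K, F) y₀).symm q.2))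
      (b₀, extChartAt 𝓘(K, F) y₀ y₀) :=
    ContMDiffAt.prodMk contMDiffAt_fst
      (ContMDiffAt.comp (b₀, extChartAt 𝓘(K, F) y₀ y₀)
        ((contMDiffOn_extChartAt_symm (I := 𝓘(K, F)) (n := ω) y₀).contMDiffAt
          (extChartAt_target_mem_nhds (I := 𝓘(K, F)) y₀))
        contMDiffAt_snd)
  have hpt : (b₀, (extChartAt 𝓘(K, F) y₀).symm (extChartAt 𝓘(K, F) y₀ y₀)) = (b₀, y₀) := by simp
  refine ⟨W, fun q => ∑ r, elemCLM K F r (h r (q.1, (extChartAt 𝓘(K, F) y₀).symm q.2)), ?_, ?_⟩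
  · refine ContMDiffAt.sum fun r _ => ?_
    have hr : ContMDiff 𝓘(K, W.carrier) 𝓘(K, F [⋀^Fin k]→L[K] W.carrier) ω
        (elemCLM K F r : W.carrier →L[K] (F [⋀^Fin k]→L[K] W.carrier)) :=
      ContinuousLinearMap.contMDiff (F := F [⋀^Fin k]→L[K] W.carrier) _
    refine hr.contMDiffAt.comp _ ?_
    refine ContMDiffAt.comp (b₀, extChartAt 𝓘(K, F) y₀ y₀) (g := h r) ?_ hc
    rw [hpt]
    exact hh r
  · have ht : ∀ᶠ q : B × F in 𝓝 (b₀, extChartAt 𝓘(K, F) y₀ y₀),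
        q.2 ∈ (extChartAt 𝓘(K, F) y₀).target :=
      continuousAt_snd.eventually (extChartAt_target_mem_nhds (I := 𝓘(K, F)) y₀)
    have hc' := hc.continuousAt
    rw [ContinuousAt, hpt] at hc'
    filter_upwards [hc'.eventually he, ht] with q hq hq2 w
    refine alternating_eq_of_basis (chartForm (η q.1) y₀ q.2) W.incl.toLinearMap
      (fun r => h r (q.1, (extChartAt 𝓘(K, F) y₀).symm q.2)) (fun r => ?_) w
    refine Eq.trans ?_ (hq r)
    rw [chartForm_apply]
    congr 1
    funext i
    exact mfderiv_extChartAt_symm_eq_symm hq2 _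

end LocalRep

section ExteriorDerivative

variable {K : Type u} [NontriviallyNormedField K]
  {V : Type u} [AddCommGroup V] [Module K V] [TopologicalSpace V] [IsTopologicalAddGroup V]
  [ContinuousSMul K V] [T2Space V]
  {EB : Type*} [NormedAddCommGroup EB] [NormedSpace K EB] {HB : Type*} [TopologicalSpace HB]
  {I : ModelWithCorners K EB HB} {B : Type*} [TopologicalSpace B] [ChartedSpace HB B]
  {F : Type*} [NormedAddCommGroup F] [NormedSpace K F]
  {Y : Type*} [TopologicalSpace Y] [ChartedSpace F Y] {k : ℕ}

theorem isFormFDeriv_of_rep {W : BHSpace K V} {η : F → F [⋀^Fin k]→ₗ[K] V}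
    {θ : F → F [⋀^Fin k]→L[K] W.carrier} {x : F} (hθ : DifferentiableAt K θ x)
    (he : ∀ᶠ x' in 𝓝 x, ∀ w, η x' w = W.incl (θ x' w)) :
    ∃ D, IsFormFDeriv η x D ∧ ∀ v w, D v w = W.incl (fderiv K θ x v w) := by
  let D : F →ₗ[K] F [⋀^Fin k]→ₗ[K] V :=
    { toFun := fun v => W.incl.toLinearMap.compAlternatingMap (fderiv K θ x v).toAlternatingMap
      map_add' := fun v v' => by ext w; simp
      map_smul' := fun c v => by ext w; simp }
  refine ⟨D, fun w => ⟨W.incl ∘L (ContinuousAlternatingMap.apply K F W.carrier w ∘L fderiv K θ x),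
    ?_, fun v => rfl⟩, fun v w => rfl⟩
  have h1 : HasFDerivAt (fun z => ContinuousAlternatingMap.apply K F W.carrier w (θ z))
      (ContinuousAlternatingMap.apply K F W.carrier w ∘L fderiv K θ x) x :=
    (ContinuousLinearMap.hasFDerivAt (𝕜 := K) (E := F [⋀^Fin k]→L[K] W.carrier) _).comp x
      hθ.hasFDerivAt
  refine (h1.clm_comp_tvs W.incl).congr_of_eventuallyEq ?_
  filter_upwards [he] with z hz
  exact hz w

theorem vExtDeriv_of_rep {W : BHSpace K V} {η : F → F [⋀^Fin k]→ₗ[K] V}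
    {θ : F → F [⋀^Fin k]→L[K] W.carrier} {x : F} (hθ : DifferentiableAt K θ x)
    (he : ∀ᶠ x' in 𝓝 x, ∀ w, η x' w = W.incl (θ x' w)) (v : Fin (k + 1) → F) :
    vExtDeriv η x v = W.incl (extDeriv θ x v) := by
  obtain ⟨D, hD, hD'⟩ := isFormFDeriv_of_rep hθ he
  rw [vExtDeriv, hD.formFDeriv_eq, AlternatingMap.alternatizeUncurryFin_apply, extDeriv,
    ContinuousAlternatingMap.alternatizeUncurryFin_apply, map_sum]
  simp only [hD', map_zsmul]

/-- Change of charts. -/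
theorem chartForm_change [IsManifold 𝓘(K, F) ω Y] (η : VForm K V F Y k) {y y₀ : Y} {x : F}
    (hx : x ∈ (extChartAt 𝓘(K, F) y).target)
    (hx₀ : (extChartAt 𝓘(K, F) y).symm x ∈ (extChartAt 𝓘(K, F) y₀).source) (w : Fin k → F) :
    chartForm η y x w =
      chartForm η y₀ (extChartAt 𝓘(K, F) y₀ ((extChartAt 𝓘(K, F) y).symm x))
        (fun i => fderiv K (extChartAt 𝓘(K, F) y₀ ∘ (extChartAt 𝓘(K, F) y).symm) x (w i)) := by
  rw [chartForm_apply, chartForm_apply]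
  have hx' := (extChartAt 𝓘(K, F) y₀).map_source hx₀
  have key : ∀ (z : Y) (hz : z = (extChartAt 𝓘(K, F) y).symm x),
      η ((extChartAt 𝓘(K, F) y).symm x) (fun i => tangentCoordChange 𝓘(K, F) y
        ((extChartAt 𝓘(K, F) y).symm x) ((extChartAt 𝓘(K, F) y).symm x) (w i)) =
      η z (fun i => tangentCoordChange 𝓘(K, F) y₀ z z
        (fderiv K (extChartAt 𝓘(K, F) y₀ ∘ (extChartAt 𝓘(K, F) y).symm) x (w i))) := by
    rintro z rfl
    congr 1
    funext i
    have h1 : fderiv K (extChartAt 𝓘(K, F) y₀ ∘ (extChartAt 𝓘(K, F) y).symm) x =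
        tangentCoordChange 𝓘(K, F) y y₀ ((extChartAt 𝓘(K, F) y).symm x) := by
      rw [tangentCoordChange_def, (extChartAt 𝓘(K, F) y).right_inv hx]
      simp [fderivWithin_univ]
    rw [h1]
    exact (tangentCoordChange_comp ⟨⟨(extChartAt 𝓘(K, F) y).map_target hx, hx₀⟩,
      mem_extChartAt_source _⟩).symm
  rw [mfderiv_extChartAt_symm_eq hx, mfderiv_extChartAt_symm_eq hx']
  exact key _ ((extChartAt 𝓘(K, F) y₀).left_inv hx₀)

variable [IsManifold I ω B] [IsManifold 𝓘(K, F) ω Y]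

theorem contMDiffAt_extDeriv_param {W : Type*} [NormedAddCommGroup W] [NormedSpace K W]
    {θ : B × F → F [⋀^Fin k]→L[K] W} {q₀ : B × F}
    (h : ContMDiffAt (I.prod 𝓘(K, F)) 𝓘(K, F [⋀^Fin k]→L[K] W) ω θ q₀) :
    ContMDiffAt (I.prod 𝓘(K, F)) 𝓘(K, F [⋀^Fin (k + 1)]→L[K] W) ω
      (fun q => extDeriv (fun x => θ (q.1, x)) q.2) q₀ := by
  have h1 : ContMDiffAt ((I.prod 𝓘(K, F)).prod 𝓘(K, F)) 𝓘(K, F [⋀^Fin k]→L[K] W) ω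
      (Function.uncurry fun (q : B × F) (x : F) => θ (q.1, x)) (q₀, q₀.2) := by
    refine ContMDiffAt.comp (q₀, q₀.2) (g := θ) h ?_
    exact ContMDiffAt.prodMk (contMDiffAt_fst.comp _ contMDiffAt_fst) contMDiffAt_snd
  have h2 := ContMDiffAt.mfderiv (m := ω) (fun (q : B × F) (x : F) => θ (q.1, x)) (fun q => q.2) h1
    contMDiffAt_snd (by simp)
  have h3 : ContMDiffAt (I.prod 𝓘(K, F)) 𝓘(K, F →L[K] F [⋀^Fin k]→L[K] W) ω
      (fun q : B × F => fderiv K (fun x => θ (q.1, x)) q.2) q₀ := by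
    have e := inTangentCoordinates_model_space (I := 𝓘(K, F)) (I' := 𝓘(K, F [⋀^Fin k]→L[K] W))
      (fun q : B × F => q.2) (fun q => θ (q.1, q.2))
      (fun q : B × F => fderiv K (fun x => θ (q.1, x)) q.2) q₀
    rw [← e]
    simpa only [mfderiv_eq_fderiv] using h2
  exact (ContinuousLinearMap.contMDiff
    (ContinuousAlternatingMap.alternatizeUncurryFinCLM K F W)).contMDiffAt.comp q₀ h3

theorem LocalRep.formD {η : B → VForm K V F Y k} {b₀ : B} {y₀ : Y} {W : BHSpace K V}
    {θ : B × F → F [⋀^Fin k]→L[K] W.carrier} (h : LocalRep I η b₀ y₀ W θ) :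
    LocalRep I (fun b => formD (η b)) b₀ y₀ W
      (fun q => extDeriv (fun x => θ (q.1, x)) q.2) := by
  refine ⟨contMDiffAt_extDeriv_param h.1, ?_⟩
  have ht : ∀ᶠ q : B × F in 𝓝 (b₀, extChartAt 𝓘(K, F) y₀ y₀),
      q.2 ∈ (extChartAt 𝓘(K, F) y₀).target :=
    continuousAt_snd.eventually (extChartAt_target_mem_nhds (I := 𝓘(K, F)) y₀)
  have hd := (contMDiffAt_iff_contMDiffAt_nhds (by simp)).1 h.1
  filter_upwards [h.2.eventually_nhds, ht, hd] with q hq hq2 hq3 w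
  obtain ⟨b, x⟩ := q
  dsimp only at hq2 ⊢
  have hs := (extChartAt 𝓘(K, F) y₀).map_target hq2
  set y := (extChartAt 𝓘(K, F) y₀).symm x with hy
  have hyx : extChartAt 𝓘(K, F) y₀ y = x := (extChartAt 𝓘(K, F) y₀).right_inv hq2
  have hdx : ContDiffAt K ω (fun x => θ (b, x)) x := by
    rw [← contMDiffAt_iff_contDiffAt]
    exact ContMDiffAt.comp x (g := θ) hq3 (contMDiffAt_const.prodMk contMDiffAt_id)
  set x₁ := extChartAt 𝓘(K, F) y y with hx₁
  have hyx₁ : (extChartAt 𝓘(K, F) y).symm x₁ = y := extChartAt_to_inv y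
  let ψ : F → F := extChartAt 𝓘(K, F) y₀ ∘ (extChartAt 𝓘(K, F) y).symm
  have hψx : ψ x₁ = x := by simp only [ψ, Function.comp_apply, hyx₁, hyx]
  have hψ : ContDiffAt K ω ψ x₁ := by
    have := contDiffWithinAt_ext_coord_change (I := 𝓘(K, F)) (n := ω) y₀ y (y := x₁) (by
      simp only [PartialEquiv.trans_source, PartialEquiv.symm_source, Set.mem_inter_iff,
        Set.mem_preimage, hyx₁]
      exact ⟨mem_extChartAt_target y, hs⟩)
    rw [modelWithCornersSelf_coe, Set.range_id, contDiffWithinAt_univ] at this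
    exact this
  have hψd : DifferentiableAt K (fderiv K ψ) x₁ :=
    (hψ.fderiv_right (m := ω) (by simp)).differentiableAt (by simp)
  have hθd : DifferentiableAt K (fun x' => θ (b, x')) (ψ x₁) := by
    rw [hψx]; exact hdx.differentiableAt (by simp)
  have hcomp : DifferentiableAt K (fun x' =>
      (θ (b, ψ x')).compContinuousLinearMap (fderiv K ψ x')) x₁ :=
    DifferentiableAt.continuousAlternatingMapCompContinuousLinearMap
      (DifferentiableAt.comp (g := fun x' => θ (b, x')) x₁ hθd (hψ.differentiableAt (by simp))) hψd
  have he : ∀ᶠ x' in 𝓝 x₁, ∀ w, chartForm (η b) y x' w =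
      W.incl ((θ (b, ψ x')).compContinuousLinearMap (fderiv K ψ x') w) := by
    have hq' : ∀ᶠ x' in 𝓝 x₁, ∀ w, chartForm (η b) y₀ (ψ x') w = W.incl (θ (b, ψ x') w) := by
      have hc : ContinuousAt (fun x' => (b, ψ x')) x₁ :=
        continuousAt_const.prodMk hψ.continuousAt
      have := hc.eventually (p := fun q : B × F =>
        ∀ w, chartForm (η q.1) y₀ q.2 w = W.incl (θ q w)) (by dsimp only; rw [hψx]; exact hq)
      exact this
    have ht' : ∀ᶠ x' in 𝓝 x₁, x' ∈ (extChartAt 𝓘(K, F) y).target :=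
      extChartAt_target_mem_nhds (I := 𝓘(K, F)) y
    have hs' : ∀ᶠ x' in 𝓝 x₁, (extChartAt 𝓘(K, F) y).symm x' ∈ (extChartAt 𝓘(K, F) y₀).source := by
      refine (continuousAt_extChartAt_symm y).eventually
        (p := fun z => z ∈ (extChartAt 𝓘(K, F) y₀).source) ?_
      rw [extChartAt_to_inv]
      exact (isOpen_extChartAt_source y₀).mem_nhds hs
    filter_upwards [hq', ht', hs'] with x' h1 h2 h3 w
    rw [chartForm_change (η b) h2 h3]
    exact h1 _
  have key : ∀ v, (_root_.formD (η b) y : F [⋀^Fin (k + 1)]→ₗ[K] V) v =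
      W.incl (extDeriv (fun x' => θ (b, x')) x fun i => fderiv K ψ x₁ (v i)) := by
    intro v
    refine (vExtDeriv_of_rep hcomp he v).trans ?_
    rw [extDeriv_pullback hθd hψ le_top, hψx]
    rfl
  rw [chartForm_apply]
  refine (key _).trans ?_
  congr 2
  funext i
  rw [mfderiv_extChartAt_symm_eq hq2]
  have h1 : fderiv K ψ x₁ = tangentCoordChange 𝓘(K, F) y y₀ y := by
    rw [tangentCoordChange_def]
    simp [fderivWithin_univ, ψ, hx₁]
  rw [h1]
  refine (tangentCoordChange_comp ⟨⟨hs, mem_extChartAt_source _⟩, hs⟩).trans ?_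
  exact tangentCoordChange_self hs

end ExteriorDerivative

section FormOperations

variable {K : Type u} [NontriviallyNormedField K] [CompleteSpace K] [CharZero K]
  {V : Type u} [AddCommGroup V] [Module K V] [TopologicalSpace V] [IsTopologicalAddGroup V]
  [ContinuousSMul K V] [T2Space V]
  {EB : Type*} [NormedAddCommGroup EB] [NormedSpace K EB] {HB : Type*} [TopologicalSpace HB]
  {I : ModelWithCorners K EB HB} {B : Type*} [TopologicalSpace B] [ChartedSpace HB B]
  {EB' : Type*} [NormedAddCommGroup EB'] [NormedSpace K EB'] {HB' : Type*} [TopologicalSpace HB']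
  {I' : ModelWithCorners K EB' HB'} {B' : Type*} [TopologicalSpace B'] [ChartedSpace HB' B']
  {F : Type*} [NormedAddCommGroup F] [NormedSpace K F] [FiniteDimensional K F]
  {Y : Type*} [TopologicalSpace Y] [ChartedSpace F Y] {k : ℕ}
  [IsManifold I ω B] [IsManifold I' ω B'] [IsManifold 𝓘(K, F) ω Y]

theorem isAnalyticForm_zero : IsAnalyticForm I (0 : B → VForm K V F Y k) :=
  fun _ _ _ _ _ _ => vAnalyticAt_zero

theorem IsAnalyticForm.add {η θ : B → VForm K V F Y k} (hη : IsAnalyticForm I η)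
    (hθ : IsAnalyticForm I θ) : IsAnalyticForm I (η + θ) :=
  fun U hU φ hφ p hp => (hη U hU φ hφ p hp).add (hθ U hU φ hφ p hp)

theorem IsAnalyticForm.neg {η : B → VForm K V F Y k} (hη : IsAnalyticForm I η) :
    IsAnalyticForm I (-η) := fun U hU φ hφ p hp =>
  ((hη U hU φ hφ p hp).const_smul (-1)).congr (by simp)

/-- Pullback along a map which is locally analytic at each point where it matters. -/
theorem isAnalyticForm_of_local {η : B' → VForm K V F Y k}
    (h : ∀ b : B', ∃ (φ : B' → B) (η' : B → VForm K V F Y k), IsAnalyticForm I η' ∧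
      ContMDiffAt I' I ω φ b ∧ ∀ᶠ b' in 𝓝 b, η b' = η' (φ b')) : IsAnalyticForm I' η := by
  refine isAnalyticForm_of_localRep fun b y => ?_
  obtain ⟨φ, η', hη', hφ, he⟩ := h b
  obtain ⟨W, θ, hθ⟩ := hη'.exists_localRep (φ b) y
  exact ⟨W, _, (hθ.comp hφ).congr he⟩

theorem IsAnalyticForm.comp {η : B → VForm K V F Y k} (hη : IsAnalyticForm I η) {φ : B' → B}
    (hφ : ContMDiff I' I ω φ) : IsAnalyticForm I' (fun b => η (φ b)) :=
  isAnalyticForm_of_local fun b => ⟨φ, η, hη, hφ b, by simp⟩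

theorem IsAnalyticForm.formD {η : B → VForm K V F Y k} (hη : IsAnalyticForm I η) :
    IsAnalyticForm I (fun b => formD (η b)) := isAnalyticForm_of_localRep fun b y => by
  obtain ⟨W, θ, hθ⟩ := hη.exists_localRep b y
  exact ⟨W, _, hθ.formD⟩

theorem LocalRep.slice {η : B → VForm K V F Y k} {b : B} {y : Y} {W : BHSpace K V}
    {θ : B × F → F [⋀^Fin k]→L[K] W.carrier} (h : LocalRep I η b y W θ) :
    ContDiffAt K ω (fun x => θ (b, x)) (extChartAt 𝓘(K, F) y y) ∧
      ∀ᶠ x in 𝓝 (extChartAt 𝓘(K, F) y y), ∀ w, chartForm (η b) y x w = W.incl (θ (b, x) w) := by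
  have hc : ContMDiffAt 𝓘(K, F) (I.prod 𝓘(K, F)) ω (fun x : F => (b, x))
      (extChartAt 𝓘(K, F) y y) := ContMDiffAt.prodMk contMDiffAt_const contMDiffAt_id
  exact ⟨(ContMDiffAt.comp _ h.1 hc).contDiffAt, hc.continuousAt.eventually h.2⟩

theorem IsAnalyticForm.exists_isFormFDeriv {η : B → VForm K V F Y k} (hη : IsAnalyticForm I η)
    (b : B) (y : Y) :
    ∃ D, IsFormFDeriv (chartForm (η b) y) (extChartAt 𝓘(K, F) y y) D := by
  obtain ⟨W, θ, hθ⟩ := hη.exists_localRep b y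
  obtain ⟨D, hD, -⟩ := isFormFDeriv_of_rep (hθ.slice.1.differentiableAt (by simp)) hθ.slice.2
  exact ⟨D, hD⟩

theorem IsAnalyticForm.formD_formD {η : B → VForm K V F Y k} (hη : IsAnalyticForm I η) (b : B) :
    _root_.formD (_root_.formD (η b)) = 0 := by
  funext y
  obtain ⟨W, θ, hθ⟩ := hη.exists_localRep b y
  have h2 := hθ.formD.slice
  ext v
  refine (vExtDeriv_of_rep (h2.1.differentiableAt (by simp)) h2.2 v).trans ?_
  have h3 : extDeriv (extDeriv fun x => θ (b, x)) (extChartAt 𝓘(K, F) y y) = 0 :=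
    extDeriv_extDeriv_apply (r := ω) hθ.slice.1 le_top
  have h4 : (extDeriv fun x => θ (b, x)) = fun q => extDeriv (fun x => θ (b, x)) q := rfl
  rw [h4] at h3
  dsimp only
  rw [h3]
  exact map_zero W.incl

theorem IsAnalyticForm.formD_add {η θ : B → VForm K V F Y k} (hη : IsAnalyticForm I η)
    (hθ : IsAnalyticForm I θ) (b : B) :
    _root_.formD (η b + θ b) = _root_.formD (η b) + _root_.formD (θ b) := by
  funext y
  obtain ⟨D, hD⟩ := hη.exists_isFormFDeriv b y
  obtain ⟨D', hD'⟩ := hθ.exists_isFormFDeriv b y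
  have h : IsFormFDeriv (chartForm (η b + θ b) y) (extChartAt 𝓘(K, F) y y) (D + D') := hD.add hD'
  change vExtDeriv _ _ = vExtDeriv _ _ + vExtDeriv _ _
  rw [vExtDeriv, vExtDeriv, vExtDeriv, h.formFDeriv_eq, hD.formFDeriv_eq, hD'.formFDeriv_eq,
    AlternatingMap.alternatizeUncurryFin_add]

theorem IsAnalyticForm.formD_clm {η : B → VForm K V F Y k} (hη : IsAnalyticForm I η) (A : V →L[K] V)
    (b : B) :
    _root_.formD (fun y => A.toLinearMap.compAlternatingMap (η b y)) =
      fun y => A.toLinearMap.compAlternatingMap (_root_.formD (η b) y) := by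
  funext y
  obtain ⟨D, hD⟩ := hη.exists_isFormFDeriv b y
  have h := hD.clm_comp A
  change vExtDeriv _ _ = A.toLinearMap.compAlternatingMap (vExtDeriv _ _)
  rw [vExtDeriv, vExtDeriv, hD.formFDeriv_eq]
  have h' : formFDeriv (chartForm (fun y => A.toLinearMap.compAlternatingMap (η b y)) y)
      (extChartAt 𝓘(K, F) y y) = _ := h.formFDeriv_eq
  rw [h']
  ext v
  simp [AlternatingMap.alternatizeUncurryFin_apply, map_sum, map_zsmul]

end FormOperations

/-! ### Admissible functions and admissible relative forms -/

section Admissible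

variable {K : Type u} [NontriviallyNormedField K]
  {V : Type u} [AddCommGroup V] [Module K V] [TopologicalSpace V]
  {EG : Type*} [NormedAddCommGroup EG] [NormedSpace K EG] {HG : Type*} [TopologicalSpace HG]
  (IG : ModelWithCorners K EG HG)
  {G : Type*} [Group G] [TopologicalSpace G] [ChartedSpace HG G] (ρ : G →* (V ≃L[K] V))
  {EB : Type*} [NormedAddCommGroup EB] [NormedSpace K EB] {HB : Type*} [TopologicalSpace HB]
  (I : ModelWithCorners K EB HB) {B : Type*} [TopologicalSpace B] [ChartedSpace HB B]
  {F : Type*} [NormedAddCommGroup F] [NormedSpace K F]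
  {Y : Type*} [TopologicalSpace Y] [ChartedSpace F Y] {k : ℕ}

/-- A locally analytic representation of `G` on `V`: `G` acts by continuous linear automorphisms
and the orbit maps are analytic. -/
def IsLocallyAnalyticRep : Prop :=
  ∀ v : V, VAnalytic K IG fun g : G => ρ g v

/-- A function `f : B → V` is admissible if `f` is analytic and `(g, b) ↦ g • f b` is analytic on
`G × B`. -/
def IsAdmissible (f : B → V) : Prop :=
  VAnalytic K I f ∧
    VAnalytic K (IG.prod I) fun p : G × B => ρ p.1 (f p.2)

/-- The relative form `(g, b, y) ↦ g • η (b, y)` on `(G × B) × Y / G × B`. -/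
def hatForm (η : B → VForm K V F Y k) : G × B → VForm K V F Y k := fun p y =>
  ((ρ p.1 : V →L[K] V) : V →ₗ[K] V).compAlternatingMap (η p.2 y)

/-- A relative form `η` on `B × Y / B` is admissible if it is analytic and the form
`(g, b, y) ↦ g • η (b, y)` on `(G × B) × Y / G × B` is analytic. -/
def IsAdmissibleForm [IsManifold 𝓘(K, F) ω Y] (η : B → VForm K V F Y k) : Prop :=
  IsAnalyticForm I η ∧ IsAnalyticForm (IG.prod I) (hatForm ρ η)

/-- Functions on `B × Y`, in curried form, that are locally constant along `Y`: each point
`(b, y)` has a neighbourhood `B' × Y'` on which `f` factors through the projection to `B'`. -/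
def IsLocConstAlong (f : B → Y → V) : Prop :=
  ∀ b y, ∃ N ∈ 𝓝 b, ∃ N' ∈ 𝓝 y, ∀ b' ∈ N, ∀ y₁ ∈ N', ∀ y₂ ∈ N', f b' y₁ = f b' y₂

/-- A function on `Y` as a `0`-form. -/
def zeroForm (f : Y → V) : VForm K V F Y 0 := fun y =>
  AlternatingMap.constOfIsEmpty K (TangentSpace 𝓘(K, F) y) (Fin 0) (f y)

end Admissible

section AdmissibleLemmas

variable {K : Type u} [NontriviallyNormedField K] [CompleteSpace K] [CharZero K]
  {V : Type u} [AddCommGroup V] [Module K V] [TopologicalSpace V] [IsTopologicalAddGroup V]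
  [ContinuousSMul K V] [T2Space V]
  {EG : Type*} [NormedAddCommGroup EG] [NormedSpace K EG] {HG : Type*} [TopologicalSpace HG]
  {IG : ModelWithCorners K EG HG}
  {G : Type*} [Group G] [TopologicalSpace G] [ChartedSpace HG G] [IsManifold IG ω G]
  {ρ : G →* (V ≃L[K] V)}
  {EB : Type*} [NormedAddCommGroup EB] [NormedSpace K EB] {HB : Type*} [TopologicalSpace HB]
  {I : ModelWithCorners K EB HB} {B : Type*} [TopologicalSpace B] [ChartedSpace HB B]
  {EB' : Type*} [NormedAddCommGroup EB'] [NormedSpace K EB'] {HB' : Type*} [TopologicalSpace HB']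
  {I' : ModelWithCorners K EB' HB'} {B' : Type*} [TopologicalSpace B'] [ChartedSpace HB' B']
  {F : Type*} [NormedAddCommGroup F] [NormedSpace K F] [FiniteDimensional K F]
  {Y : Type*} [TopologicalSpace Y] [ChartedSpace F Y] {k : ℕ}
  [IsManifold I ω B] [IsManifold I' ω B'] [IsManifold 𝓘(K, F) ω Y]

theorem isAdmissibleForm_zero : IsAdmissibleForm IG ρ I (0 : B → VForm K V F Y k) := by
  refine ⟨isAnalyticForm_zero, ?_⟩
  have : hatForm ρ (0 : B → VForm K V F Y k) = 0 := by
    funext p y; ext v; simp [hatForm]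
  rw [this]
  exact isAnalyticForm_zero

theorem IsAdmissibleForm.add {η θ : B → VForm K V F Y k} (hη : IsAdmissibleForm IG ρ I η)
    (hθ : IsAdmissibleForm IG ρ I θ) : IsAdmissibleForm IG ρ I (η + θ) := by
  refine ⟨hη.1.add hθ.1, ?_⟩
  have : hatForm ρ (η + θ) = hatForm ρ η + hatForm ρ θ := by
    funext p y; ext v; simp [hatForm]
  rw [this]
  exact hη.2.add hθ.2

theorem IsAdmissibleForm.neg {η : B → VForm K V F Y k} (hη : IsAdmissibleForm IG ρ I η) :
    IsAdmissibleForm IG ρ I (-η) := by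
  refine ⟨hη.1.neg, ?_⟩
  have : hatForm ρ (-η) = -hatForm ρ η := by
    funext p y; ext v; simp [hatForm]
  rw [this]
  exact hη.2.neg

theorem isAdmissibleForm_of_local {η : B' → VForm K V F Y k}
    (h : ∀ b : B', ∃ (φ : B' → B) (η' : B → VForm K V F Y k), IsAdmissibleForm IG ρ I η' ∧
      ContMDiffAt I' I ω φ b ∧ ∀ᶠ b' in 𝓝 b, η b' = η' (φ b')) : IsAdmissibleForm IG ρ I' η := by
  refine ⟨isAnalyticForm_of_local (I := I) (B := B) fun b => ?_,
    isAnalyticForm_of_local (I := IG.prod I) (B := G × B) fun p => ?_⟩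
  · obtain ⟨φ, η', hη', h⟩ := h b
    exact ⟨φ, η', hη'.1, h⟩
  · obtain ⟨φ, η', hη', hφ, he⟩ := h p.2
    refine ⟨fun q => (q.1, φ q.2), hatForm ρ η', hη'.2, ?_, ?_⟩
    · exact contMDiffAt_fst.prodMk (hφ.comp p contMDiffAt_snd)
    · filter_upwards [continuousAt_snd.eventually he] with q hq
      funext y
      change _ = ((ρ q.1 : V →L[K] V) : V →ₗ[K] V).compAlternatingMap (η' (φ q.2) y)
      rw [← hq]
      rfl

theorem IsAdmissibleForm.comp {η : B → VForm K V F Y k} (hη : IsAdmissibleForm IG ρ I η) {φ : B' → B}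
    (hφ : ContMDiff I' I ω φ) : IsAdmissibleForm IG ρ I' (fun b => η (φ b)) :=
  isAdmissibleForm_of_local fun b => ⟨φ, η, hη, hφ b, by simp⟩

theorem IsAdmissibleForm.formD {η : B → VForm K V F Y k} (hη : IsAdmissibleForm IG ρ I η) :
    IsAdmissibleForm IG ρ I (fun b => formD (η b)) := by
  refine ⟨hη.1.formD, ?_⟩
  have : hatForm ρ (fun b => _root_.formD (η b)) = fun p => _root_.formD (hatForm ρ η p) := by
    funext p
    exact (hη.1.formD_clm (ρ p.1 : V →L[K] V) p.2).symm
  rw [this]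
  exact hη.2.formD

theorem isAdmissible_zero : IsAdmissible IG ρ I (fun _ : B => (0 : V)) :=
  ⟨fun _ => vAnalyticAt_zero, fun _ => by simpa using vAnalyticAt_zero⟩

theorem IsAdmissible.add {f g : B → V} (hf : IsAdmissible IG ρ I f) (hg : IsAdmissible IG ρ I g) :
    IsAdmissible IG ρ I (fun b => f b + g b) :=
  ⟨fun b => (hf.1 b).add (hg.1 b), fun p => by simpa using (hf.2 p).add (hg.2 p)⟩

theorem IsAdmissible.neg {f : B → V} (hf : IsAdmissible IG ρ I f) :
    IsAdmissible IG ρ I (fun b => -f b) :=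
  ⟨fun b => ((hf.1 b).const_smul (-1)).congr (by simp),
    fun p => ((hf.2 p).const_smul (-1)).congr (by simp)⟩

theorem isAdmissible_of_local {f : B' → V}
    (h : ∀ b : B', ∃ (φ : B' → B) (f' : B → V), IsAdmissible IG ρ I f' ∧
      ContMDiffAt I' I ω φ b ∧ ∀ᶠ b' in 𝓝 b, f b' = f' (φ b')) : IsAdmissible IG ρ I' f := by
  refine ⟨fun b => ?_, fun p => ?_⟩
  · obtain ⟨φ, f', hf', hφ, he⟩ := h b
    exact ((hf'.1 (φ b)).comp hφ).congr he
  · obtain ⟨φ, f', hf', hφ, he⟩ := h p.2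
    have h1 : ContMDiffAt (IG.prod I') (IG.prod I) ω
        (fun q : G × B' => (q.1, φ q.2)) p := contMDiffAt_fst.prodMk (hφ.comp p contMDiffAt_snd)
    refine (VAnalyticAt.comp (φ := fun q : G × B' => (q.1, φ q.2)) (hf'.2 _) h1).congr ?_
    filter_upwards [continuousAt_snd.eventually he] with q hq
    simp only [hq]

theorem isAdmissibleForm_zeroForm {f : B → Y → V}
    (hf : IsAdmissible IG ρ (I.prod 𝓘(K, F)) fun p : B × Y => f p.1 p.2) :
    IsAdmissibleForm IG ρ I fun b => (zeroForm (f b) : VForm K V F Y 0) := by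
  refine ⟨fun U hU φ hφ p hp => hf.1 p, fun U hU φ hφ p hp => ?_⟩
  have h1 : ContMDiffAt ((IG.prod I).prod 𝓘(K, F))
      (IG.prod (I.prod 𝓘(K, F))) ω
      (fun q : (G × B) × Y => (q.1.1, (q.1.2, q.2))) p :=
    (contMDiffAt_fst.comp p contMDiffAt_fst).prodMk
      ((contMDiffAt_snd.comp p contMDiffAt_fst).prodMk contMDiffAt_snd)
  exact VAnalyticAt.comp (φ := fun q : (G × B) × Y => (q.1.1, (q.1.2, q.2))) (hf.2 _) h1

theorem formD_zeroForm {f : B → Y → V} (hf : IsLocConstAlong f) (b : B) :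
    formD (zeroForm (f b) : VForm K V F Y 0) = 0 := by
  funext y
  have hD : IsFormFDeriv (chartForm (zeroForm (f b) : VForm K V F Y 0) y)
      (extChartAt 𝓘(K, F) y y) 0 := by
    intro w
    refine ⟨0, ?_, fun v => by simp⟩
    obtain ⟨N, hN, N', hN', h⟩ := hf b y
    have hc : ContinuousAt (extChartAt 𝓘(K, F) y).symm (extChartAt 𝓘(K, F) y y) :=
      continuousAt_extChartAt_symm y
    have he : (fun x' => chartForm (zeroForm (f b) : VForm K V F Y 0) y x' w) =ᶠ[
        𝓝 (extChartAt 𝓘(K, F) y y)] fun _ => f b y := by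
      rw [ContinuousAt, extChartAt_to_inv] at hc
      filter_upwards [hc hN'] with x hx
      exact h b (mem_of_mem_nhds hN) _ hx _ (mem_of_mem_nhds hN')
    exact (hasFDerivAt_const (f b y) _).congr_of_eventuallyEq he
  change vExtDeriv _ _ = 0
  rw [vExtDeriv, hD.formFDeriv_eq]
  exact map_zero (AlternatingMap.alternatizeUncurryFinLM (R := K) (M := F) (N := V) (n := 0))

end AdmissibleLemmas

/-! ### The site of locally analytic manifolds -/

/-- Finite dimensional paracompact (Hausdorff) locally `K`-analytic manifolds. -/
structure LaMan (K : Type u) [NontriviallyNormedField K] where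
  carrier : Type u
  dim : ℕ
  [topologicalSpace : TopologicalSpace carrier]
  [chartedSpace : ChartedSpace (Fin dim → K) carrier]
  [isManifold : IsManifold 𝓘(K, Fin dim → K) ω carrier]
  [t2Space : T2Space carrier]
  [paracompactSpace : ParacompactSpace carrier]

attribute [instance] LaMan.topologicalSpace LaMan.chartedSpace LaMan.isManifold LaMan.t2Space
  LaMan.paracompactSpace

namespace LaMan

variable {K : Type u} [NontriviallyNormedField K]

/-- The model with corners of a manifold. -/
abbrev I (X : LaMan K) : ModelWithCorners K (Fin X.dim → K) (Fin X.dim → K) :=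
  𝓘(K, Fin X.dim → K)

/-- The category of manifolds and analytic maps. -/
instance : Category (LaMan K) where
  Hom X Y := ContMDiffMap X.I Y.I X.carrier Y.carrier ω
  id _ := ContMDiffMap.id
  comp f g := g.comp f

theorem contMDiff_hom {X Y : LaMan K} (f : X ⟶ Y) : ContMDiff X.I Y.I ω f.1 := f.2

/-- A paracompact open subset as a manifold. -/
abbrev restrict (X : LaMan K) (U : TopologicalSpace.Opens X.carrier) [ParacompactSpace U] :
    LaMan K where
  carrier := U
  dim := X.dim

/-- The inclusion of an open subset. -/
def incl (X : LaMan K) (U : TopologicalSpace.Opens X.carrier) [ParacompactSpace U] :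
    X.restrict U ⟶ X :=
  ⟨Subtype.val, (contMDiff_subtype_val : ContMDiff X.I X.I ω (Subtype.val : U → X.carrier))⟩

open Classical in
/-- A retraction of `X` onto an open subset `U`, analytic on `U`. -/
def retract (X : LaMan K) (U : TopologicalSpace.Opens X.carrier) (u : U) (x : X.carrier) : U :=
  if h : x ∈ U then ⟨x, h⟩ else u

theorem retract_eq (X : LaMan K) (U : TopologicalSpace.Opens X.carrier) (u : U) {x : X.carrier}
    (h : x ∈ U) : X.retract U u x = ⟨x, h⟩ := dif_pos h

theorem contMDiffAt_retract (X : LaMan K) (U : TopologicalSpace.Opens X.carrier) (u : U)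
    {x : X.carrier} (h : x ∈ U) : ContMDiffAt X.I X.I ω (X.retract U u) x := by
  have : ContMDiffAt X.I X.I ω (fun z : U => X.retract U u z) ⟨x, h⟩ := by
    have e : (fun z : U => X.retract U u z) = id := by
      funext z
      exact X.retract_eq U u z.2
    rw [e]
    exact contMDiffAt_id
  exact contMDiffAt_subtype_iff.1 this

theorem exists_lift {X Z : LaMan K} (U : TopologicalSpace.Opens X.carrier) [ParacompactSpace U]
    (f : Z ⟶ X) (h : ∀ z, f.1 z ∈ U) : ∃ g : Z ⟶ X.restrict U, g ≫ X.incl U = f := by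
  refine ⟨⟨fun z => ⟨f.1 z, h z⟩, fun z => ?_⟩, rfl⟩
  have e : (fun z => (⟨f.1 z, h z⟩ : U)) = X.retract U ⟨f.1 z, h z⟩ ∘ f.1 := by
    funext z'
    exact (X.retract_eq U _ (h z')).symm
  change ContMDiffAt Z.I X.I ω (fun z => (⟨f.1 z, h z⟩ : U)) z
  rw [e]
  exact (X.contMDiffAt_retract U _ (h z)).comp z (contMDiff_hom f z)

theorem exists_small (X : LaMan K) (x : X.carrier) {N : Set X.carrier} (hN : N ∈ 𝓝 x) :
    ∃ (U : TopologicalSpace.Opens X.carrier) (_ : ParacompactSpace U), x ∈ U ∧ (U : Set _) ⊆ N := by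
  let c := chartAt (Fin X.dim → K) x
  let U : TopologicalSpace.Opens X.carrier :=
    ⟨c.source ∩ interior N, c.open_source.inter isOpen_interior⟩
  have h1 : Topology.IsEmbedding (c.source.domRestrict c) := c.isOpenEmbedding_restrict.isEmbedding
  have h2 : Topology.IsEmbedding (Set.inclusion (Set.inter_subset_left : (U : Set _) ⊆ c.source)) :=
    Topology.IsEmbedding.inclusion _
  have h3 := h1.comp h2
  have : TopologicalSpace.MetrizableSpace U := h3.metrizableSpace
  let _ := TopologicalSpace.metrizableSpaceMetric U
  exact ⟨U, inferInstance, ⟨mem_chart_source _ x, mem_interior_iff_mem_nhds.2 hN⟩,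
    fun z hz => interior_subset hz.2⟩

variable (K) in
/-- The topology generated by open coverings: a sieve on `X` is covering if it contains the
inclusions of the members of some open covering of `X`. -/
def openTopology : GrothendieckTopology (LaMan K) where
  sieves X := {S | ∀ x : X.carrier, ∃ (U : TopologicalSpace.Opens X.carrier)
    (_ : ParacompactSpace U), x ∈ U ∧ S.arrows (X.incl U)}
  top_mem' X x := by
    obtain ⟨U, hU, hx, -⟩ := X.exists_small x Filter.univ_mem
    exact ⟨U, hU, hx, trivial⟩
  pullback_stable' X Z S f hS z := by
    obtain ⟨U, hU, hx, hSU⟩ := hS (f.1 z)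
    obtain ⟨U', hU', hz, hsub⟩ := Z.exists_small z
      ((contMDiff_hom f).continuous.continuousAt.preimage_mem_nhds (U.2.mem_nhds hx))
    refine ⟨U', hU', hz, ?_⟩
    obtain ⟨g, hg⟩ := exists_lift U (Z.incl U' ≫ f) (fun w => hsub w.2)
    change S.arrows (Z.incl U' ≫ f)
    rw [← hg]
    exact S.downward_closed hSU g
  transitive' X S hS R hR x := by
    obtain ⟨U, hU, hx, hSU⟩ := hS x
    obtain ⟨U₂, hU₂, hx₂, hRU⟩ := hR hSU ⟨x, hx⟩
    have hopen : IsOpen (Subtype.val '' (U₂ : Set U) : Set X.carrier) :=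
      U.2.isOpenEmbedding_subtypeVal.isOpenMap _ U₂.2
    obtain ⟨U₃, hU₃, hx₃, hsub⟩ := X.exists_small x (hopen.mem_nhds ⟨⟨x, hx⟩, hx₂, rfl⟩)
    refine ⟨U₃, hU₃, hx₃, ?_⟩
    obtain ⟨g, hg⟩ := exists_lift U (X.incl U₃) (fun w => by
      obtain ⟨a, -, ha⟩ := hsub w.2
      change (w : X.carrier) ∈ U
      rw [← ha]
      exact a.2)
    obtain ⟨g', hg'⟩ := exists_lift (X := X.restrict U) U₂ g (fun w => by
      obtain ⟨a, ha', ha⟩ := hsub w.2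
      have : g.1 w = a := by
        apply Subtype.ext
        rw [ha]
        exact congrArg (fun h : X.restrict U₃ ⟶ X => h.1 w) hg
      rw [this]
      exact ha')
    rw [← hg, ← hg', Category.assoc]
    exact R.downward_closed hRU g'

/-! Sheaves of abelian groups of functions `X → T` satisfying a local condition. -/

section FunSheaf

variable {T : Type u} [AddCommGroup T] (S : ∀ X : LaMan K, AddSubgroup (X.carrier → T))
  (hpull : ∀ {X Z : LaMan K} (f : Z ⟶ X) (s : X.carrier → T), s ∈ S X → s ∘ f.1 ∈ S Z)

/-- The presheaf `X ↦ S X`, with composition as restriction maps. The values are lifted to the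
universe in which the site is small. -/
def funPresheaf : (LaMan K)ᵒᵖ ⥤ AddCommGrpCat.{u + 1} where
  obj X := AddCommGrpCat.of (ULift.{u + 1} (S X.unop))
  map f := AddCommGrpCat.ofHom
    { toFun := fun s => ⟨⟨s.down.1 ∘ f.unop.1, hpull f.unop _ s.down.2⟩⟩
      map_zero' := rfl
      map_add' := fun _ _ => rfl }
  map_id _ := rfl
  map_comp _ _ := rfl

theorem funPresheaf_isSheaf
    (hloc : ∀ (X : LaMan K) (s : X.carrier → T),
      (∀ x, ∃ (U : TopologicalSpace.Opens X.carrier) (_ : ParacompactSpace U), x ∈ U ∧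
        s ∘ (X.incl U).1 ∈ S (X.restrict U)) → s ∈ S X) :
    Presheaf.IsSheaf (openTopology K) (funPresheaf S hpull) := by
  rw [Presheaf.isSheaf_iff_isSheaf_forget _ _ (forget AddCommGrpCat.{u + 1}),
    isSheaf_iff_isSheaf_of_type]
  intro X R hR x hx
  choose U hU hxU hRU using hR
  let val : ∀ ⦃Z : LaMan K⦄ (f : Z ⟶ X) (hf : R.arrows f), Z.carrier → T :=
    fun Z f hf => (x f hf : ULift.{u + 1} (S Z)).down.1
  have hval : ∀ ⦃Z Z' : LaMan K⦄ (g : Z' ⟶ Z) (f : Z ⟶ X) (hf : R.arrows f)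
      (hgf : R.arrows (g ≫ f)), val (g ≫ f) hgf = val f hf ∘ g.1 := by
    intro Z Z' g f hf hgf
    have h1 := hx (𝟙 Z') g hgf hf (by simp)
    have h2 := congrArg (fun a : ULift.{u + 1} (S Z') => a.down.1) h1
    exact h2
  have hcongr : ∀ ⦃Z : LaMan K⦄ (f f' : Z ⟶ X) (hf : R.arrows f) (hf' : R.arrows f'), f = f' →
      val f hf = val f' hf' := by
    rintro Z f _ hf hf' rfl
    rfl
  let s : X.carrier → T := fun z => val (X.incl (U z)) (hRU z) ⟨z, hxU z⟩
  have hs : ∀ ⦃Z : LaMan K⦄ (f : Z ⟶ X) (hf : R.arrows f), s ∘ f.1 = val f hf := by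
    intro Z f hf
    funext z
    obtain ⟨N, hN, hzN, hsub⟩ := Z.exists_small z
      ((contMDiff_hom f).continuous.continuousAt.preimage_mem_nhds
        ((U (f.1 z)).2.mem_nhds (hxU (f.1 z))))
    obtain ⟨g, hg⟩ := exists_lift (U (f.1 z)) (Z.incl N ≫ f) (fun w => hsub w.2)
    have h1 := hval g (X.incl (U (f.1 z))) (hRU _) (R.downward_closed (hRU _) g)
    have h2 := hval (Z.incl N) f hf (R.downward_closed hf _)
    have h3 := hcongr _ _ (R.downward_closed (hRU (f.1 z)) g)
      (R.downward_closed hf (Z.incl N)) hg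
    have h4 : g.1 ⟨z, hzN⟩ = ⟨f.1 z, hxU (f.1 z)⟩ := by
      apply Subtype.ext
      exact congrArg (fun h : Z.restrict N ⟶ X => h.1 ⟨z, hzN⟩) hg
    have h5 := congrFun (h1.symm.trans (h3.trans h2)) ⟨z, hzN⟩
    simp only [Function.comp_apply, h4] at h5
    exact h5
  have hsS : s ∈ S X := by
    refine hloc X s fun z => ⟨U z, hU z, hxU z, ?_⟩
    rw [hs (X.incl (U z)) (hRU z)]
    exact (x (X.incl (U z)) (hRU z) : ULift.{u + 1} (S (X.restrict (U z)))).down.2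
  refine ⟨(⟨⟨s, hsS⟩⟩ : ULift.{u + 1} (S X)), ?_, ?_⟩
  · intro Z f hf
    apply ULift.ext
    apply Subtype.ext
    exact hs f hf
  · intro t ht
    apply ULift.ext
    apply Subtype.ext
    funext z
    have := congrArg (fun a : ULift.{u + 1} (S (X.restrict (U z))) => a.down.1 ⟨z, hxU z⟩)
      (ht (X.incl (U z)) (hRU z))
    exact this

/-- The sheaf `X ↦ S X`. -/
def funSheaf
    (hloc : ∀ (X : LaMan K) (s : X.carrier → T),
      (∀ x, ∃ (U : TopologicalSpace.Opens X.carrier) (_ : ParacompactSpace U), x ∈ U ∧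
        s ∘ (X.incl U).1 ∈ S (X.restrict U)) → s ∈ S X) :
    Sheaf (openTopology K) AddCommGrpCat.{u + 1} :=
  ⟨funPresheaf S hpull, funPresheaf_isSheaf S hpull hloc⟩

end FunSheaf

end LaMan

/-! ### The relative de Rham complex -/

section DeRham

variable {K : Type u} [NontriviallyNormedField K] [CompleteSpace K] [CharZero K]
  {V : Type u} [AddCommGroup V] [Module K V] [TopologicalSpace V] [IsTopologicalAddGroup V]
  [ContinuousSMul K V] [T2Space V]
  {EG : Type*} [NormedAddCommGroup EG] [NormedSpace K EG] {HG : Type*} [TopologicalSpace HG]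
  (IG : ModelWithCorners K EG HG)
  {G : Type*} [Group G] [TopologicalSpace G] [ChartedSpace HG G] [IsManifold IG ω G]
  (ρ : G →* (V ≃L[K] V)) (Y : LaMan K)

/-- The group `Ω^k_ad(X × Y / X, V)` of admissible relative forms. -/
def admissibleForms (k : ℕ) (X : LaMan K) :
    AddSubgroup (X.carrier → VForm K V (Fin Y.dim → K) Y.carrier k) where
  carrier := {η | IsAdmissibleForm IG ρ X.I η}
  zero_mem' := isAdmissibleForm_zero
  add_mem' := fun h h' => h.add h'
  neg_mem' := fun h => h.neg

/-- The group of admissible functions on `X × Y` that are locally constant along `Y`. -/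
def admissibleLocConst (X : LaMan K) : AddSubgroup (X.carrier → Y.carrier → V) where
  carrier := {f | IsAdmissible IG ρ (X.I.prod Y.I) (fun p : X.carrier × Y.carrier => f p.1 p.2) ∧
    IsLocConstAlong f}
  zero_mem' := ⟨isAdmissible_zero, fun _ _ => ⟨Set.univ, Filter.univ_mem, Set.univ,
    Filter.univ_mem, fun _ _ _ _ _ _ => rfl⟩⟩
  add_mem' := by
    rintro f f' ⟨hf, hf2⟩ ⟨hf', hf2'⟩
    refine ⟨hf.add hf', fun b y => ?_⟩
    obtain ⟨N, hN, N', hN', h⟩ := hf2 b y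
    obtain ⟨M, hM, M', hM', h'⟩ := hf2' b y
    refine ⟨N ∩ M, Filter.inter_mem hN hM, N' ∩ M', Filter.inter_mem hN' hM',
      fun b' hb y₁ h₁ y₂ h₂ => ?_⟩
    simp only [Pi.add_apply]
    rw [h b' hb.1 y₁ h₁.1 y₂ h₂.1, h' b' hb.2 y₁ h₁.2 y₂ h₂.2]
  neg_mem' := by
    rintro f ⟨hf, hf2⟩
    refine ⟨hf.neg, fun b y => ?_⟩
    obtain ⟨N, hN, N', hN', h⟩ := hf2 b y
    refine ⟨N, hN, N', hN', fun b' hb y₁ h₁ y₂ h₂ => ?_⟩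
    simp only [Pi.neg_apply]
    rw [h b' hb y₁ h₁ y₂ h₂]

theorem admissibleForms_pull {k : ℕ} {X Z : LaMan K} (f : Z ⟶ X)
    (s : X.carrier → VForm K V (Fin Y.dim → K) Y.carrier k)
    (hs : s ∈ admissibleForms IG ρ Y k X) : s ∘ f.1 ∈ admissibleForms IG ρ Y k Z :=
  IsAdmissibleForm.comp hs (LaMan.contMDiff_hom f)

theorem LaMan.exists_local {T : Type u} {X : LaMan K} {s : X.carrier → T}
    {P : ∀ Z : LaMan K, (Z.carrier → T) → Prop} {x : X.carrier}
    (h : ∃ (U : TopologicalSpace.Opens X.carrier) (_ : ParacompactSpace U), x ∈ U ∧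
      P (X.restrict U) (s ∘ (X.incl U).1)) :
    ∃ (Z : LaMan K) (φ : X.carrier → Z.carrier) (t : Z.carrier → T), P Z t ∧
      ContMDiffAt X.I Z.I ω φ x ∧ ∀ᶠ z in 𝓝 x, s z = t (φ z) := by
  obtain ⟨U, hU, hx, hs⟩ := h
  refine ⟨X.restrict U, X.retract U ⟨x, hx⟩, _, hs, X.contMDiffAt_retract U ⟨x, hx⟩ hx, ?_⟩
  filter_upwards [U.2.mem_nhds hx] with z hz
  change s z = s (X.retract U ⟨x, hx⟩ z)
  rw [X.retract_eq U _ hz]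

theorem admissibleForms_local {k : ℕ} (X : LaMan K)
    (s : X.carrier → VForm K V (Fin Y.dim → K) Y.carrier k)
    (h : ∀ x, ∃ (U : TopologicalSpace.Opens X.carrier) (_ : ParacompactSpace U), x ∈ U ∧
      s ∘ (X.incl U).1 ∈ admissibleForms IG ρ Y k (X.restrict U)) :
    s ∈ admissibleForms IG ρ Y k X := by
  have h' := fun x => LaMan.exists_local (P := fun Z t => t ∈ admissibleForms IG ρ Y k Z) (h x)
  refine ⟨isAnalyticForm_of_localRep fun x y => ?_, isAnalyticForm_of_localRep fun p y => ?_⟩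
  · obtain ⟨Z, φ, t, ht, hφ, he⟩ := h' x
    obtain ⟨W, θ, hθ⟩ := ht.1.exists_localRep (φ x) y
    exact ⟨W, _, (hθ.comp hφ).congr he⟩
  · obtain ⟨Z, φ, t, ht, hφ, he⟩ := h' p.2
    have hψ : ContMDiffAt (IG.prod X.I) (IG.prod Z.I) ω
        (fun q : G × X.carrier => (q.1, φ q.2)) p :=
      contMDiffAt_fst.prodMk (hφ.comp p contMDiffAt_snd)
    obtain ⟨W, θ, hθ⟩ := ht.2.exists_localRep (p.1, φ p.2) y
    refine ⟨W, _, (hθ.comp (φ := fun q : G × X.carrier => (q.1, φ q.2)) hψ).congr ?_⟩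
    filter_upwards [continuousAt_snd.eventually he] with q hq
    funext y
    change _ = ((ρ q.1 : V →L[K] V) : V →ₗ[K] V).compAlternatingMap (t (φ q.2) y)
    rw [← hq]
    rfl

theorem admissibleLocConst_pull {X Z : LaMan K} (f : Z ⟶ X) (s : X.carrier → Y.carrier → V)
    (hs : s ∈ admissibleLocConst IG ρ Y X) : s ∘ f.1 ∈ admissibleLocConst IG ρ Y Z := by
  refine ⟨isAdmissible_of_local fun p => ⟨fun q => (f.1 q.1, q.2), _, hs.1, ?_, by simp⟩,
    fun z y => ?_⟩
  · exact (ContMDiffAt.comp p (LaMan.contMDiff_hom f p.1) contMDiffAt_fst).prodMk contMDiffAt_snd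
  · obtain ⟨N, hN, N', hN', h⟩ := hs.2 (f.1 z) y
    exact ⟨f.1 ⁻¹' N, (LaMan.contMDiff_hom f).continuous.continuousAt.preimage_mem_nhds hN, N', hN',
      fun b hb => h _ hb⟩

theorem admissibleLocConst_local (X : LaMan K) (s : X.carrier → Y.carrier → V)
    (h : ∀ x, ∃ (U : TopologicalSpace.Opens X.carrier) (_ : ParacompactSpace U), x ∈ U ∧
      s ∘ (X.incl U).1 ∈ admissibleLocConst IG ρ Y (X.restrict U)) :
    s ∈ admissibleLocConst IG ρ Y X := by
  have h' := fun x => LaMan.exists_local (P := fun Z t => t ∈ admissibleLocConst IG ρ Y Z) (h x)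
  refine ⟨⟨fun p => ?_, fun p => ?_⟩, fun x y => ?_⟩
  · obtain ⟨Z, φ, t, ht, hφ, he⟩ := h' p.1
    have hψ : ContMDiffAt (X.I.prod Y.I) (Z.I.prod Y.I) ω
        (fun q : X.carrier × Y.carrier => (φ q.1, q.2)) p :=
      (ContMDiffAt.comp p hφ contMDiffAt_fst).prodMk contMDiffAt_snd
    refine (VAnalyticAt.comp (φ := fun q : X.carrier × Y.carrier => (φ q.1, q.2))
      (ht.1.1 _) hψ).congr ?_
    filter_upwards [continuousAt_fst.eventually he] with q hq
    simp only [hq]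
  · obtain ⟨Z, φ, t, ht, hφ, he⟩ := h' p.2.1
    have hψ : ContMDiffAt (IG.prod (X.I.prod Y.I)) (IG.prod (Z.I.prod Y.I)) ω
        (fun q : G × (X.carrier × Y.carrier) => (q.1, (φ q.2.1, q.2.2))) p :=
      contMDiffAt_fst.prodMk ((ContMDiffAt.comp p hφ
        (contMDiffAt_fst.comp p contMDiffAt_snd)).prodMk (contMDiffAt_snd.comp p contMDiffAt_snd))
    refine (VAnalyticAt.comp (φ := fun q : G × (X.carrier × Y.carrier) =>
      (q.1, (φ q.2.1, q.2.2))) (ht.1.2 _) hψ).congr ?_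
    have hc : ContinuousAt (fun q : G × (X.carrier × Y.carrier) => q.2.1) p :=
      (continuous_fst.comp continuous_snd).continuousAt
    filter_upwards [hc.eventually he] with q hq
    simp only [hq]
  · obtain ⟨Z, φ, t, ht, hφ, he⟩ := h' x
    obtain ⟨N, hN, N', hN', hc⟩ := ht.2 (φ x) y
    refine ⟨_, Filter.inter_mem he (hφ.continuousAt.preimage_mem_nhds hN), N', hN',
      fun b hb y₁ h₁ y₂ h₂ => ?_⟩
    have hb1 : s b = t (φ b) := hb.1
    rw [hb1]
    exact hc _ hb.2 y₁ h₁ y₂ h₂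

/-- The sheaf `X ↦ Ω^k_ad(X × Y / X, V)` of admissible relative forms. -/
def formSheaf (k : ℕ) : Sheaf (LaMan.openTopology K) AddCommGrpCat.{u + 1} :=
  LaMan.funSheaf (admissibleForms IG ρ Y k) (admissibleForms_pull IG ρ Y)
    (admissibleForms_local IG ρ Y)

/-- The sheaf sending `X` to the group of admissible functions on `X × Y` that are locally constant
along `Y`. -/
def locConstSheaf : Sheaf (LaMan.openTopology K) AddCommGrpCat.{u + 1} :=
  LaMan.funSheaf (admissibleLocConst IG ρ Y) (admissibleLocConst_pull IG ρ Y)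
    (admissibleLocConst_local IG ρ Y)

/-- The exterior derivative along `Y` as a morphism of sheaves. -/
def formSheafD (k : ℕ) : formSheaf IG ρ Y k ⟶ formSheaf IG ρ Y (k + 1) where
  hom :=
    { app := fun X => AddCommGrpCat.ofHom
        (X := ULift.{u + 1} (admissibleForms IG ρ Y k X.unop))
        (Y := ULift.{u + 1} (admissibleForms IG ρ Y (k + 1) X.unop)) <|
        AddMonoidHom.mk' (fun s => ⟨⟨fun x => formD (s.down.1 x), IsAdmissibleForm.formD s.down.2⟩⟩)
          fun s t => ULift.ext _ _ <| Subtype.ext <| funext fun x =>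
            s.down.2.1.formD_add t.down.2.1 x
      naturality := fun _ _ _ => rfl }

theorem formSheafD_comp (k : ℕ) : formSheafD IG ρ Y k ≫ formSheafD IG ρ Y (k + 1) = 0 := by
  apply Sheaf.hom_ext
  apply NatTrans.ext
  funext X
  apply AddCommGrpCat.hom_ext
  refine AddMonoidHom.ext
    fun (s : ULift.{u + 1} (admissibleForms IG ρ Y k X.unop)) => ?_
  exact ULift.ext _ _ <| Subtype.ext <| funext fun x => s.down.2.1.formD_formD x

/-- The relative de Rham complex `Ω^*_ad(Y, V)` of admissible forms, a complex of abelian sheaves on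
the site of manifolds. -/
def deRhamComplex : CochainComplex (Sheaf (LaMan.openTopology K) AddCommGrpCat.{u + 1}) ℕ :=
  CochainComplex.of (formSheaf IG ρ Y) (formSheafD IG ρ Y) (formSheafD_comp IG ρ Y)

/-- The inclusion of the functions locally constant along `Y` into the `0`-forms. -/
def locConstInclusion : locConstSheaf IG ρ Y ⟶ formSheaf IG ρ Y 0 where
  hom :=
    { app := fun X => AddCommGrpCat.ofHom
        (X := ULift.{u + 1} (admissibleLocConst IG ρ Y X.unop))
        (Y := ULift.{u + 1} (admissibleForms IG ρ Y 0 X.unop)) <|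
        AddMonoidHom.mk'
          (fun s => ⟨⟨fun x => zeroForm (s.down.1 x), isAdmissibleForm_zeroForm s.down.2.1⟩⟩)
          fun _ _ => rfl
      naturality := fun _ _ _ => rfl }

theorem locConstInclusion_comp : locConstInclusion IG ρ Y ≫ formSheafD IG ρ Y 0 = 0 := by
  apply Sheaf.hom_ext
  apply NatTrans.ext
  funext X
  apply AddCommGrpCat.hom_ext
  refine AddMonoidHom.ext
    fun (s : ULift.{u + 1} (admissibleLocConst IG ρ Y X.unop)) => ?_
  exact ULift.ext _ _ <| Subtype.ext <| funext fun x => formD_zeroForm s.down.2.2 x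

/-- The inclusion of the sheaf of functions locally constant along `Y`, as a complex concentrated
in degree `0`, into the relative de Rham complex. -/
def deRhamInclusion :
    (CochainComplex.single₀ _).obj (locConstSheaf IG ρ Y) ⟶ deRhamComplex IG ρ Y :=
  (CochainComplex.fromSingle₀Equiv _ _).symm ⟨locConstInclusion IG ρ Y, by
    have h : (deRhamComplex IG ρ Y).d 0 1 = formSheafD IG ρ Y 0 :=
      CochainComplex.of_d (formSheaf IG ρ Y) (formSheafD IG ρ Y) 0
    rw [h]
    exact locConstInclusion_comp IG ρ Y⟩

end DeRham

end

/-! ### Growth of the inverses of the positive integers in `K` -/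

section NatBound

/-! The complex is exact already on sections over every manifold `X`. The core is a Poincaré lemma
with parameters. In a chart centred at `y₀`, the primitive of a closed form `θ` of degree `k + 1` is
the contraction with the radial field `y - y₀` of the solution `f` of the Euler equation `(k + 1) f
+ D_{y - y₀} f = θ`. The left hand side is the Lie derivative of `f` along the radial field. On
power series the equation is solved by dividing the part of degree `m` in `y` by `m + k + 1`. This
preserves a positive radius of convergence because `‖n⁻¹‖` grows at most exponentially in `n`
(`exists_norm_inv_natCast_le`, `AnalyticAt.exists_euler`). Analytic solutions are unique
(`HasFPowerSeriesOnBall.eq_zero_of_euler`). As `df` solves the Euler equation with constant `k + 2`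
and right hand side `dθ = 0`, uniqueness gives `df = 0`, and Cartan's formula then says that the
contraction of `f` is a primitive of `θ`.

Admissibility also follows from uniqueness. The equation is solved for the form `g η`, with `G`
among the parameters, near `g = 1`, and the primitive `ζ` of `η` is read off at `g = 1`. Both `g
f(1, b, ·)` and `f(g, b, ·)` solve the equation for `g η`, so they agree once they are compared in a
BH-space that contains `W` and `g W`. Hence `g ζ` is analytic near `g = 1`, and translation in `G`
carries this to all of `G` (`LocalRep.translate`).

Passing from local to global uses that the manifolds are totally disconnected: every open covering
of `X × Y` is refined by a partition into open sets (`hasOpenPartitions_prod`). Local primitives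
chosen separately on the blocks form a global one.

In degree `0`, a closed form has vanishing derivative along `Y` and is locally constant along `Y`,
by the uniqueness statement with constant `0`. -/

theorem exists_norm_inv_natCast_le (K : Type*) [NontriviallyNormedField K] [IsUltrametricDist K]
    [CharZero K] : ∃ a : ℝ, 1 ≤ a ∧ ∀ n : ℕ, n ≠ 0 → ‖(n : K)⁻¹‖ ≤ a ^ n := by
  classical
  by_cases hex : ∃ n : ℕ, n ≠ 0 ∧ ‖(n : K)‖ < 1
  -- The least positive integer `p` with `‖p‖ < 1` divides every `n` with `‖n‖ < 1`, since the
  -- remainder of `n` has norm less than `1` as well. Splitting off one factor `p` costs `‖p‖⁻¹`,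
  -- and `m + 1 ≤ p * m` pays for it in the induction.
  · set p := Nat.find hex with hp
    have hp0 : p ≠ 0 := (Nat.find_spec hex).1
    have hp1 : ‖(p : K)‖ < 1 := (Nat.find_spec hex).2
    have hpK : 0 < ‖(p : K)‖ := norm_pos_iff.2 (Nat.cast_ne_zero.2 hp0)
    have ha : 1 ≤ ‖(p : K)‖⁻¹ := (one_le_inv₀ hpK).2 hp1.le
    refine ⟨‖(p : K)‖⁻¹, ha, fun n => ?_⟩
    induction n using Nat.strong_induction_on with
    | _ n ih =>
      intro hn
      by_cases h1 : ‖(n : K)‖ < 1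
      · have hdvd : p ∣ n := by
          by_contra hnd
          have hr0 : n % p ≠ 0 := fun h => hnd (Nat.dvd_of_mod_eq_zero h)
          have hlt : n % p < p := Nat.mod_lt _ (Nat.pos_of_ne_zero hp0)
          refine Nat.find_min hex hlt ⟨hr0, ?_⟩
          have e : ((n % p : ℕ) : K) = n - p * (n / p : ℕ) := by
            have := Nat.mod_add_div n p
            rw [eq_sub_iff_add_eq]
            exact_mod_cast this
          rw [e, sub_eq_add_neg]
          refine (IsUltrametricDist.norm_add_le_max _ _).trans_lt (max_lt h1 ?_)
          rw [norm_neg, norm_mul]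
          exact mul_lt_one_of_nonneg_of_lt_one_left (norm_nonneg _) hp1
            (IsUltrametricDist.norm_natCast_le_one K _)
        obtain ⟨m, rfl⟩ := hdvd
        have hm : m ≠ 0 := by rintro rfl; simp at hn
        have hp2 : 2 ≤ p := by
          rcases Nat.lt_or_ge p 2 with h | h
          · have : p = 1 := by omega
            rw [this] at hp1
            simp at hp1
          · exact h
        have hlt : m < p * m := by nlinarith [Nat.pos_of_ne_zero hm]
        rw [Nat.cast_mul, mul_inv, norm_mul, norm_inv]
        calc _ ≤ ‖(p : K)‖⁻¹ * ‖(p : K)‖⁻¹ ^ m := by gcongr; exact ih m hlt hm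
          _ = ‖(p : K)‖⁻¹ ^ (m + 1) := by rw [pow_succ']
          _ ≤ _ := pow_le_pow_right₀ ha hlt
      · rw [norm_inv]
        exact (inv_le_one_of_one_le₀ (not_lt.1 h1)).trans (one_le_pow₀ ha)
  · push Not at hex
    refine ⟨1, le_rfl, fun n hn => ?_⟩
    rw [norm_inv, one_pow]
    exact inv_le_one_of_one_le₀ (hex n hn)

end NatBound

/-! ### Solving the Euler equation by power series -/

section Euler

variable {K : Type*} [NontriviallyNormedField K]
  {E : Type*} [NormedAddCommGroup E] [NormedSpace K E]
  {F : Type*} [NormedAddCommGroup F] [NormedSpace K F]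
  {W : Type*} [NormedAddCommGroup W] [NormedSpace K W]

/-- The `n`-element subsets of `n + 1` slots are the complements of single slots, and the omitted
slot receives `v`. The direction `v` is independent of `x` because the Euler operator differentiates
along `F` only, in the direction `(0, z.2)` at the point `z`. -/
theorem FormalMultilinearSeries.derivSeries_apply_eq_sum (p : FormalMultilinearSeries K E W)
    (n : ℕ) (x v : E) :
    p.derivSeries n (fun _ => x) v = ∑ i, p (n + 1) (Function.update (fun _ => x) i v) := by
  -- The degree is a variable `m` because `1 + n` and `n + 1` are not definitionally equal.
  have key : ∀ (m : ℕ) (h : 1 + n = m),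
      ∑ s : { s : Finset (Fin (1 + n)) // s.card = n },
        p (1 + n) ((s : Finset _).piecewise (fun _ => x) fun _ => v) =
      ∑ i : Fin m, p m (Function.update (fun _ => x) i v) := by
    rintro m rfl
    refine (Fintype.sum_bijective
      (fun i : Fin (1 + n) => (⟨{i}ᶜ, by simp [Finset.card_compl]⟩ :
        { s : Finset (Fin (1 + n)) // s.card = n })) ⟨fun i j h => ?_, ?_⟩ _ _ fun i => ?_).symm
    · simpa using h
    · rintro ⟨s, hs⟩
      have h : sᶜ.card = 1 := by rw [Finset.card_compl, hs, Fintype.card_fin, Nat.add_sub_cancel]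
      obtain ⟨a, ha⟩ := Finset.card_eq_one.mp h
      exact ⟨a, Subtype.ext (compl_eq_comm.mp ha)⟩
    · congr 1
      funext j
      by_cases hj : j = i
      · subst hj
        simp
      · simp [Finset.piecewise, hj]
  rw [← key (n + 1) (add_comm 1 n)]
  simp only [FormalMultilinearSeries.derivSeries,
    ContinuousLinearMap.compFormalMultilinearSeries_apply,
    FormalMultilinearSeries.changeOriginSeries, ContinuousLinearMap.compContinuousMultilinearMap_coe,
    Function.comp_apply, _root_.sum_apply, map_sum]
  refine Finset.sum_congr rfl fun s _ => ?_
  rw [← p.changeOriginSeriesTerm_apply 1 n s s.2]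
  change _ = (p.changeOriginSeriesTerm 1 n s s.2 fun _ => x) fun _ => v
  exact continuousMultilinearCurryFin1_apply _ _

/-- The projection of `E × F` to `F` or to `E`, as an endomorphism of `E × F`. -/
noncomputable def partProj (K E F : Type*) [NontriviallyNormedField K] [NormedAddCommGroup E]
    [NormedSpace K E] [NormedAddCommGroup F] [NormedSpace K F] (b : Prop) [Decidable b] :
    E × F →L[K] E × F :=
  if b then ContinuousLinearMap.inr K E F ∘L ContinuousLinearMap.snd K E F
  else ContinuousLinearMap.inl K E F ∘L ContinuousLinearMap.fst K E F

theorem norm_partProj_le (b : Prop) [Decidable b] : ‖partProj K E F b‖ ≤ 1 := by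
  refine ContinuousLinearMap.opNorm_le_bound _ zero_le_one fun z => ?_
  rw [one_mul, Prod.norm_def z]
  by_cases h : b <;> simp [partProj, h, Prod.norm_def]

/-- Divide the part of `p` which is homogeneous of degree `m` in the variable in `F` by `m + c`. -/
noncomputable def eulerSeries (c : ℕ) (p : FormalMultilinearSeries K (E × F) W) :
    FormalMultilinearSeries K (E × F) W := fun n =>
  ∑ S : Finset (Fin n), ((S.card + c : ℕ) : K)⁻¹ •
    (p n).compContinuousLinearMap fun i => partProj K E F (i ∈ S)

/-- Writing `z = (0, z.2) + (z.1, 0)` in every slot decomposes `p n` into pieces indexed by the set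
`S` of slots that receive the part in `F`. Replacing slot `i` by `(0, z.2)` fixes the piece of `S`
if `i ∈ S` and kills it otherwise. The sum over `i` therefore multiplies this piece by `S.card`, and
the total factor `S.card + c` cancels the inverse in `eulerSeries`. -/
theorem eulerSeries_euler [CharZero K] {c : ℕ} (hc : c ≠ 0)
    (p : FormalMultilinearSeries K (E × F) W) (n : ℕ) (z : E × F) :
    (c : K) • eulerSeries c p n (fun _ => z) +
      ∑ i, eulerSeries c p n (Function.update (fun _ => z) i (0, z.2)) = p n fun _ => z := by
  have hsplit : (p n fun _ => z) = ∑ S : Finset (Fin n),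
      p n (fun i => partProj K E F (i ∈ S) z) := by
    have := (p n).map_add_univ (fun _ => ((0 : E), z.2)) (fun _ => (z.1, (0 : F)))
    have e : ((fun _ => ((0 : E), z.2)) + (fun _ => (z.1, (0 : F))) : Fin n → E × F) =
        fun _ => z := by
      funext i; simp
    rw [e] at this
    rw [this]
    refine Finset.sum_congr rfl fun S _ => ?_
    congr 1
    funext i
    by_cases h : i ∈ S <;> simp [partProj, h]
  have hupd : ∀ (S : Finset (Fin n)) (i : Fin n),
      (p n) (fun j => partProj K E F (j ∈ S)
        ((Function.update (fun _ => z) i (0, z.2) : Fin n → E × F) j)) =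
      if i ∈ S then p n (fun j => partProj K E F (j ∈ S) z) else 0 := by
    intro S i
    split_ifs with hi
    · congr 1
      funext j
      by_cases hj : j = i
      · subst hj
        simp [partProj, hi]
      · simp [hj]
    · refine (p n).map_coord_zero i ?_
      simp [partProj, hi]
  simp only [eulerSeries, _root_.sum_apply, _root_.smul_apply,
    ContinuousMultilinearMap.compContinuousLinearMap_apply, hupd]
  rw [Finset.sum_comm, hsplit, Finset.smul_sum, ← Finset.sum_add_distrib]
  refine Finset.sum_congr rfl fun S _ => ?_
  rw [← Finset.smul_sum, Finset.sum_ite_mem, Finset.univ_inter, Finset.sum_const,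
    ← Nat.cast_smul_eq_nsmul K, smul_smul, smul_smul, ← add_smul]
  have : ((S.card + c : ℕ) : K) ≠ 0 := by
    rw [Nat.cast_ne_zero]
    omega
  rw [mul_comm (c : K), ← mul_add, ← Nat.cast_add, add_comm c, inv_mul_cancel₀ this, one_smul]

/-- There are `2 ^ n` pieces, each of norm at most `a ^ (n + c) * ‖p n‖` because `S.card ≤ n`. A
geometric bound on `p` with ratio `r` thus becomes one with ratio `2 * a * r`. -/
theorem eulerSeries_radius_pos [IsUltrametricDist K] [CharZero K] {c : ℕ} (hc : c ≠ 0)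
    {p : FormalMultilinearSeries K (E × F) W} (hp : 0 < p.radius) :
    0 < (eulerSeries c p).radius := by
  obtain ⟨a, ha, hinv⟩ := exists_norm_inv_natCast_le K
  obtain ⟨C, r, hC, hr, hCr⟩ := p.le_mul_pow_of_radius_pos hp
  have ha0 : 0 < a := zero_lt_one.trans_le ha
  have hbound : ∀ n, ‖eulerSeries c p n‖ ≤ (C * a ^ c) * (2 * a * r) ^ n := by
    intro n
    have h1 : ∀ S : Finset (Fin n), ‖((S.card + c : ℕ) : K)⁻¹ •
        (p n).compContinuousLinearMap fun i => partProj K E F (i ∈ S)‖ ≤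
        a ^ (n + c) * (C * r ^ n) := by
      intro S
      rw [norm_smul]
      have hS : S.card ≤ n := (Finset.card_le_univ S).trans_eq (Fintype.card_fin n)
      refine mul_le_mul ((hinv _ (by omega)).trans (pow_le_pow_right₀ ha (by omega))) ?_
        (norm_nonneg _) (by positivity)
      refine (ContinuousMultilinearMap.norm_compContinuousLinearMap_le _ _).trans ?_
      refine (mul_le_of_le_one_right (norm_nonneg _) ?_).trans (hCr n)
      exact Finset.prod_le_one (fun _ _ => norm_nonneg _) fun _ _ => norm_partProj_le _
    refine (norm_sum_le_of_le _ fun S _ => h1 S).trans_eq ?_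
    rw [Finset.sum_const, Finset.card_univ, Fintype.card_finset, Fintype.card_fin, nsmul_eq_mul,
      mul_pow, mul_pow, pow_add]
    push_cast
    ring
  have hs : 0 < 2 * a * r := by positivity
  let s : NNReal := ⟨(2 * a * r)⁻¹, by positivity⟩
  refine lt_of_lt_of_le ?_ ((eulerSeries c p).le_radius_of_bound (C * a ^ c) (r := s) fun n => ?_)
  · rw [ENNReal.coe_pos]
    exact inv_pos.2 hs
  · calc _ ≤ (C * a ^ c) * (2 * a * r) ^ n * (2 * a * r)⁻¹ ^ n := by
          gcongr
          · exact hbound n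
          · exact le_rfl
      _ = C * a ^ c := by
          rw [mul_assoc, ← mul_pow, mul_inv_cancel₀ hs.ne', one_pow, mul_one]

/-- The inhomogeneous Euler equation in the variable in `F`, with parameters in `E`, has an analytic
solution. -/
theorem AnalyticAt.exists_euler [IsUltrametricDist K] [CharZero K] [CompleteSpace W]
    {θ : E × F → W} {z₀ : E × F} (hθ : AnalyticAt K θ z₀) {c : ℕ} (hc : c ≠ 0) :
    ∃ f : E × F → W, AnalyticAt K f z₀ ∧
      ∀ᶠ z in 𝓝 z₀, (c : K) • f z + fderiv K f z (0, z.2 - z₀.2) = θ z := by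
  obtain ⟨p, r, hp⟩ := hθ
  have hpos := eulerSeries_radius_pos hc (hp.r_pos.trans_le hp.r_le)
  set q := eulerSeries c p with hq
  have hf0 := q.hasFPowerSeriesOnBall hpos
  have hf : HasFPowerSeriesOnBall (fun z => q.sum (z - z₀)) q z₀ q.radius := by
    simpa using hf0.comp_sub z₀
  refine ⟨_, hf.analyticAt, ?_⟩
  have hR : 0 < min r q.radius := lt_min hp.r_pos hpos
  filter_upwards [Metric.eball_mem_nhds z₀ hR] with z hz
  have hz1 : z ∈ Metric.eball z₀ r := Metric.eball_subset_eball (min_le_left _ _) hz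
  have hz2 : z ∈ Metric.eball z₀ q.radius := Metric.eball_subset_eball (min_le_right _ _) hz
  have s1 := (hf.hasSum_sub hz2).const_smul (c : K)
  have s2 := hf.fderiv.hasSum_sub hz2
  have s3 := (ContinuousLinearMap.apply K W ((0 : E), z.2 - z₀.2)).hasSum s2
  simp only [ContinuousLinearMap.apply_apply,
    FormalMultilinearSeries.derivSeries_apply_eq_sum] at s3
  set g : ℕ → W := fun n =>
    ∑ i, q n (Function.update (fun _ => z - z₀) i ((0 : E), z.2 - z₀.2)) with hg
  have s4 : HasSum g (fderiv K (fun z => q.sum (z - z₀)) z (0, z.2 - z₀.2)) := by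
    -- The term of degree `n` of the derivative comes from degree `n + 1` of `q`. The missing term
    -- `g 0` is an empty sum.
    refine (hasSum_nat_add_iff' (f := g) 1).1 ?_
    simpa [hg] using s3
  have s5 := s1.add s4
  refine s5.unique ?_
  convert hp.hasSum_sub hz1 using 2 with n
  exact eulerSeries_euler hc p n (z - z₀)

end Euler

/-! ### Uniqueness for the Euler equation, on balls of uniform radius -/

section EulerUniqueness

variable {K : Type*} [NontriviallyNormedField K]
  {E : Type*} [NormedAddCommGroup E] [NormedSpace K E]
  {F : Type*} [NormedAddCommGroup F] [NormedSpace K F]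
  {W : Type*} [NormedAddCommGroup W] [NormedSpace K W] [CompleteSpace W]

/-- The homogeneous Euler equation has no nonzero analytic solution; for `c = 0` the value at the
origin has to be prescribed. -/
theorem HasFPowerSeriesOnBall.eq_zero_of_euler [CharZero K] {u : F → W}
    {p : FormalMultilinearSeries K F W} {y₀ : F} {r : ENNReal}
    (h : HasFPowerSeriesOnBall u p y₀ r) {c : ℕ} (h0 : c = 0 → u y₀ = 0)
    (he : ∀ᶠ y in 𝓝 y₀, (c : K) • u y + fderiv K u y (y - y₀) = 0) {y : F}
    (hy : y ∈ Metric.eball y₀ r) : u y = 0 := by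
  -- On the line `t ↦ y₀ + t • v` the equation says that the power series in `t` with coefficients
  -- `(c + n) • p n (v, …, v)` vanishes near `0`. Hence all these coefficients vanish. Since this
  -- determines `p` on the diagonal, `u` vanishes on the whole ball of the expansion, although the
  -- equation is only known near `y₀`.
  have key : ∀ (v : F) (n : ℕ), (p n fun _ => v) = 0 := by
    intro v n
    let a : ℕ → W := fun n => ((c + n : ℕ) : K) • p n fun _ => v
    let P : FormalMultilinearSeries K K W := fun n => ContinuousMultilinearMap.mkPiRing K (Fin n) (a n)
    have hP : HasFPowerSeriesAt (0 : K → W) P 0 := by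
      rw [hasFPowerSeriesAt_iff]
      have hc : Filter.Tendsto (fun t : K => y₀ + t • v) (𝓝 0) (𝓝 y₀) := by
        have : Continuous fun t : K => y₀ + t • v := by fun_prop
        simpa using this.tendsto 0
      filter_upwards [hc.eventually he, hc (Metric.eball_mem_nhds y₀ h.r_pos)] with t ht1 ht2
      have s1 := (h.hasSum_sub ht2).const_smul (c : K)
      have s2 := (ContinuousLinearMap.apply K W (t • v)).hasSum (h.fderiv.hasSum_sub ht2)
      simp only [add_sub_cancel_left] at s1 s2 ht1
      simp only [ContinuousLinearMap.apply_apply,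
        FormalMultilinearSeries.derivSeries_apply_diag] at s2
      have s3 : HasSum (fun n : ℕ => n • p n fun _ => t • v)
          (fderiv K u (y₀ + t • v) (t • v)) := by
        refine (hasSum_nat_add_iff' (f := fun n : ℕ => n • p n fun _ => t • v) 1).1 ?_
        simpa using s2
      have s4 := s1.add s3
      rw [ht1] at s4
      have e : ∀ n : ℕ, t ^ n • P.coeff n =
          (c : K) • (p n fun _ => t • v) + n • p n fun _ => t • v := by
        intro n
        have h1 : (p n fun _ => t • v) = t ^ n • p n fun _ => v := by
          have := (p n).map_smul_univ (fun _ => t) (fun _ => v)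
          simpa using this
        have h2 : P.coeff n = a n := by
          simp [P, FormalMultilinearSeries.coeff, Pi.one_def]
        rw [h1, h2, ← Nat.cast_smul_eq_nsmul K n, ← add_smul, smul_comm, ← Nat.cast_add]
      simpa only [e, Pi.zero_apply] using s4
    have hz : a n = 0 := by
      have := congrFun hP.eq_zero n
      have h2 := congrArg (fun q => q (fun _ => (1 : K))) this
      simpa [P] using h2
    -- The factor `c + n` is invertible except for `c = n = 0`, where the coefficient is the
    -- prescribed value `u y₀ = 0`.
    by_cases hcn : c + n = 0
    · have hc0 : c = 0 := by omega
      have hn0 : n = 0 := by omega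
      subst hn0
      rw [h.coeff_zero, h0 hc0]
    · exact (smul_eq_zero.1 hz).resolve_left (Nat.cast_ne_zero.2 hcn)
  refine (h.hasSum_sub hy).unique ?_
  simp only [key]
  exact hasSum_zero

/-- With `s` smaller than the radius of a joint expansion at `(b₀, y₀)`, the series can be recentred
at `(b, y₀)` for `‖b - b₀‖ < s / 2`, which leaves the radius `s / 2`. Restriction to the slice keeps
this radius. Uniqueness can then be applied to each slice on a ball that does not shrink as `b`
varies. -/
theorem AnalyticAt.exists_uniform_ball {f : E × F → W} {b₀ : E} {y₀ : F}
    (hf : AnalyticAt K f (b₀, y₀)) :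
    ∃ r : ENNReal, 0 < r ∧ ∀ᶠ b in 𝓝 b₀, ∃ p : FormalMultilinearSeries K F W,
      HasFPowerSeriesOnBall (fun y => f (b, y)) p y₀ r := by
  obtain ⟨p, r₀, hp⟩ := hf
  obtain ⟨s, hs0, hs⟩ := ENNReal.lt_iff_exists_nnreal_btwn.1 hp.r_pos
  have hs2 : (0 : ENNReal) < (s / 2 : NNReal) := by
    rw [ENNReal.coe_pos]
    exact half_pos (ENNReal.coe_pos.1 hs0)
  refine ⟨(s / 2 : NNReal), hs2, ?_⟩
  filter_upwards [Metric.eball_mem_nhds b₀ hs2] with b hb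
  have hn : ‖(b - b₀, (0 : F))‖₊ < s / 2 := by
    rw [Metric.mem_eball, edist_eq_enorm_sub, enorm_eq_nnnorm, ENNReal.coe_lt_coe] at hb
    simpa [Prod.nnnorm_def] using hb
  have hlt : (‖(b - b₀, (0 : F))‖₊ : ENNReal) < r₀ :=
    (ENNReal.coe_lt_coe.2 (hn.trans_le (half_le_self zero_le))).trans hs
  have h1 := hp.changeOrigin hlt
  have h2 : HasFPowerSeriesOnBall f (p.changeOrigin (b - b₀, 0)) (b, y₀) (s / 2 : NNReal) := by
    have e : (b₀, y₀) + (b - b₀, (0 : F)) = (b, y₀) := by simp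
    rw [e] at h1
    refine h1.mono hs2 ?_
    rw [ENNReal.le_sub_iff_add_le_left ENNReal.coe_ne_top hlt.le]
    refine le_trans ?_ hs.le
    rw [← ENNReal.coe_add, ENNReal.coe_le_coe]
    calc _ ≤ s / 2 + s / 2 := by gcongr
      _ = s := add_halves s
  have h3 : HasFPowerSeriesOnBall (fun z => f (z + (b, 0))) (p.changeOrigin (b - b₀, 0))
      (ContinuousLinearMap.inr K E F y₀) (s / 2 : NNReal) := by
    have h := h2.comp_sub (-(b, (0 : F)))
    have e : (b, y₀) + -(b, (0 : F)) = ContinuousLinearMap.inr K E F y₀ := by simp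
    simpa only [sub_neg_eq_add, e] using h
  have h4 := h3.compContinuousLinearMap
  refine ⟨_, (h4.mono hs2 ?_).congr fun y _ => by simp⟩
  have hle : ‖ContinuousLinearMap.inr K E F‖ₑ ≤ 1 := by
    rw [enorm_eq_nnnorm, ← ENNReal.coe_one, ENNReal.coe_le_coe]
    exact ContinuousLinearMap.norm_inr_le_one K E F
  calc ((s / 2 : NNReal) : ENNReal) = (s / 2 : NNReal) / 1 := by simp
    _ ≤ _ := ENNReal.div_le_div_left hle _

/-- Each slice vanishes on the ball supplied by `AnalyticAt.exists_uniform_ball`. As its radius is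
independent of the parameter, these balls fill a neighbourhood of `(b₀, y₀)`. -/
theorem AnalyticAt.eq_zero_of_euler [CharZero K] {u : E × F → W} {b₀ : E} {y₀ : F}
    (hu : AnalyticAt K u (b₀, y₀)) {c : ℕ} (h0 : c = 0 → ∀ᶠ b in 𝓝 b₀, u (b, y₀) = 0)
    (he : ∀ᶠ z in 𝓝 (b₀, y₀),
      (c : K) • u z + fderiv K (fun y => u (z.1, y)) z.2 (z.2 - y₀) = 0) :
    ∀ᶠ z in 𝓝 (b₀, y₀), u z = 0 := by
  obtain ⟨r, hr, hp⟩ := hu.exists_uniform_ball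
  have h0' : ∀ᶠ b in 𝓝 b₀, c = 0 → u (b, y₀) = 0 := by
    by_cases hc : c = 0
    · simpa [hc] using h0 hc
    · simp [hc]
  have hs : ∀ᶠ b in 𝓝 b₀, ∀ᶠ y in 𝓝 y₀,
      (c : K) • u (b, y) + fderiv K (fun y => u (b, y)) y (y - y₀) = 0 :=
    he.curry_nhds
  rw [nhds_prod_eq]
  filter_upwards [((hp.and h0').and hs).prod_mk (Metric.eball_mem_nhds y₀ hr)] with z hz
  obtain ⟨⟨⟨⟨p, hp⟩, h0⟩, hs⟩, hz2⟩ := hz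
  exact hp.eq_zero_of_euler h0 hs hz2

end EulerUniqueness

/-! ### The Poincaré lemma with parameters -/

section Poincare

variable {K : Type*} [NontriviallyNormedField K]
  {E : Type*} [NormedAddCommGroup E] [NormedSpace K E]
  {F : Type*} [NormedAddCommGroup F] [NormedSpace K F]
  {W : Type*} [NormedAddCommGroup W] [NormedSpace K W] {k : ℕ}

theorem HasFDerivAt.clm_comp_apply {A : Type*} [NormedAddCommGroup A] [NormedSpace K A]
    {f : F → A} {f' : F →L[K] A} {y : F} (hf : HasFDerivAt f f' y) (L : A →L[K] W) :
    HasFDerivAt (fun z => L (f z)) (L ∘L f') y :=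
  L.hasFDerivAt.comp y hf

theorem AnalyticAt.clm_comp_apply {A : Type*} [NormedAddCommGroup A] [NormedSpace K A]
    {f : F → A} {y : F} (hf : AnalyticAt K f y) (L : A →L[K] W) :
    AnalyticAt K (fun z => L (f z)) y :=
  (L.analyticAt _).comp hf

/-- The exterior derivative commutes with the Lie derivative along the radial field. The constant
rises by one because differentiating `y - y₀` contributes one more copy of `fderiv K f y`, whose
alternatization is `extDeriv f y`. The term with the second derivative is the radial derivative of
`extDeriv f`, by symmetry. -/
theorem extDeriv_euler {f : F → F [⋀^Fin k]→L[K] W} {y : F} (hf : ContDiffAt K ω f y) (y₀ : F)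
    (c : K) :
    extDeriv (fun y => c • f y + fderiv K f y (y - y₀)) y =
      (c + 1) • extDeriv f y + fderiv K (extDeriv f) y (y - y₀) := by
  have hd : DifferentiableAt K f y := hf.differentiableAt (by simp)
  have hd2 : DifferentiableAt K (fderiv K f) y :=
    (hf.fderiv_right (m := ω) (by simp)).differentiableAt (by simp)
  have h1 : HasFDerivAt (fun y => c • f y + fderiv K f y (y - y₀))
      (c • fderiv K f y + (fderiv K f y + (fderiv K (fderiv K f) y).flip (y - y₀))) y := by
    refine (hd.hasFDerivAt.const_smul c).add ?_
    have := hd2.hasFDerivAt.clm_apply ((hasFDerivAt_id y).sub_const y₀)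
    simpa using this
  have hsymm : (fderiv K (fderiv K f) y).flip (y - y₀) = fderiv K (fderiv K f) y (y - y₀) := by
    ext1 v
    exact hf.isSymmSndFDerivAt le_top v (y - y₀)
  have h2 : fderiv K (extDeriv f) y (y - y₀) = ContinuousAlternatingMap.alternatizeUncurryFin
      (fderiv K (fderiv K f) y (y - y₀)) := by
    have h := HasFDerivAt.clm_comp_apply (K := K) (A := F →L[K] F [⋀^Fin k]→L[K] W)
      (W := F [⋀^Fin (k + 1)]→L[K] W) hd2.hasFDerivAt
      (ContinuousAlternatingMap.alternatizeUncurryFinCLM K F W)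
    exact congrArg (fun A => A (y - y₀)) h.fderiv
  rw [h2, extDeriv, h1.fderiv, hsymm, extDeriv]
  simp only [ContinuousAlternatingMap.alternatizeUncurryFin_add,
    ContinuousAlternatingMap.alternatizeUncurryFin_smul, add_smul, one_smul, add_assoc]

/-- Cartan's formula for the radial vector field and a closed form. -/
theorem extDeriv_curryLeft {f : F → F [⋀^Fin (k + 1)]→L[K] W} {y : F}
    (hf : DifferentiableAt K f y) (hd : extDeriv f y = 0) (y₀ : F) :
    extDeriv (fun y => (f y).curryLeft (y - y₀)) y =
      ((k + 1 : ℕ) : K) • f y + fderiv K f y (y - y₀) := by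
  let C : (F [⋀^Fin (k + 1)]→L[K] W) →L[K] F →L[K] F [⋀^Fin k]→L[K] W :=
    (ContinuousAlternatingMap.curryLeftLI (𝕜 := K) (E := F) (F := W) (n := k)).toContinuousLinearMap
  have h1 : HasFDerivAt (fun y => (f y).curryLeft (y - y₀))
      ((f y).curryLeft + (C ∘L fderiv K f y).flip (y - y₀)) y := by
    have hC := HasFDerivAt.clm_comp_apply (K := K) (A := F [⋀^Fin (k + 1)]→L[K] W)
      (W := F →L[K] F [⋀^Fin k]→L[K] W) hf.hasFDerivAt C
    have := HasFDerivAt.clm_apply (G := F) (H := F [⋀^Fin k]→L[K] W) hC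
      ((hasFDerivAt_id y).sub_const y₀)
    simpa using! this
  rw [extDeriv, h1.fderiv, ContinuousAlternatingMap.alternatizeUncurryFin_add,
    ContinuousAlternatingMap.alternatizeUncurryFin_curryLeft, ← Nat.cast_smul_eq_nsmul K]
  congr 1
  ext v
  -- Closedness is evaluated at `(y - y₀, v)`. The first summand is the radial derivative of `f` at
  -- `v`, and the others are, up to sign, the alternatization still to be computed.
  have h2 := congrArg (fun A => A (Fin.cons (y - y₀) v)) hd
  simp only [extDeriv, ContinuousAlternatingMap.alternatizeUncurryFin_apply] at h2
  rw [Fin.sum_univ_succ] at h2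
  rw [ContinuousAlternatingMap.alternatizeUncurryFin_apply]
  simp only [Fin.val_zero, pow_zero, one_smul, Fin.cons_zero, Fin.removeNth_zero, Fin.tail_cons,
    Fin.cons_succ, Fin.val_succ, pow_succ, mul_neg, mul_one, neg_smul,
    Finset.sum_neg_distrib] at h2
  have h3 := eq_of_sub_eq_zero ((sub_eq_add_neg _ _).trans h2)
  rw [h3]
  refine Finset.sum_congr rfl fun i _ => ?_
  congr 1
  change fderiv K f y (v i) (Matrix.vecCons (y - y₀) (i.removeNth v)) = _
  congr 1
  funext j
  refine Fin.cases rfl (fun j => ?_) j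
  simp [Fin.removeNth, Fin.succ_succAbove_succ]

/-- The Poincaré lemma with parameters in `E`. -/
theorem AnalyticAt.exists_primitive [IsUltrametricDist K] [CharZero K] [CompleteSpace W]
    {θ : E × F → F [⋀^Fin (k + 1)]→L[K] W} {b₀ : E} {y₀ : F} (hθ : AnalyticAt K θ (b₀, y₀))
    (hd : ∀ᶠ z in 𝓝 (b₀, y₀), extDeriv (fun y => θ (z.1, y)) z.2 = 0) :
    ∃ f : E × F → F [⋀^Fin (k + 1)]→L[K] W, AnalyticAt K f (b₀, y₀) ∧
      (∀ᶠ z in 𝓝 (b₀, y₀), ((k + 1 : ℕ) : K) • f z +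
        fderiv K (fun y => f (z.1, y)) z.2 (z.2 - y₀) = θ z) ∧
      ∀ᶠ z in 𝓝 (b₀, y₀), extDeriv (fun y => (f (z.1, y)).curryLeft (y - y₀)) z.2 = θ z := by
  -- The constant is the degree of `θ`, so that the Euler operator is the Lie derivative of `f`
  -- along the radial field.
  obtain ⟨f, hf, he⟩ := hθ.exists_euler (c := k + 1) (by simp)
  have hfn := hf.eventually_analyticAt
  have hslice : ∀ {z : E × F}, AnalyticAt K f z → ContDiffAt K ω (fun y => f (z.1, y)) z.2 :=
    fun {z} hz => (AnalyticAt.contDiffAt hz).comp (f := fun y => (z.1, y)) z.2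
      (contDiffAt_const.prodMk contDiffAt_id)
  have hfd : ∀ {z : E × F}, AnalyticAt K f z → ∀ v,
      fderiv K (fun y => f (z.1, y)) z.2 v = fderiv K f z (0, v) := by
    intro z hz v
    have := (HasFDerivAt.comp (x := z.2) (f := fun y => (z.1, y)) (g := f)
      hz.differentiableAt.hasFDerivAt (hasFDerivAt_prodMk_right z.1 z.2)).fderiv
    have := congrArg (fun A => A v) this
    simpa [Function.comp_def] using this
  have he' : ∀ᶠ z in 𝓝 (b₀, y₀), ((k + 1 : ℕ) : K) • f z +
      fderiv K (fun y => f (z.1, y)) z.2 (z.2 - y₀) = θ z := by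
    filter_upwards [he, hfn] with z h1 h2
    rw [hfd h2]
    exact h1
  refine ⟨f, hf, he', ?_⟩
  let g : E × F → F [⋀^Fin (k + 2)]→L[K] W := fun z => extDeriv (fun y => f (z.1, y)) z.2
  -- Near the base point `g` is the alternatization of the full derivative of `f` restricted to
  -- directions in `F`, which is jointly analytic.
  have hg : AnalyticAt K g (b₀, y₀) := by
    let T : (E × F →L[K] F [⋀^Fin (k + 1)]→L[K] W) →L[K] F →L[K] F [⋀^Fin (k + 1)]→L[K] W :=
      (ContinuousLinearMap.inr K E F).precomp _
    have h1 : AnalyticAt K (fun z => ContinuousAlternatingMap.alternatizeUncurryFinCLM K F W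
        (T (fderiv K f z))) (b₀, y₀) :=
      AnalyticAt.clm_comp_apply (K := K) (A := F →L[K] F [⋀^Fin (k + 1)]→L[K] W)
        (W := F [⋀^Fin (k + 2)]→L[K] W)
        (AnalyticAt.clm_comp_apply (K := K) (A := E × F →L[K] F [⋀^Fin (k + 1)]→L[K] W)
          (W := F →L[K] F [⋀^Fin (k + 1)]→L[K] W) hf.fderiv T)
        (ContinuousAlternatingMap.alternatizeUncurryFinCLM K F W)
    refine h1.congr ?_
    filter_upwards [hfn] with z hz
    change _ = ContinuousAlternatingMap.alternatizeUncurryFin _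
    rw [ContinuousAlternatingMap.alternatizeUncurryFinCLM_apply]
    congr 1
    ext1 v
    exact (hfd hz v).symm
  have hcurve : ∀ z : E × F, Filter.Tendsto (fun y => (z.1, y)) (𝓝 z.2) (𝓝 z) := fun z => by
    have : Continuous fun y : F => (z.1, y) := by fun_prop
    exact this.tendsto z.2
  -- Applying `d` along `F` to the Euler equation gives `(k + 2) g + D_{y - y₀} g = dθ = 0`, and
  -- uniqueness applies.
  have hg0 : ∀ᶠ z in 𝓝 (b₀, y₀), g z = 0 := by
    refine hg.eq_zero_of_euler (c := k + 2) (by simp) ?_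
    filter_upwards [he'.eventually_nhds, hfn, hd] with z h1 h2 h3
    have h4 : (fun y => ((k + 1 : ℕ) : K) • f (z.1, y) +
        fderiv K (fun y => f (z.1, y)) y (y - y₀)) =ᶠ[𝓝 z.2] fun y => θ (z.1, y) :=
      (hcurve z).eventually h1
    have h5 := h4.extDeriv_eq
    rw [extDeriv_euler (hslice h2), h3] at h5
    rw [← h5]
    push_cast
    congr 2
    ring
  filter_upwards [he', hg0, hfn] with z h1 h2 h3
  rw [extDeriv_curryLeft ((hslice h3).differentiableAt (by simp)) h2, h1]

end Poincare

/-! ### Refining open coverings by partitions into open sets -/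

section Partition

/-- Every open covering of `T`, here given by a neighbourhood `N t` of each point `t`, has a refinement
by a partition into open subsets, the fibres of a locally constant function. -/
def HasOpenPartitions (T : Type*) [TopologicalSpace T] : Prop :=
  ∀ N : T → Set T, (∀ t, N t ∈ 𝓝 t) → ∃ s : T → T, IsLocallyConstant s ∧ ∀ t, t ∈ N (s t)

/-- Each `t` gets the largest ball `B t` of radius `(1 / 2) ^ n` that is contained in some `N c`.
Every point of an ultrametric ball is a centre, so `t' ∈ B t` implies that the radius at `t'` is at
least that at `t`. Then `t ∈ B t'`, and by symmetry the two balls coincide. The balls therefore form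
a partition. -/
theorem hasOpenPartitions_of_isUltrametricDist (T : Type*) [PseudoMetricSpace T]
    [IsUltrametricDist T] : HasOpenPartitions T := by
  classical
  intro N hN
  have hex : ∀ t, ∃ n : ℕ, ∃ c, Metric.ball t ((1 / 2 : ℝ) ^ n) ⊆ N c := by
    intro t
    obtain ⟨ε, hε, h⟩ := Metric.mem_nhds_iff.1 (hN t)
    obtain ⟨n, hn⟩ := exists_pow_lt_of_lt_one hε (by norm_num : (1 / 2 : ℝ) < 1)
    exact ⟨n, t, (Metric.ball_subset_ball hn.le).trans h⟩
  let B : T → Set T := fun t => Metric.ball t ((1 / 2 : ℝ) ^ Nat.find (hex t))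
  have hB : ∀ t, ∃ c, B t ⊆ N c := fun t => Nat.find_spec (hex t)
  have hmem : ∀ t, t ∈ B t := fun t => Metric.mem_ball_self (by positivity)
  have hle : ∀ t t', t' ∈ B t → Nat.find (hex t') ≤ Nat.find (hex t) := by
    intro t t' h
    refine Nat.find_min' (hex t') ?_
    obtain ⟨c, hc⟩ := hB t
    exact ⟨c, (IsUltrametricDist.ball_eq_of_mem h).symm.subset.trans hc⟩
  have hBeq : ∀ t t', t' ∈ B t → B t' = B t := by
    intro t t' h
    have h1 := hle t t' h
    have h2 : t ∈ B t' := by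
      rw [Metric.mem_ball_comm]
      exact Metric.ball_subset_ball
        (pow_le_pow_of_le_one (by norm_num) (by norm_num) h1) h
    have h3 : Nat.find (hex t') = Nat.find (hex t) := le_antisymm h1 (hle t' t h2)
    change Metric.ball t' _ = Metric.ball t _
    rw [h3]
    exact (IsUltrametricDist.ball_eq_of_mem h).symm
  refine ⟨fun t => (hB t).choose, ?_, fun t => (hB t).choose_spec (hmem t)⟩
  rw [IsLocallyConstant.iff_eventually_eq]
  intro t
  filter_upwards [Metric.ball_mem_nhds t (by positivity : (0 : ℝ) < (1 / 2) ^ Nat.find (hex t))]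
    with t' ht'
  -- The chosen `c` depends on `t` only through the predicate `B t ⊆ N c`, hence only on the ball as
  -- a set.
  have := hBeq t t' ht'
  congr 1
  funext c
  rw [this]

theorem Topology.IsInducing.hasOpenPartitions {T M : Type*} [TopologicalSpace T]
    [PseudoMetricSpace M] [IsUltrametricDist M] {f : T → M} (hf : IsInducing f) :
    HasOpenPartitions T := by
  let _ : PseudoMetricSpace T := hf.comapPseudoMetricSpace
  have : IsUltrametricDist T := ⟨fun x y z => dist_triangle_max (f x) (f y) (f z)⟩
  exact hasOpenPartitions_of_isUltrametricDist T

theorem OpenPartialHomeomorph.hasOpenPartitions_source {T M : Type*} [TopologicalSpace T]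
    [PseudoMetricSpace M] [IsUltrametricDist M] (e : OpenPartialHomeomorph T M) :
    HasOpenPartitions e.source :=
  e.isOpenEmbedding_restrict.isInducing.hasOpenPartitions

/-- Separation of the closure of `Z` and the complement of `W` by a clopen set. -/
theorem exists_isClopen_between {T M : Type*} [TopologicalSpace T]
    [PseudoMetricSpace M] [IsUltrametricDist M] (e : OpenPartialHomeomorph T M) {Z W : Set T}
    (hW : IsOpen W) (hZW : closure Z ⊆ W) (hWe : closure W ⊆ e.source) :
    ∃ Q, IsClopen Q ∧ Z ⊆ Q ∧ Q ⊆ W := by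
  classical
  have hWs : W ⊆ e.source := subset_closure.trans hWe
  -- The covering of the chart domain by `W` and the complement of `closure Z` is refined by a
  -- partition. The clopen set is the union of the blocks whose label lies in `closure Z`.
  let N : e.source → Set e.source := fun t =>
    if (t : T) ∈ closure Z then Subtype.val ⁻¹' W else Subtype.val ⁻¹' (closure Z)ᶜ
  obtain ⟨s, hs, hsN⟩ := e.hasOpenPartitions_source N fun t => by
    by_cases ht : (t : T) ∈ closure Z
    · simp only [N, if_pos ht]
      exact (hW.preimage continuous_subtype_val).mem_nhds (hZW ht)
    · simp only [N, if_neg ht]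
      exact (isClosed_closure.isOpen_compl.preimage continuous_subtype_val).mem_nhds ht
  let Q' : Set e.source := s ⁻¹' (Subtype.val ⁻¹' closure Z)
  have hQW : Subtype.val '' Q' ⊆ W := by
    rintro _ ⟨t, ht, rfl⟩
    have := hsN t
    have ht' : (s t : T) ∈ closure Z := ht
    simp only [N, if_pos ht'] at this
    exact this
  have hopen : ∀ S : Set e.source, IsOpen (Subtype.val '' (s ⁻¹' S) : Set T) := fun S =>
    e.open_source.isOpenEmbedding_subtypeVal.isOpenMap _ (hs S)
  refine ⟨Subtype.val '' Q', ⟨?_, hopen _⟩, ?_, hQW⟩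
  · rw [← isOpen_compl_iff]
    -- Points outside the chart domain lie in the open set `(closure W)ᶜ`, which misses `Q'`. This
    -- is where `closure W ⊆ e.source` is needed.
    have : (Subtype.val '' Q')ᶜ =
        (closure W)ᶜ ∪ Subtype.val '' (s ⁻¹' (Subtype.val ⁻¹' closure Z)ᶜ) := by
      ext t
      constructor
      · intro ht
        by_cases hte : t ∈ e.source
        · exact Or.inr ⟨⟨t, hte⟩, fun h => ht ⟨⟨t, hte⟩, h, rfl⟩, rfl⟩
        · exact Or.inl fun h => hte (hWe h)
      · rintro (ht | ⟨t, ht, rfl⟩) ⟨t', ht', h⟩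
        · exact ht (subset_closure (hQW ⟨t', ht', h⟩))
        · rw [Subtype.val_injective h] at ht'
          exact ht ht'
    rw [this]
    exact isClosed_closure.isOpen_compl.union (hopen _)
  · intro t ht
    have htc := subset_closure ht
    refine ⟨⟨t, hWs (hZW htc)⟩, ?_, rfl⟩
    by_contra hcon
    have := hsN ⟨t, hWs (hZW htc)⟩
    have hcon' : ¬ (s ⟨t, hWs (hZW htc)⟩ : T) ∈ closure Z := hcon
    simp only [N, if_neg hcon'] at this
    exact this htc

/-- Paracompactness gives a locally finite refinement of the chart domains. Shrinking it twice
leaves room for a clopen set `Q i` inside each chart domain such that the `Q i` still cover. Sending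
`t` to the least `i` with `t ∈ Q i`, for a well-ordering of the indices, is locally constant. -/
theorem exists_isLocallyConstant_mem_source {T M : Type*} [TopologicalSpace T] [T2Space T]
    [ParacompactSpace T] [PseudoMetricSpace M] [IsUltrametricDist M]
    (e : T → OpenPartialHomeomorph T M) (he : ∀ t, t ∈ (e t).source) :
    ∃ s : T → T, IsLocallyConstant s ∧ ∀ t, t ∈ (e (s t)).source := by
  classical
  obtain ⟨v, hvo, hvc, hvf, hve⟩ := precise_refinement (fun t => (e t).source)
    (fun t => (e t).open_source) (Set.eq_univ_of_forall fun t => Set.mem_iUnion.2 ⟨t, he t⟩)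
  obtain ⟨w, hwc, hwo, hwv⟩ := exists_iUnion_eq_closure_subset hvo hvf.point_finite hvc
  obtain ⟨z, hzc, hzo, hzw⟩ := exists_iUnion_eq_closure_subset hwo
    (fun t => (hvf.point_finite t).subset fun i hi => hwv i (subset_closure hi)) hwc
  have hQ := fun i => exists_isClopen_between (e i) (hwo i) (hzw i) ((hwv i).trans (hve i))
  choose Q hQc hzQ hQw using hQ
  have hQf : LocallyFinite Q := hvf.subset fun i => (hQw i).trans (subset_closure.trans (hwv i))
  have hcov : ∀ t, {i | t ∈ Q i}.Nonempty := fun t => by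
    have : t ∈ ⋃ i, z i := by rw [hzc]; trivial
    obtain ⟨i, hi⟩ := Set.mem_iUnion.1 this
    exact ⟨i, hzQ i hi⟩
  have wf : WellFounded (WellOrderingRel : T → T → Prop) := WellOrderingRel.isWellOrder.wf
  let s : T → T := fun t => wf.min {i | t ∈ Q i} (hcov t)
  have hs : ∀ t, t ∈ Q (s t) := fun t => wf.min_mem _ (hcov t)
  refine ⟨s, ?_, fun t => hve _ (hwv _ (subset_closure (hQw _ (hs t))))⟩
  rw [IsLocallyConstant.iff_isOpen_fiber]
  intro i
  -- The fibre over `i` is `Q i` minus the earlier `Q j`. Their union is closed because it is a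
  -- locally finite union of closed sets, so the fibre is open.
  have : s ⁻¹' {i} = Q i ∩ (⋃ j : {j // WellOrderingRel j i}, Q j)ᶜ := by
    ext t
    constructor
    · rintro rfl
      refine ⟨hs t, fun h => ?_⟩
      obtain ⟨⟨j, hj⟩, hjt⟩ := Set.mem_iUnion.1 h
      exact wf.not_lt_min {i | t ∈ Q i} hjt hj
    · rintro ⟨h1, h2⟩
      rcases trichotomous_of WellOrderingRel (s t) i with h | h | h
      · exact absurd (Set.mem_iUnion.2 ⟨⟨s t, h⟩, hs t⟩) h2
      · exact h
      · exact absurd h (wf.not_lt_min {i | t ∈ Q i} h1)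
  rw [this]
  refine (hQc i).isOpen.inter (isOpen_compl_iff.2 ?_)
  exact (hQf.comp_injective Subtype.val_injective).isClosed_iUnion fun j => (hQc j).isClosed

/-- The sets `C i` may overlap. The partition of `C i` is used only on the open fibre of `s` over
`i`, which lies in `C i`. -/
theorem HasOpenPartitions.of_isLocallyConstant {T ι : Type*} [TopologicalSpace T] {s : T → ι}
    (hs : IsLocallyConstant s) (C : ι → Set T) (hmem : ∀ t, t ∈ C (s t))
    (h : ∀ i, HasOpenPartitions (C i)) : HasOpenPartitions T := by
  intro N hN
  have h' := fun i => h i (fun t => Subtype.val ⁻¹' N t) fun t =>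
    continuous_subtype_val.continuousAt.preimage_mem_nhds (hN t)
  choose σ hσ hσN using h'
  refine ⟨fun t => σ (s t) ⟨t, hmem t⟩, ?_, fun t => hσN (s t) ⟨t, hmem t⟩⟩
  rw [IsLocallyConstant.iff_eventually_eq]
  intro t
  have h1 := (IsLocallyConstant.iff_eventually_eq _).1 (hσ (s t)) ⟨t, hmem t⟩
  rw [nhds_induced, Filter.eventually_comap] at h1
  filter_upwards [h1, (IsLocallyConstant.iff_eventually_eq _).1 hs t] with t' h2 h3
  have : ∀ i (hi : i = s t) (hm : t' ∈ C i),
      (σ i ⟨t', hm⟩ : T) = σ (s t) ⟨t, hmem t⟩ := by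
    rintro i rfl hm
    rw [h2 ⟨t', hm⟩ rfl]
  exact this _ h3 _

/-- Charts are selected on the two factors separately, since a product of paracompact spaces need
not be paracompact. On a product of chart domains the maximum metric is ultrametric. -/
theorem hasOpenPartitions_prod {X Y M M' : Type*} [TopologicalSpace X] [T2Space X]
    [ParacompactSpace X] [TopologicalSpace Y] [T2Space Y] [ParacompactSpace Y]
    [PseudoMetricSpace M] [IsUltrametricDist M] [PseudoMetricSpace M'] [IsUltrametricDist M']
    [ChartedSpace M X] [ChartedSpace M' Y] : HasOpenPartitions (X × Y) := by
  have : IsUltrametricDist (M × M') := ⟨fun x y z => by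
    simp only [Prod.dist_eq]
    refine max_le ((dist_triangle_max x.1 y.1 z.1).trans ?_)
      ((dist_triangle_max x.2 y.2 z.2).trans ?_)
    · exact max_le_max (le_max_left _ _) (le_max_left _ _)
    · exact max_le_max (le_max_right _ _) (le_max_right _ _)⟩
  obtain ⟨s, hs, hse⟩ := exists_isLocallyConstant_mem_source (fun x : X => chartAt M x)
    (mem_chart_source M)
  obtain ⟨s', hs', hse'⟩ := exists_isLocallyConstant_mem_source (fun y : Y => chartAt M' y)
    (mem_chart_source M')
  refine HasOpenPartitions.of_isLocallyConstant (s := fun p : X × Y => (s p.1, s' p.2)) ?_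
    (fun i => ((chartAt M i.1).prod (chartAt M' i.2)).source)
    (fun p => ⟨hse p.1, hse' p.2⟩) fun i => OpenPartialHomeomorph.hasOpenPartitions_source _
  exact (hs.comp_continuous continuous_fst).prodMk (hs'.comp_continuous continuous_snd)

end Partition

/-! ### Exactness of complexes of sheaves from exactness on sections -/

section SheafExactness

/-- Homology of functors is computed objectwise, and a functor is zero when all its values are. -/
theorem ShortComplex.exact_of_evaluation {T A : Type*} [Category* T] [Category* A] [Abelian A]
    (S : ShortComplex (T ⥤ A)) (h : ∀ t, (S.map ((evaluation T A).obj t)).Exact) : S.Exact := by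
  rw [S.exact_iff_isZero_homology, Functor.isZero_iff]
  intro t
  exact ((ShortComplex.exact_iff_isZero_homology _).1 (h t)).of_iso
    (S.mapHomologyIso ((evaluation T A).obj t)).symm

/-- A complex of abelian sheaves is exact if it is exact on sections. -/
theorem Sheaf.exact_of_sections {C : Type*} [Category* C] {J : GrothendieckTopology C}
    [HasSheafify J AddCommGrpCat.{u}] (S : ShortComplex (Sheaf J AddCommGrpCat.{u}))
    (h : ∀ (X : Cᵒᵖ) (x : S.X₂.obj.obj X), S.g.hom.app X x = 0 →
      ∃ y : S.X₁.obj.obj X, S.f.hom.app X y = x) : S.Exact := by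
  have h1 : (S.map (sheafToPresheaf J AddCommGrpCat.{u})).Exact := by
    refine ShortComplex.exact_of_evaluation _ fun X => ?_
    rw [ShortComplex.ab_exact_iff]
    exact h X
  -- Sheafification is exact, and by the counit it returns the original complex of sheaves.
  have h2 := h1.map_of_preservesLeftHomologyOf (presheafToSheaf J AddCommGrpCat.{u})
  refine ShortComplex.exact_of_iso ?_ h2
  exact S.mapNatIso (asIso (sheafificationAdjunction J AddCommGrpCat.{u}).counit) ≪≫
    (Iso.refl _)

end SheafExactness

/-! ### Reduction of the quasi-isomorphism to statements about forms -/

section DeRham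

variable {K : Type u} [NontriviallyNormedField K] [CompleteSpace K] [CharZero K]
  {V : Type u} [AddCommGroup V] [Module K V] [TopologicalSpace V] [IsTopologicalAddGroup V]
  [ContinuousSMul K V] [T2Space V]
  {EG : Type*} [NormedAddCommGroup EG] [NormedSpace K EG] {HG : Type*} [TopologicalSpace HG]
  (IG : ModelWithCorners K EG HG)
  {G : Type*} [Group G] [TopologicalSpace G] [ChartedSpace HG G] [IsManifold IG ω G]
  (ρ : G →* (V ≃L[K] V)) (Y : LaMan K)

theorem quasiIso_deRhamInclusion
    (h0 : ∀ (X : LaMan K), ∀ s ∈ admissibleForms IG ρ Y 0 X, (∀ x, formD (s x) = 0) →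
      ∃ f ∈ admissibleLocConst IG ρ Y X, ∀ x, zeroForm (f x) = s x)
    (hs : ∀ (k : ℕ) (X : LaMan K), ∀ s ∈ admissibleForms IG ρ Y (k + 1) X,
      (∀ x, formD (s x) = 0) → ∃ t ∈ admissibleForms IG ρ Y k X, ∀ x, formD (t x) = s x) :
    QuasiIso (deRhamInclusion IG ρ Y) := by
  refine ⟨fun n => ?_⟩
  cases n with
  | zero =>
    -- In degree `0` both incoming differentials vanish, and so does the outgoing one of the source.
    -- What remains is that the inclusion is a monomorphism with image the kernel of `d`.
    rw [CochainComplex.quasiIsoAt₀_iff, ShortComplex.quasiIso_iff_of_zeros]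
    rotate_left
    · rfl
    · rfl
    · rfl
    have hmono : Mono (locConstInclusion IG ρ Y) := by
      refine (sheafToPresheaf _ _).mono_of_mono_map ?_
      rw [NatTrans.mono_iff_mono_app]
      intro X
      rw [AddCommGrpCat.mono_iff_injective]
      intro (s : ULift.{u + 1} (admissibleLocConst IG ρ Y X.unop))
        (t : ULift.{u + 1} (admissibleLocConst IG ρ Y X.unop)) hst
      have hst' : (fun x => (zeroForm (s.down.1 x) :
          VForm K V (Fin Y.dim → K) Y.carrier 0)) = fun x => zeroForm (t.down.1 x) :=
        congrArg (fun a : ULift.{u + 1} (admissibleForms IG ρ Y 0 X.unop) => a.down.1) hst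
      refine ULift.ext _ _ (Subtype.ext (funext fun x => funext fun y => ?_))
      exact congrArg (fun A : VForm K V (Fin Y.dim → K) Y.carrier 0 => A y 0) (congrFun hst' x)
    have hexact : (ShortComplex.mk (locConstInclusion IG ρ Y) (formSheafD IG ρ Y 0)
        (locConstInclusion_comp IG ρ Y)).Exact := by
      refine Sheaf.exact_of_sections _ fun X
        (s : ULift.{u + 1} (admissibleForms IG ρ Y 0 X.unop)) hX => ?_
      have hX' : (fun x => formD (s.down.1 x)) = 0 :=
        congrArg (fun a : ULift.{u + 1} (admissibleForms IG ρ Y 1 X.unop) => a.down.1) hX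
      obtain ⟨f, hf, hfs⟩ := h0 X.unop s.down.1 s.down.2 fun x => congrFun hX' x
      refine ⟨(⟨⟨f, hf⟩⟩ : ULift.{u + 1} (admissibleLocConst IG ρ Y X.unop)), ?_⟩
      exact ULift.ext _ _ (Subtype.ext (funext hfs))
    refine (ShortComplex.exact_and_mono_f_iff_of_iso ?_).2 ⟨hexact, hmono⟩
    refine ShortComplex.isoMk (Iso.refl _) (Iso.refl _) (Iso.refl _) ?_ ?_
    · simp
      rfl
    · have h : (deRhamComplex IG ρ Y).d 0 1 = formSheafD IG ρ Y 0 :=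
        CochainComplex.of_d (formSheaf IG ρ Y) (formSheafD IG ρ Y) 0
      exact (Category.id_comp _).trans (h.symm.trans (Category.comp_id _).symm)
  | succ n =>
    -- In positive degrees the source has no cohomology, so the claim is exactness of the de Rham
    -- complex.
    rw [quasiIsoAt_iff_exactAt _ _ (CochainComplex.exactAt_succ_single_obj _ _)]
    rw [HomologicalComplex.exactAt_iff' _ n (n + 1) (n + 2) (by simp) (by simp)]
    have hexact : (ShortComplex.mk (formSheafD IG ρ Y n) (formSheafD IG ρ Y (n + 1))
        (formSheafD_comp IG ρ Y n)).Exact := by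
      refine Sheaf.exact_of_sections _ fun X
        (s : ULift.{u + 1} (admissibleForms IG ρ Y (n + 1) X.unop)) hX => ?_
      have hX' : (fun x => formD (s.down.1 x)) = 0 :=
        congrArg (fun a : ULift.{u + 1} (admissibleForms IG ρ Y (n + 2) X.unop) => a.down.1) hX
      obtain ⟨f, hf, hfs⟩ := hs n X.unop s.down.1 s.down.2 fun x => congrFun hX' x
      refine ⟨(⟨⟨f, hf⟩⟩ : ULift.{u + 1} (admissibleForms IG ρ Y n X.unop)), ?_⟩
      exact ULift.ext _ _ (Subtype.ext (funext hfs))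
    have h : ∀ m, (deRhamComplex IG ρ Y).d m (m + 1) = formSheafD IG ρ Y m := fun m =>
      CochainComplex.of_d (formSheaf IG ρ Y) (formSheafD IG ρ Y) m
    refine ShortComplex.exact_of_iso (ShortComplex.isoMk (Iso.refl (formSheaf IG ρ Y n))
      (Iso.refl (formSheaf IG ρ Y (n + 1))) (Iso.refl (formSheaf IG ρ Y (n + 2))) ?_ ?_) hexact
    · exact (Category.id_comp _).trans ((h n).trans (Category.comp_id _).symm)
    · exact (Category.id_comp _).trans ((h (n + 1)).trans (Category.comp_id _).symm)

end DeRham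

/-! ### Passing from parameters in a normed space to parameters in a manifold -/

section ChartTransport

variable {K : Type*} [NontriviallyNormedField K]
  {EB : Type*} [NormedAddCommGroup EB] [NormedSpace K EB] {HB : Type*} [TopologicalSpace HB]
  {I : ModelWithCorners K EB HB} [I.Boundaryless]
  {B : Type*} [TopologicalSpace B] [ChartedSpace HB B] [IsManifold I ω B]
  {F : Type*} [NormedAddCommGroup F] [NormedSpace K F]
  {A : Type*} [NormedAddCommGroup A] [NormedSpace K A]

/-- Power series need a normed parameter space, so `B` is replaced by its chart at `b₀`. Without
boundary the target of this chart is a neighbourhood of the image of `b₀`. -/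
theorem ContMDiffAt.analyticAt_extChartAt_symm {θ : B × F → A} {b₀ : B} {x₀ : F}
    (h : ContMDiffAt (I.prod 𝓘(K, F)) 𝓘(K, A) ω θ (b₀, x₀)) :
    AnalyticAt K (fun z : EB × F => θ ((extChartAt I b₀).symm z.1, z.2))
      (extChartAt I b₀ b₀, x₀) := by
  have h1 : ContMDiffAt (𝓘(K, EB).prod 𝓘(K, F)) (I.prod 𝓘(K, F)) ω
      (fun z : EB × F => ((extChartAt I b₀).symm z.1, z.2)) (extChartAt I b₀ b₀, x₀) :=
    ContMDiffAt.prodMk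
      (ContMDiffAt.comp (extChartAt I b₀ b₀, x₀)
        ((contMDiffOn_extChartAt_symm (I := I) (n := ω) b₀).contMDiffAt
          (extChartAt_target_mem_nhds (I := I) b₀)) contMDiffAt_fst) contMDiffAt_snd
  have h2 : ContMDiffAt (𝓘(K, EB).prod 𝓘(K, F)) 𝓘(K, A) ω
      (fun z : EB × F => θ ((extChartAt I b₀).symm z.1, z.2)) (extChartAt I b₀ b₀, x₀) := by
    refine ContMDiffAt.comp (extChartAt I b₀ b₀, x₀) (g := θ) ?_ h1
    rw [extChartAt_to_inv]
    exact h
  rw [← modelWithCornersSelf_prod, chartedSpaceSelf_prod] at h2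
  exact h2.contDiffAt.analyticAt

theorem AnalyticAt.contMDiffAt_extChartAt [CompleteSpace A] {f : EB × F → A} {b₀ : B} {x₀ : F}
    (h : AnalyticAt K f (extChartAt I b₀ b₀, x₀)) :
    ContMDiffAt (I.prod 𝓘(K, F)) 𝓘(K, A) ω
      (fun q : B × F => f (extChartAt I b₀ q.1, q.2)) (b₀, x₀) := by
  have h1 : ContMDiffAt (I.prod 𝓘(K, F)) (𝓘(K, EB).prod 𝓘(K, F)) ω
      (fun q : B × F => (extChartAt I b₀ q.1, q.2)) (b₀, x₀) :=
    ContMDiffAt.prodMk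
      (ContMDiffAt.comp (b₀, x₀) (_root_.contMDiffAt_extChartAt (x := b₀)) contMDiffAt_fst)
      contMDiffAt_snd
  have h2 : ContMDiffAt (𝓘(K, EB).prod 𝓘(K, F)) 𝓘(K, A) ω f (extChartAt I b₀ b₀, x₀) := by
    rw [← modelWithCornersSelf_prod, chartedSpaceSelf_prod]
    exact h.contDiffAt.contMDiffAt
  exact ContMDiffAt.comp (b₀, x₀) (g := f) h2 h1

theorem eventually_extChartAt_prod {P : EB × F → Prop} {b₀ : B} {x₀ : F}
    (h : ∀ᶠ z in 𝓝 (extChartAt I b₀ b₀, x₀), P z) :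
    ∀ᶠ q : B × F in 𝓝 (b₀, x₀), P (extChartAt I b₀ q.1, q.2) ∧
      (extChartAt I b₀).symm (extChartAt I b₀ q.1) = q.1 := by
  have hc : ContinuousAt (fun q : B × F => (extChartAt I b₀ q.1, q.2)) (b₀, x₀) :=
    ContinuousAt.prodMk (ContinuousAt.comp (x := (b₀, x₀)) (f := Prod.fst)
      (continuousAt_extChartAt b₀) continuousAt_fst) continuousAt_snd
  have hs : ∀ᶠ q : B × F in 𝓝 (b₀, x₀), q.1 ∈ (extChartAt I b₀).source :=
    continuousAt_fst.eventually (extChartAt_source_mem_nhds b₀)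
  filter_upwards [hc.eventually h, hs] with q h1 h2
  exact ⟨h1, (extChartAt I b₀).left_inv h2⟩

theorem eventually_extChartAt_symm_prod {P : B × F → Prop} {b₀ : B} {x₀ : F}
    (h : ∀ᶠ q in 𝓝 (b₀, x₀), P q) :
    ∀ᶠ z : EB × F in 𝓝 (extChartAt I b₀ b₀, x₀), P ((extChartAt I b₀).symm z.1, z.2) := by
  have hc : ContinuousAt (fun z : EB × F => ((extChartAt I b₀).symm z.1, z.2))
      (extChartAt I b₀ b₀, x₀) :=
    ContinuousAt.prodMk (ContinuousAt.comp (x := (extChartAt I b₀ b₀, x₀)) (f := Prod.fst)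
      (continuousAt_extChartAt_symm b₀) continuousAt_fst) continuousAt_snd
  rw [ContinuousAt, extChartAt_to_inv] at hc
  exact hc.eventually h

variable [CharZero K] [CompleteSpace A]

/-- The Poincaré lemma with parameters in a manifold. -/
theorem ContMDiffAt.exists_primitive [IsUltrametricDist K] {k : ℕ}
    {θ : B × F → F [⋀^Fin (k + 1)]→L[K] A} {b₀ : B} {x₀ : F}
    (h : ContMDiffAt (I.prod 𝓘(K, F)) 𝓘(K, F [⋀^Fin (k + 1)]→L[K] A) ω θ (b₀, x₀))
    (hd : ∀ᶠ q in 𝓝 (b₀, x₀), extDeriv (fun x => θ (q.1, x)) q.2 = 0) :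
    ∃ f : B × F → F [⋀^Fin (k + 1)]→L[K] A,
      ContMDiffAt (I.prod 𝓘(K, F)) 𝓘(K, F [⋀^Fin (k + 1)]→L[K] A) ω f (b₀, x₀) ∧
      (∀ᶠ q in 𝓝 (b₀, x₀), ((k + 1 : ℕ) : K) • f q +
        fderiv K (fun x => f (q.1, x)) q.2 (q.2 - x₀) = θ q) ∧
      (∀ᶠ q in 𝓝 (b₀, x₀), extDeriv (fun x => (f (q.1, x)).curryLeft (x - x₀)) q.2 = θ q) ∧
      ∃ r : ENNReal, 0 < r ∧ ∀ᶠ b in 𝓝 b₀,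
        ∃ p : FormalMultilinearSeries K F (F [⋀^Fin (k + 1)]→L[K] A),
          HasFPowerSeriesOnBall (fun x => f (b, x)) p x₀ r := by
  have hθ := h.analyticAt_extChartAt_symm
  have hd' : ∀ᶠ z in 𝓝 (extChartAt I b₀ b₀, x₀),
      extDeriv (fun x => θ ((extChartAt I b₀).symm z.1, x)) z.2 = 0 :=
    eventually_extChartAt_symm_prod hd
  obtain ⟨f, hf, he, hx⟩ := hθ.exists_primitive hd'
  obtain ⟨r, hr, hp⟩ := hf.exists_uniform_ball
  refine ⟨fun q => f (extChartAt I b₀ q.1, q.2), hf.contMDiffAt_extChartAt, ?_, ?_, r, hr, ?_⟩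
  · filter_upwards [eventually_extChartAt_prod he] with q hq
    refine hq.1.trans ?_
    rw [hq.2]
  · filter_upwards [eventually_extChartAt_prod hx] with q hq
    refine hq.1.trans ?_
    rw [hq.2]
  · exact (continuousAt_extChartAt b₀).eventually hp

/-- An analytic function with vanishing derivative along `F` is locally constant along `F`. -/
theorem ContMDiffAt.eventually_eq_of_fderiv_eq_zero {θ : B × F → A} {b₀ : B} {x₀ : F}
    (h : ContMDiffAt (I.prod 𝓘(K, F)) 𝓘(K, A) ω θ (b₀, x₀))
    (hd : ∀ᶠ q in 𝓝 (b₀, x₀), fderiv K (fun x => θ (q.1, x)) q.2 = 0) :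
    ∀ᶠ q in 𝓝 (b₀, x₀), θ q = θ (q.1, x₀) := by
  have hθ := h.analyticAt_extChartAt_symm
  have hd' : ∀ᶠ z in 𝓝 (extChartAt I b₀ b₀, x₀),
      fderiv K (fun x => θ ((extChartAt I b₀).symm z.1, x)) z.2 = 0 :=
    eventually_extChartAt_symm_prod hd
  have hu : AnalyticAt K (fun z : EB × F => θ ((extChartAt I b₀).symm z.1, z.2) -
      θ ((extChartAt I b₀).symm z.1, x₀)) (extChartAt I b₀ b₀, x₀) := by
    refine hθ.sub ?_
    exact AnalyticAt.comp (x := (extChartAt I b₀ b₀, x₀)) (f := fun z : EB × F => (z.1, x₀)) hθ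
      (analyticAt_fst.prod analyticAt_const)
  -- The difference with the value at `x₀` vanishes at `x₀` and solves the Euler equation with `c =
  -- 0`.
  have h0 := hu.eq_zero_of_euler (c := 0) (fun _ => by simp) (by
    filter_upwards [hd'] with z hz
    rw [fderiv_sub_const, hz]
    simp)
  filter_upwards [eventually_extChartAt_prod h0] with q hq
  have := sub_eq_zero.1 hq.1
  rw [hq.2] at this
  exact this

end ChartTransport

/-! ### Locality of forms and change of charts -/

section FormGerms

variable {K : Type u} [NontriviallyNormedField K]
  {V : Type u} [AddCommGroup V] [Module K V] [TopologicalSpace V]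
  {EB : Type*} [NormedAddCommGroup EB] [NormedSpace K EB] {HB : Type*} [TopologicalSpace HB]
  {I : ModelWithCorners K EB HB} {B : Type*} [TopologicalSpace B] [ChartedSpace HB B]
  {F : Type*} [NormedAddCommGroup F] [NormedSpace K F]
  {Y : Type*} [TopologicalSpace Y] [ChartedSpace F Y] {k : ℕ}

theorem chartForm_congr {η η' : VForm K V F Y k} (y₀ : Y) {x : F}
    (h : η' ((extChartAt 𝓘(K, F) y₀).symm x) = η ((extChartAt 𝓘(K, F) y₀).symm x)) :
    chartForm η' y₀ x = chartForm η y₀ x := by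
  simp only [chartForm, h]

theorem formD_congr {η η' : VForm K V F Y k} {y : Y} (h : ∀ᶠ z in 𝓝 y, η' z = η z) :
    formD η' y = formD η y := by
  have hc := continuousAt_extChartAt_symm (I := 𝓘(K, F)) y
  rw [ContinuousAt, extChartAt_to_inv] at hc
  have he : ∀ᶠ x in 𝓝 (extChartAt 𝓘(K, F) y y), chartForm η' y x = chartForm η y x := by
    filter_upwards [hc.eventually h] with x hx
    exact chartForm_congr y hx
  -- The two forms have the same derivatives, as predicates. Hence the choice in `formFDeriv`
  -- returns the same value, whether or not a derivative exists.
  have hF : IsFormFDeriv (chartForm η' y) (extChartAt 𝓘(K, F) y y) =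
      IsFormFDeriv (chartForm η y) (extChartAt 𝓘(K, F) y y) := by
    funext D
    refine propext (forall_congr' fun w => exists_congr fun A => and_congr_left fun _ => ?_)
    refine Filter.EventuallyEq.hasFDerivAt_iff ?_
    filter_upwards [he] with x hx
    rw [hx]
  have hD : formFDeriv (chartForm η' y) (extChartAt 𝓘(K, F) y y) =
      formFDeriv (chartForm η y) (extChartAt 𝓘(K, F) y y) := by
    unfold formFDeriv
    congr!
  change vExtDeriv _ _ = vExtDeriv _ _
  rw [vExtDeriv, vExtDeriv, hD]

theorem LocalRep.congr_nhds {η η' : B → VForm K V F Y k} {b₀ : B} {y₀ : Y} {W : BHSpace K V}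
    {θ : B × F → F [⋀^Fin k]→L[K] W.carrier} (h : LocalRep I η b₀ y₀ W θ)
    (he : ∀ᶠ p : B × Y in 𝓝 (b₀, y₀), η' p.1 p.2 = η p.1 p.2) : LocalRep I η' b₀ y₀ W θ := by
  refine ⟨h.1, ?_⟩
  have hc : ContinuousAt (fun q : B × F => (q.1, (extChartAt 𝓘(K, F) y₀).symm q.2))
      (b₀, extChartAt 𝓘(K, F) y₀ y₀) :=
    ContinuousAt.prodMk continuousAt_fst (ContinuousAt.comp
      (x := (b₀, extChartAt 𝓘(K, F) y₀ y₀)) (f := Prod.snd)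
      (continuousAt_extChartAt_symm y₀) continuousAt_snd)
  rw [ContinuousAt, extChartAt_to_inv] at hc
  filter_upwards [h.2, hc.eventually he] with q hq hq' w
  rw [chartForm_congr y₀ hq']
  exact hq w

variable [IsManifold 𝓘(K, F) ω Y]

/-- The form on `Y` given by `α` in the preferred chart at `y₀`. -/
noncomputable def formOfChart (y₀ : Y) (α : F → F [⋀^Fin k]→ₗ[K] V) : VForm K V F Y k := fun y =>
  (α (extChartAt 𝓘(K, F) y₀ y)).compLinearMap
    (tangentCoordChange 𝓘(K, F) y y₀ y : F →L[K] F).toLinearMap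

theorem chartForm_formOfChart (y₀ : Y) (α : F → F [⋀^Fin k]→ₗ[K] V) {x : F}
    (hx : x ∈ (extChartAt 𝓘(K, F) y₀).target) : chartForm (formOfChart y₀ α) y₀ x = α x := by
  ext w
  have hs := (extChartAt 𝓘(K, F) y₀).map_target hx
  rw [chartForm_apply, mfderiv_extChartAt_symm_eq hx]
  change α (extChartAt 𝓘(K, F) y₀ ((extChartAt 𝓘(K, F) y₀).symm x)) _ = _
  rw [(extChartAt 𝓘(K, F) y₀).right_inv hx]
  congr 1
  funext i
  refine (tangentCoordChange_comp ⟨⟨hs, mem_extChartAt_source _⟩, hs⟩).trans ?_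
  exact tangentCoordChange_self hs

/-- The tangent coordinate changes between `y` and `y₀` are inverse to each other, so the value at
`y` is recovered from the expression in the chart at `y₀`. -/
theorem VForm.eq_of_chartForm_eq {η η' : VForm K V F Y k} {y₀ y : Y}
    (hy : y ∈ (extChartAt 𝓘(K, F) y₀).source)
    (h : ∀ w, chartForm η y₀ (extChartAt 𝓘(K, F) y₀ y) w =
      chartForm η' y₀ (extChartAt 𝓘(K, F) y₀ y) w) : η y = η' y := by
  have key : ∀ (η : VForm K V F Y k) (v : Fin k → F),
      (η y : F [⋀^Fin k]→ₗ[K] V) v = chartForm η y₀ (extChartAt 𝓘(K, F) y₀ y)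
        (fun i => tangentCoordChange 𝓘(K, F) y y₀ y (v i)) := by
    intro η v
    have hx := (extChartAt 𝓘(K, F) y₀).map_source hy
    rw [chartForm_apply, mfderiv_extChartAt_symm_eq hx]
    have : ∀ (z : Y) (_ : z = y), (η y : F [⋀^Fin k]→ₗ[K] V) v =
        (η z : F [⋀^Fin k]→ₗ[K] V) (fun i => tangentCoordChange 𝓘(K, F) y₀ z z
          (tangentCoordChange 𝓘(K, F) y y₀ y (v i))) := by
      rintro z rfl
      congr 1
      funext i
      symm
      refine (tangentCoordChange_comp ⟨⟨mem_extChartAt_source _, hy⟩,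
        mem_extChartAt_source _⟩).trans ?_
      exact tangentCoordChange_self (mem_extChartAt_source _)
    exact this _ ((extChartAt 𝓘(K, F) y₀).left_inv hy)
  ext v
  exact (key η v).trans ((h _).trans (key η' v).symm)

variable [CompleteSpace K] [FiniteDimensional K F] [IsManifold I ω B] [CharZero K]
  [IsTopologicalAddGroup V] [ContinuousSMul K V] [T2Space V]

/-- A local representation refers to the preferred chart at its base point, and this chart changes
with the point. The representation at a nearby point is the pullback of `θ` along the transition map
`ψ`, with the same BH-space. -/
theorem LocalRep.eventually {η : B → VForm K V F Y k} {b₀ : B} {y₀ : Y} {W : BHSpace K V}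
    {θ : B × F → F [⋀^Fin k]→L[K] W.carrier} (h : LocalRep I η b₀ y₀ W θ) :
    ∀ᶠ p : B × Y in 𝓝 (b₀, y₀), ∃ θ', LocalRep I η p.1 p.2 W θ' := by
  have hc : ContinuousAt (fun p : B × Y => (p.1, extChartAt 𝓘(K, F) y₀ p.2)) (b₀, y₀) :=
    ContinuousAt.prodMk continuousAt_fst (ContinuousAt.comp (x := (b₀, y₀)) (f := Prod.snd)
      (continuousAt_extChartAt y₀) continuousAt_snd)
  have hs : ∀ᶠ p : B × Y in 𝓝 (b₀, y₀), p.2 ∈ (extChartAt 𝓘(K, F) y₀).source :=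
    continuousAt_snd.eventually (extChartAt_source_mem_nhds y₀)
  have hd := (contMDiffAt_iff_contMDiffAt_nhds (by simp)).1 h.1
  filter_upwards [hc.eventually h.2.eventually_nhds, hc.eventually hd, hs] with ⟨b, y⟩ hq hq3 hy
  dsimp only at hq hq3 hy
  set x₁ := extChartAt 𝓘(K, F) y y with hx₁
  have hyx₁ : (extChartAt 𝓘(K, F) y).symm x₁ = y := extChartAt_to_inv y
  let ψ : F → F := extChartAt 𝓘(K, F) y₀ ∘ (extChartAt 𝓘(K, F) y).symm
  have hψx : ψ x₁ = extChartAt 𝓘(K, F) y₀ y := by simp only [ψ, Function.comp_apply, hyx₁]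
  have hψ : ContDiffAt K ω ψ x₁ := by
    have := contDiffWithinAt_ext_coord_change (I := 𝓘(K, F)) (n := ω) y₀ y (y := x₁) (by
      simp only [PartialEquiv.trans_source, PartialEquiv.symm_source, Set.mem_inter_iff,
        Set.mem_preimage, hyx₁]
      exact ⟨mem_extChartAt_target y, hy⟩)
    rw [modelWithCornersSelf_coe, Set.range_id, contDiffWithinAt_univ] at this
    exact this
  have hψ2 : ContMDiffAt (I.prod 𝓘(K, F)) (I.prod 𝓘(K, F)) ω (fun q : B × F => (q.1, ψ q.2))
      (b, x₁) :=
    ContMDiffAt.prodMk contMDiffAt_fst (ContMDiffAt.comp (g := ψ) (b, x₁) hψ.contMDiffAt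
      contMDiffAt_snd)
  have hθψ : ContMDiffAt (I.prod 𝓘(K, F)) 𝓘(K, F [⋀^Fin k]→L[K] W.carrier) ω
      (fun q : B × F => θ (q.1, ψ q.2)) (b, x₁) := by
    refine ContMDiffAt.comp (b, x₁) (g := θ) ?_ hψ2
    rw [hψx]
    exact hq3
  have hdψ : ∀ v : F, ContMDiffAt (I.prod 𝓘(K, F)) 𝓘(K, F) ω
      (fun q : B × F => fderiv K ψ q.2 v) (b, x₁) := fun v =>
    ContMDiffAt.comp (b, x₁) (g := fun x => fderiv K ψ x v)
      ((hψ.fderiv_right (m := ω) (by simp)).clm_apply contDiffAt_const).contMDiffAt contMDiffAt_snd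
  -- The pullback is assembled from its values on tuples of basis vectors, so that its analyticity
  -- is that of finitely many functions with values in `W`.
  refine ⟨fun q => ∑ r, elemCLM K F r (θ (q.1, ψ q.2)
    fun i => fderiv K ψ q.2 (Module.finBasis K F (r i))), ?_, ?_⟩
  · refine ContMDiffAt.sum fun r _ => ?_
    have hr : ContMDiff 𝓘(K, W.carrier) 𝓘(K, F [⋀^Fin k]→L[K] W.carrier) ω
        (elemCLM K F r : W.carrier →L[K] (F [⋀^Fin k]→L[K] W.carrier)) :=
      ContinuousLinearMap.contMDiff (F := F [⋀^Fin k]→L[K] W.carrier) _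
    exact hr.contMDiffAt.comp _ (ContMDiffAt.alternating_apply hθψ fun i => hdψ _)
  · have hcψ := hψ2.continuousAt
    rw [ContinuousAt, hψx] at hcψ
    have ht' : ∀ᶠ q : B × F in 𝓝 (b, x₁), q.2 ∈ (extChartAt 𝓘(K, F) y).target :=
      continuousAt_snd.eventually (extChartAt_target_mem_nhds (I := 𝓘(K, F)) y)
    have hs' : ∀ᶠ x' in 𝓝 x₁, (extChartAt 𝓘(K, F) y).symm x' ∈ (extChartAt 𝓘(K, F) y₀).source := by
      refine (continuousAt_extChartAt_symm y).eventually
        (p := fun z => z ∈ (extChartAt 𝓘(K, F) y₀).source) ?_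
      rw [extChartAt_to_inv]
      exact (isOpen_extChartAt_source y₀).mem_nhds hy
    have hs'' : ∀ᶠ q : B × F in 𝓝 (b, x₁),
        (extChartAt 𝓘(K, F) y).symm q.2 ∈ (extChartAt 𝓘(K, F) y₀).source :=
      Filter.Tendsto.eventually (f := Prod.snd) (continuousAt_snd (p := (b, x₁))) hs'
    filter_upwards [hcψ.eventually hq, ht', hs''] with q h1 h2 h3 w
    refine alternating_eq_of_basis (chartForm (η q.1) y q.2) W.incl.toLinearMap
      (fun r => θ (q.1, ψ q.2) fun i => fderiv K ψ q.2 (Module.finBasis K F (r i)))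
      (fun r => ?_) w
    rw [chartForm_change (η q.1) h2 h3]
    exact h1 _

end FormGerms

/-! ### Admissibility can be tested at the identity of `G` -/

section Translation

variable {K : Type u} [NontriviallyNormedField K]
  {V : Type u} [AddCommGroup V] [Module K V] [TopologicalSpace V]

/-- The image of a BH-space under a continuous linear automorphism of `V`. -/
def BHSpace.map (A : V ≃L[K] V) (W : BHSpace K V) : BHSpace K V where
  carrier := W.carrier
  incl := (A : V →L[K] V) ∘L W.incl
  injective := A.injective.comp W.injective

variable
  {EG : Type*} [NormedAddCommGroup EG] [NormedSpace K EG] {HG : Type*} [TopologicalSpace HG]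
  {IG : ModelWithCorners K EG HG}
  {G : Type*} [Group G] [TopologicalSpace G] [ChartedSpace HG G] [LieGroup IG ω G]
  {ρ : G →* (V ≃L[K] V)}
  {EB : Type*} [NormedAddCommGroup EB] [NormedSpace K EB] {HB : Type*} [TopologicalSpace HB]
  {I : ModelWithCorners K EB HB} {B : Type*} [TopologicalSpace B] [ChartedSpace HB B]
  {F : Type*} [NormedAddCommGroup F] [NormedSpace K F]
  {Y : Type*} [TopologicalSpace Y] [ChartedSpace F Y] {k : ℕ}

/-- For `g'` near `g` the element `g⁻¹ g'` is near `1`, and `g' η = g ((g⁻¹ g') η)`. The fixed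
automorphism `ρ g` is absorbed into the BH-space. -/
theorem LocalRep.translate {η : B → VForm K V F Y k} {b₀ : B} {y₀ : Y} {W : BHSpace K V}
    {θ : (G × B) × F → F [⋀^Fin k]→L[K] W.carrier}
    (h : LocalRep (IG.prod I) (hatForm ρ η) (1, b₀) y₀ W θ) (g : G) :
    LocalRep (IG.prod I) (hatForm ρ η) (g, b₀) y₀ (W.map (ρ g))
      (fun q => θ ((g⁻¹ * q.1.1, q.1.2), q.2)) := by
  have hφ : ContMDiffAt (IG.prod I) (IG.prod I) ω (fun p : G × B => (g⁻¹ * p.1, p.2)) (g, b₀) :=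
    ContMDiffAt.prodMk (ContMDiffAt.comp (g, b₀) (contMDiff_mul_left (a := g⁻¹)).contMDiffAt
      contMDiffAt_fst) contMDiffAt_snd
  have h1 : LocalRep (IG.prod I) (fun p : G × B => hatForm ρ η (g⁻¹ * p.1, p.2)) (g, b₀) y₀ W
      (fun q => θ ((g⁻¹ * q.1.1, q.1.2), q.2)) := by
    refine LocalRep.comp (φ := fun p : G × B => (g⁻¹ * p.1, p.2)) ?_ hφ
    rw [inv_mul_cancel]
    exact h
  refine ⟨h1.1, ?_⟩
  filter_upwards [h1.2] with q hq w
  have h2 := congrArg (ρ g) (hq w)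
  refine Eq.trans ?_ h2
  change ρ q.1.1 _ = ρ g (ρ (g⁻¹ * q.1.1) _)
  have h3 : ρ q.1.1 = ρ g * ρ (g⁻¹ * q.1.1) := by rw [← map_mul, mul_inv_cancel_left]
  rw [h3]
  rfl

theorem LocalRep.of_hatForm {η : B → VForm K V F Y k} {b₀ : B} {y₀ : Y} {W : BHSpace K V}
    {θ : (G × B) × F → F [⋀^Fin k]→L[K] W.carrier}
    (h : LocalRep (IG.prod I) (hatForm ρ η) (1, b₀) y₀ W θ) :
    LocalRep I η b₀ y₀ W (fun q => θ ((1, q.1), q.2)) := by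
  have h1 : LocalRep I (fun b => hatForm ρ η (1, b)) b₀ y₀ W (fun q => θ ((1, q.1), q.2)) :=
    LocalRep.comp (φ := fun b : B => ((1 : G), b)) h
      (ContMDiffAt.prodMk contMDiffAt_const contMDiffAt_id)
  have e : (fun b => hatForm ρ η (1, b)) = η := by
    funext b y
    ext v
    simp [hatForm]
  rwa [e] at h1

theorem isAdmissibleForm_of_localRep [CompleteSpace K] [FiniteDimensional K F] [IsManifold I ω B]
    [IsManifold 𝓘(K, F) ω Y] {η : B → VForm K V F Y k}
    (h : ∀ b y, ∃ W θ, LocalRep (IG.prod I) (hatForm ρ η) ((1 : G), b) y W θ) :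
    IsAdmissibleForm IG ρ I η := by
  refine ⟨isAnalyticForm_of_localRep fun b y => ?_,
    isAnalyticForm_of_localRep fun p y => ?_⟩
  · obtain ⟨W, θ, hθ⟩ := h b y
    exact ⟨W, _, hθ.of_hatForm⟩
  · obtain ⟨W, θ, hθ⟩ := h p.2 y
    exact ⟨_, _, hθ.translate p.1⟩

end Translation

/-! ### Primitives of admissible closed forms -/

section LocalPrimitives

variable {K : Type u} [NontriviallyNormedField K] [CompleteSpace K] [CharZero K]
  {V : Type u} [AddCommGroup V] [Module K V] [TopologicalSpace V] [IsTopologicalAddGroup V]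
  [ContinuousSMul K V] [T2Space V]
  {F : Type*} [NormedAddCommGroup F] [NormedSpace K F] [FiniteDimensional K F] {k : ℕ}

/-- The automorphism `A` need not preserve the image of `W` in `V`. Vectors of `W` and of its
translate are compared in a BH-space that receives both. -/
theorem BHSpace.exists_sum_map (W : BHSpace K V) (A : V ≃L[K] V) :
    ∃ (W' : BHSpace K V) (j₁ j₂ : W.carrier →L[K] W'.carrier),
      (∀ w, W'.incl (j₁ w) = A (W.incl w)) ∧ ∀ w, W'.incl (j₂ w) = W.incl w := by
  obtain ⟨W', j, hj⟩ := exists_bhSpace_sum (fun b : Bool => cond b (W.map A) W)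
  exact ⟨W', j true, j false, hj true, hj false⟩

/-- An automorphism of `V` carrying the right hand side of one Euler equation to that of another
carries the solution of the former to that of the latter. -/
theorem BHSpace.map_eq_of_euler (W : BHSpace K V) (A : V ≃L[K] V)
    {f₁ f₂ : F → F [⋀^Fin k]→L[K] W.carrier}
    {p₁ p₂ : FormalMultilinearSeries K F (F [⋀^Fin k]→L[K] W.carrier)} {x₀ : F} {r : ENNReal}
    (h₁ : HasFPowerSeriesOnBall f₁ p₁ x₀ r) (h₂ : HasFPowerSeriesOnBall f₂ p₂ x₀ r)
    {c : ℕ} (hc : c ≠ 0)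
    (he : ∀ᶠ x in 𝓝 x₀, ∀ w, A (W.incl (((c : K) • f₁ x + fderiv K f₁ x (x - x₀)) w)) =
      W.incl (((c : K) • f₂ x + fderiv K f₂ x (x - x₀)) w))
    {x : F} (hx : x ∈ Metric.eball x₀ r) (w : Fin k → F) :
    A (W.incl (f₁ x w)) = W.incl (f₂ x w) := by
  obtain ⟨W', j₁, j₂, hj₁, hj₂⟩ := W.exists_sum_map A
  let L₁ : (F [⋀^Fin k]→L[K] W.carrier) →L[K] W'.carrier :=
    j₁ ∘L ContinuousAlternatingMap.apply K F W.carrier w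
  let L₂ : (F [⋀^Fin k]→L[K] W.carrier) →L[K] W'.carrier :=
    j₂ ∘L ContinuousAlternatingMap.apply K F W.carrier w
  -- For fixed `w` the difference takes values in the Banach space `W'`, where it solves the
  -- homogeneous Euler equation. Injectivity of `W'.incl` brings the equation from `V` to `W'`.
  have hu := (L₁.comp_hasFPowerSeriesOnBall h₁).sub (L₂.comp_hasFPowerSeriesOnBall h₂)
  have hball : ∀ᶠ x in 𝓝 x₀, x ∈ Metric.eball x₀ r := Metric.eball_mem_nhds x₀ h₁.r_pos
  have h0 := hu.eq_zero_of_euler (c := c) (fun h => absurd h hc) (by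
    filter_upwards [he, hball] with x hx hxr
    have d₁ := (h₁.analyticAt_of_mem hxr).differentiableAt.hasFDerivAt
    have d₂ := (h₂.analyticAt_of_mem hxr).differentiableAt.hasFDerivAt
    have d : HasFDerivAt (L₁ ∘ f₁ - L₂ ∘ f₂) (L₁ ∘L fderiv K f₁ x - L₂ ∘L fderiv K f₂ x) x :=
      (L₁.hasFDerivAt.comp x d₁).sub (L₂.hasFDerivAt.comp x d₂)
    rw [d.fderiv]
    have h := hx w
    rw [← hj₁, ← hj₂] at h
    have h' : L₁ ((c : K) • f₁ x + fderiv K f₁ x (x - x₀)) =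
        L₂ ((c : K) • f₂ x + fderiv K f₂ x (x - x₀)) := W'.injective h
    rw [map_add, map_add, map_smul, map_smul] at h'
    change (c : K) • (L₁ (f₁ x) - L₂ (f₂ x)) +
      (L₁ (fderiv K f₁ x (x - x₀)) - L₂ (fderiv K f₂ x (x - x₀))) = 0
    rw [smul_sub, sub_add_sub_comm, h', sub_self]) hx
  have h1 : j₁ (f₁ x w) = j₂ (f₂ x w) := sub_eq_zero.1 h0
  rw [← hj₁, h1, hj₂]

variable [IsUltrametricDist K]
  {EG : Type*} [NormedAddCommGroup EG] [NormedSpace K EG] {HG : Type*} [TopologicalSpace HG]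
  {IG : ModelWithCorners K EG HG} [IG.Boundaryless]
  {G : Type*} [Group G] [TopologicalSpace G] [ChartedSpace HG G] [LieGroup IG ω G]
  {ρ : G →* (V ≃L[K] V)}
  {EB : Type*} [NormedAddCommGroup EB] [NormedSpace K EB] {HB : Type*} [TopologicalSpace HB]
  {I : ModelWithCorners K EB HB} [I.Boundaryless]
  {B : Type*} [TopologicalSpace B] [ChartedSpace HB B] [IsManifold I ω B]
  {Y : Type*} [TopologicalSpace Y] [ChartedSpace F Y] [IsManifold 𝓘(K, F) ω Y]

theorem chartForm_hatForm (η : B → VForm K V F Y k) (a : G × B) (y₀ : Y) (x : F) (w : Fin k → F) :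
    chartForm (hatForm ρ η a) y₀ x w = ρ a.1 (chartForm (η a.2) y₀ x w) :=
  rfl

/-- The Poincaré lemma is applied to `g η` with parameters `(g, b)`, and the slice `g = 1` defines
`ζ`. The conclusion holds at all points near `(b₀, y₀)`, as gluing along an open partition requires.
-/
theorem IsAdmissibleForm.exists_local_primitive {η : B → VForm K V F Y (k + 1)}
    (hη : IsAdmissibleForm IG ρ I η) (hd : ∀ b, _root_.formD (η b) = 0) (b₀ : B) (y₀ : Y) :
    ∃ ζ : B → VForm K V F Y k, ∀ᶠ p : B × Y in 𝓝 (b₀, y₀),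
      (∃ W θ, LocalRep (IG.prod I) (hatForm ρ ζ) ((1 : G), p.1) p.2 W θ) ∧
        _root_.formD (ζ p.1) p.2 = η p.1 p.2 := by
  obtain ⟨W, θ, hθ⟩ := hη.2.exists_localRep ((1 : G), b₀) y₀
  set x₀ := extChartAt 𝓘(K, F) y₀ y₀ with hx₀
  -- The derivative commutes with `ρ g`, so `g η` is closed. Injectivity of `W.incl` makes its
  -- representative closed.
  have hcl : ∀ᶠ q : (G × B) × F in 𝓝 (((1 : G), b₀), x₀),
      extDeriv (fun x => θ (q.1, x)) q.2 = 0 := by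
    filter_upwards [hθ.formD.2] with q hq
    ext w
    apply W.injective
    rw [← hq w]
    have h0 : _root_.formD (hatForm ρ η q.1) = 0 := by
      refine (hη.1.formD_clm (ρ q.1.1 : V →L[K] V) q.1.2).trans ?_
      rw [hd]
      funext y
      ext v
      simp
    rw [h0]
    exact (map_zero W.incl).symm
  obtain ⟨f, hf, he, hx, r, hr, hp⟩ := hθ.1.exists_primitive hcl
  let α : B → F → F [⋀^Fin k]→ₗ[K] V := fun b x =>
    W.incl.toLinearMap.compAlternatingMap
      ((f ((1, b), x)).curryLeft (x - x₀)).toAlternatingMap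
  let ζ : B → VForm K V F Y k := fun b => formOfChart y₀ (α b)
  have hone : ContinuousAt (fun a : G × B => ((1 : G), a.2)) ((1 : G), b₀) :=
    (continuous_const.prodMk continuous_snd).continuousAt
  -- Both sides solve the Euler equation with right hand side `g η`. The comparison holds on the
  -- fixed ball of radius `r` for all `(g, b)` near `(1, b₀)`, which makes a neighbourhood in the
  -- product.
  have hcomm : ∀ᶠ q : (G × B) × F in 𝓝 (((1 : G), b₀), x₀), ∀ w,
      ρ q.1.1 (W.incl (f ((1, q.1.2), q.2) w)) = W.incl (f q w) := by
    have hb : ∀ᶠ a : G × B in 𝓝 ((1 : G), b₀), ∀ x ∈ Metric.eball x₀ r, ∀ w,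
        ρ a.1 (W.incl (f ((1, a.2), x) w)) = W.incl (f (a, x) w) := by
      have h1 := he.and hθ.2
      rw [nhds_prod_eq] at h1
      have h2 := h1.curry
      filter_upwards [h2, hone.eventually h2, hp, hone.eventually hp] with a e₁ e₂ ⟨p₁, hp₁⟩
        ⟨p₂, hp₂⟩ x hx w
      refine W.map_eq_of_euler (ρ a.1) hp₂ hp₁ (Nat.succ_ne_zero k) ?_ hx w
      filter_upwards [e₁, e₂] with x hx₁ hx₂ w
      have h₁ := hx₁.2 w
      have h₂ := hx₂.2 w
      have t₁ := hx₁.1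
      have t₂ := hx₂.1
      rw [t₁, t₂, ← h₁, ← h₂, chartForm_hatForm, chartForm_hatForm, map_one]
      rfl
    filter_upwards [hb.prod_inl_nhds x₀, (Filter.Eventually.prod_inr_nhds
      (Metric.eball_mem_nhds x₀ hr : ∀ᶠ x in 𝓝 x₀, x ∈ Metric.eball x₀ r) ((1 : G), b₀))]
      with q h1 h2 w using h1 _ h2 w
  have ht : ∀ᶠ q : (G × B) × F in 𝓝 (((1 : G), b₀), x₀),
      q.2 ∈ (extChartAt 𝓘(K, F) y₀).target :=
    continuousAt_snd.eventually (extChartAt_target_mem_nhds (I := 𝓘(K, F)) y₀)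
  -- By `hcomm` the form `g ζ` is represented by the contraction of `f` at `(g, b)`, which is
  -- analytic in `g` as well.
  have hζ : LocalRep (IG.prod I) (hatForm ρ ζ) ((1 : G), b₀) y₀ W
      (fun q => (f q).curryLeft (q.2 - x₀)) := by
    refine ⟨?_, ?_⟩
    · let C : (F [⋀^Fin (k + 1)]→L[K] W.carrier) →L[K] (F →L[K] F [⋀^Fin k]→L[K] W.carrier) :=
        (ContinuousAlternatingMap.curryLeftLI (𝕜 := K) (E := F) (F := W.carrier)
          (n := k)).toContinuousLinearMap
      have h1 := (ContinuousLinearMap.contMDiff (n := ω) (E := F [⋀^Fin (k + 1)]→L[K] W.carrier)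
        (F := F →L[K] F [⋀^Fin k]→L[K] W.carrier) C).contMDiffAt.comp _ hf
      have h2 : ContMDiffAt ((IG.prod I).prod 𝓘(K, F)) 𝓘(K, F) ω
          (fun q : (G × B) × F => q.2 - x₀) (((1 : G), b₀), x₀) :=
        contMDiffAt_snd.sub contMDiffAt_const
      exact ContMDiffAt.clm_apply h1 h2
    · filter_upwards [hcomm, ht] with q hq hqt w
      rw [chartForm_hatForm, chartForm_formOfChart y₀ _ hqt]
      exact hq _
  refine ⟨ζ, ?_⟩
  have hc₁ : ContinuousAt (fun p : B × Y => (((1 : G), p.1), p.2)) (b₀, y₀) := by fun_prop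
  have hc₂ : ContinuousAt (fun p : B × Y => (p.1, extChartAt 𝓘(K, F) y₀ p.2)) (b₀, y₀) :=
    ContinuousAt.prodMk continuousAt_fst (ContinuousAt.comp (x := (b₀, y₀)) (f := Prod.snd)
      (continuousAt_extChartAt y₀) continuousAt_snd)
  have hc₃ : ContinuousAt (fun p : B × F => (((1 : G), p.1), p.2)) (b₀, x₀) := by fun_prop
  have hs : ∀ᶠ p : B × Y in 𝓝 (b₀, y₀), p.2 ∈ (extChartAt 𝓘(K, F) y₀).source :=
    continuousAt_snd.eventually (extChartAt_source_mem_nhds y₀)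
  filter_upwards [hc₁.eventually hζ.eventually, hc₂.eventually hζ.of_hatForm.formD.2,
    hc₂.eventually (hc₃.eventually hx), hc₂.eventually hθ.of_hatForm.2, hs] with p h1 h2 h3 h4 hp
  refine ⟨⟨W, h1⟩, VForm.eq_of_chartForm_eq hp fun w => ?_⟩
  have h2' := h2 w
  rw [h3] at h2'
  exact h2'.trans (h4 w).symm

/-- Admissible closed forms of positive degree are exact. -/
theorem IsAdmissibleForm.exists_primitive (hT : HasOpenPartitions (B × Y))
    {η : B → VForm K V F Y (k + 1)}
    (hη : IsAdmissibleForm IG ρ I η) (hd : ∀ b, _root_.formD (η b) = 0) :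
    ∃ ζ : B → VForm K V F Y k, IsAdmissibleForm IG ρ I ζ ∧ ∀ b, _root_.formD (ζ b) = η b := by
  choose ζ hζ using fun p : B × Y => hη.exists_local_primitive hd p.1 p.2
  -- The blocks are disjoint and open, so primitives chosen on different blocks need not agree. Near
  -- each point the glued form is one local primitive.
  obtain ⟨s, hs, hN⟩ := hT _ hζ
  refine ⟨fun b y => ζ (s (b, y)) b y, isAdmissibleForm_of_localRep fun b y => ?_,
    fun b => funext fun y => ?_⟩
  · obtain ⟨W, θ, h⟩ := (hN (b, y)).1
    refine ⟨W, θ, h.congr_nhds ?_⟩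
    have hc : ContinuousAt (fun p : (G × B) × Y => (p.1.2, p.2)) (((1 : G), b), y) := by fun_prop
    filter_upwards [hc.eventually (hs.eventually_eq (b, y))] with p hp
    simp only [hatForm, hp]
  · refine (formD_congr (η := ζ (s (b, y)) b) ?_).trans (hN (b, y)).2
    have hc : ContinuousAt (fun z : Y => (b, z)) y := by fun_prop
    filter_upwards [hc.eventually (hs.eventually_eq (b, y))] with z hz
    simp only [hz]

theorem isLocConstAlong_of_formD_eq_zero {η : B → VForm K V F Y 0} (hη : IsAnalyticForm I η)
    (hd : ∀ b, formD (η b) = 0) : IsLocConstAlong fun b y => η b y 0 := by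
  intro b₀ y₀
  obtain ⟨W, θ, hθ⟩ := hη.exists_localRep b₀ y₀
  set x₀ := extChartAt 𝓘(K, F) y₀ y₀ with hx₀
  have hcl : ∀ᶠ q : B × F in 𝓝 (b₀, x₀), fderiv K (fun x => θ (q.1, x)) q.2 = 0 := by
    filter_upwards [hθ.formD.2] with q hq
    have h0 : extDeriv (fun x => θ (q.1, x)) q.2 = 0 := by
      ext w
      apply W.injective
      rw [← hq w, hd]
      exact (map_zero W.incl).symm
    -- For a `0`-form the alternatization has a single summand, so `dθ = 0` means that the
    -- derivative vanishes.
    ext v w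
    have h1 := congrArg (fun a => a (fun _ => v)) h0
    simp only [extDeriv, ContinuousAlternatingMap.alternatizeUncurryFin_apply] at h1
    rw [Subsingleton.elim w (Fin.removeNth 0 fun _ => v)]
    simpa using h1
  have hconst := hθ.1.eventually_eq_of_fderiv_eq_zero hcl
  have hc₂ : ContinuousAt (fun p : B × Y => (p.1, extChartAt 𝓘(K, F) y₀ p.2)) (b₀, y₀) :=
    ContinuousAt.prodMk continuousAt_fst (ContinuousAt.comp (x := (b₀, y₀)) (f := Prod.snd)
      (continuousAt_extChartAt y₀) continuousAt_snd)
  have hs : ∀ᶠ p : B × Y in 𝓝 (b₀, y₀), p.2 ∈ (extChartAt 𝓘(K, F) y₀).source :=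
    continuousAt_snd.eventually (extChartAt_source_mem_nhds y₀)
  have hev : ∀ᶠ p : B × Y in 𝓝 (b₀, y₀), η p.1 p.2 0 = W.incl (θ (p.1, x₀) 0) := by
    filter_upwards [hc₂.eventually hθ.2, hc₂.eventually hconst, hs] with p h1 h2 hp
    rw [← h2, ← h1 0]
    change _ = η p.1 ((extChartAt 𝓘(K, F) y₀).symm (extChartAt 𝓘(K, F) y₀ p.2)) _
    have key : ∀ z, z = p.2 → ∀ v, η p.1 p.2 0 = η p.1 z v := by
      rintro z rfl v
      exact congrArg _ (Subsingleton.elim _ _)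
    exact key _ ((extChartAt 𝓘(K, F) y₀).left_inv hp) _
  rw [nhds_prod_eq] at hev
  obtain ⟨N, hN, N', hN', h⟩ := Filter.mem_prod_iff.1 hev
  refine ⟨N, hN, N', hN', fun b hb y₁ h₁ y₂ h₂ => ?_⟩
  exact (h (Set.mk_mem_prod hb h₁)).trans (h (Set.mk_mem_prod hb h₂)).symm

theorem IsAdmissibleForm.isAdmissible_apply {η : B → VForm K V F Y 0}
    (hη : IsAdmissibleForm IG ρ I η) :
    IsAdmissible IG ρ (I.prod 𝓘(K, F)) fun p : B × Y => η p.1 p.2 0 := by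
  refine ⟨fun p => ?_, fun p => ?_⟩
  · refine (hη.1 Set.univ isOpen_univ (fun i => i.elim0) (fun i => i.elim0) p trivial).congr ?_
    exact Filter.Eventually.of_forall fun q => congrArg _ (Subsingleton.elim _ _)
  · have h1 : ContMDiffAt (IG.prod (I.prod 𝓘(K, F))) ((IG.prod I).prod 𝓘(K, F)) ω
        (fun q : G × (B × Y) => ((q.1, q.2.1), q.2.2)) p :=
      (contMDiffAt_fst.prodMk (contMDiffAt_fst.comp p contMDiffAt_snd)).prodMk
        (contMDiffAt_snd.comp p contMDiffAt_snd)
    have h2 := hη.2 Set.univ isOpen_univ (fun i => i.elim0) (fun i => i.elim0)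
      ((p.1, p.2.1), p.2.2) trivial
    refine (VAnalyticAt.comp (φ := fun q : G × (B × Y) => ((q.1, q.2.1), q.2.2)) h2 h1).congr ?_
    exact Filter.Eventually.of_forall fun q =>
      congrArg (fun v => ρ q.1 (η q.2.1 q.2.2 v)) (Subsingleton.elim _ _)

end LocalPrimitives

theorem mainTheorem6
    {K : Type u} [NontriviallyNormedField K] [IsUltrametricDist K] [CompleteSpace K] [CharZero K]
    {V : Type u} [AddCommGroup V] [Module K V] [TopologicalSpace V] [IsTopologicalAddGroup V]
    [ContinuousSMul K V] [T2Space V]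
    [IsLinearTopology (NormedField.valuation (K := K)).integer V]
    {dG : ℕ} {G : Type u} [Group G] [TopologicalSpace G] [ChartedSpace (Fin dG → K) G]
    [LieGroup 𝓘(K, Fin dG → K) ω G] [T2Space G]
    (ρ : G →* (V ≃L[K] V)) (hρ : IsLocallyAnalyticRep 𝓘(K, Fin dG → K) ρ)
    (Y : LaMan K) :
    QuasiIso (deRhamInclusion 𝓘(K, Fin dG → K) ρ Y) := by
  refine quasiIso_deRhamInclusion _ ρ Y (fun X s hs hd => ?_) fun k X s hs hd => ?_
  -- A `0`-form is determined by its value on the empty tuple, of which `0` is a name.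
  · refine ⟨fun x y => s x y 0, ⟨IsAdmissibleForm.isAdmissible_apply hs,
      isLocConstAlong_of_formD_eq_zero hs.1 hd⟩, fun x => ?_⟩
    funext y
    ext v
    exact congrArg (s x y) (Subsingleton.elim 0 v)
  · exact IsAdmissibleForm.exists_primitive
      (hasOpenPartitions_prod (M := Fin X.dim → K) (M' := Fin Y.dim → K)) hs hd
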